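/- **Conventions.** A weighted directed graph on $\{1,\dots,n\}$ is given by its adjacency matrix $A\ge 0$, with $A(i,j)$ the weight of the edge $(i,j)$ (self-loops allowed). Its directed Laplacian is $L_A=D_A-A^T$, with $D_A$ the diagonal matrix of out-degrees $\sum_jA(i,j)$. Its undirectification $\mathcal U(A)$ has adjacency matrix $\frac12(A+A^T)$. $\mathrm{nnz}$ is the number of non-zero entries, $M^{+/2}$ is the square root of the Moore–Penrose pseudoinverse of a positive semidefinite matrix $M$, and $\preceq$ is the Loewner order. A graph $\tilde A$ is an *$\epsilon$-graph-approximation* of $A$ if, with $U=L_{\mathcal U(A)}$, the matrix $U$ is positive semidefinite, $\ker U\subseteq\ker(L_{\tilde A}-L_A)\cap\ker((L_{\tilde A}-L_A)^T)$, and $\|U^{+/2}(L_{\tilde A}-L_A)U^{+/2}\|_2\le\epsilon$. Let $a,b\in\mathbb R^n_{\ge0}$ be non-zero with $\|a\|_1=\|b\|_1=d$. The *directed product graph* $\vec G(a,b)$ has adjacency matrix $ba^T/d$, hence Laplacian $\mathrm{diag}(b)-ab^T/d$. For $C\in\mathbb R^{n\times n}$ put $$L(C)=\begin{pmatrix}\mathrm{diag}(b)&0\\0&\mathrm{diag}(a)\end{pmatrix}-\begin{pmatrix}0&C\\C^T&0\end{pmatrix}.$$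 The undirected *bipartite product graph* has Laplacian $L_{G(a,b)}=L(ba^T/d)$. A *(degree-preserving) $\delta$-bipartite-sparsifier with constant $K$* of it is a matrix $L=L(C)$ with $C\ge0$ entrywise and $L\mathbf 1=0$ (so that $L$ is the Laplacian of a bipartite graph with the same degrees), such that $(1-\delta)L\preceq L_{G(a,b)}\preceq(1+\delta)L$ and $\mathrm{nnz}(L)\le K(\mathrm{nnz}(a)+\mathrm{nnz}(b))/\delta^4$. SparseProduct$(a,b,\epsilon)$ computes an $\epsilon/128$-bipartite-sparsifier $L$ and returns the directed graph $\tilde A$ for which $\tilde A^T$ is the bottom left block of the adjacency matrix of the bipartite graph, i.e. $\tilde A=C$. **Lemma.** Let $0<\epsilon\le 1/2$, and let $a,b\in\mathbb R^n_{\ge0}$ be non-zero with $\|a\|_1=\|b\|_1$. 1. For every $K$ and every $\epsilon/128$-bipartite-sparsifier $L$ with constant $K$, the matrix $\tilde A$ obtained from $L$ as above is entrywise non-negative and is an $\epsilon$-graph-approximation of $\vec G(a,b)$; the in-degrees and the out-degrees of $\tilde A$ and of $\vec G(a,b)$ are identical; and $\mathrm{nnz}(\tilde A)$ and $\mathrm{nnz}(L_{\tilde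 A})$ are at most $128^4K(\mathrm{nnz}(a)+\mathrm{nnz}(b))\epsilon^{-4}$. 2. There are a single deterministic real-RAM program SparseProduct and an absolute constant $K>0$ such that for all such $n,a,b,\epsilon$, with $a$ and $b$ given as lists of their non-zero entries in any order, the program halts after at most $K(\mathrm{nnz}(a)+\mathrm{nnz}(b))\epsilon^{-4}$ steps and outputs the list of the non-zero entries of a matrix $\tilde A$ obtained as above from some $\epsilon/128$-bipartite-sparsifier with constant $K$. This $\tilde A$ is an $\epsilon$-graph-approximation of $\vec G(a,b)$ with identical in- and out-degrees, and $\mathrm{nnz}(\tilde A)$ and $\mathrm{nnz}(L_{\tilde A})$ are at most $K(\mathrm{nnz}(a)+\mathrm{nnz}(b))\epsilon^{-4}$. (Real RAM: registers and arrays of real numbers, integer constants; each exact operation $+,-,\times,/$, each comparison and each array access at a natural-number index costs one step; there is no rounding operation; memory outside the input is initially $0$.) -/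

import Mathlib

open Matrix

noncomputable section

/-! ### Vectors, matrices and weighted graphs

A weighted directed graph on `ι` is given by its adjacency matrix `A`, where `A i j` is the weight
of the edge from `i` to `j` (and `0` if there is none). -/

/-- The number of non-zero entries of a vector. -/
def nnz {ι : Type} (v : ι → ℝ) : ℕ := Nat.card {i : ι // v i ≠ 0}

/-- The number of non-zero entries of a matrix. -/
def matNnz {ι : Type} (M : Matrix ι ι ℝ) : ℕ := nnz (fun p : ι × ι => M p.1 p.2)

/-- The `ℓ₁` norm of a vector. -/
def l1Norm {n : ℕ} (v : Fin n → ℝ) : ℝ := ∑ i, |v i|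

/-- Weighted out-degrees. -/
def outDeg {n : ℕ} (A : Matrix (Fin n) (Fin n) ℝ) (i : Fin n) : ℝ := ∑ j, A i j

/-- Weighted in-degrees. -/
def inDeg {n : ℕ} (A : Matrix (Fin n) (Fin n) ℝ) (j : Fin n) : ℝ := ∑ i, A i j

/-- The directed Laplacian `D - Aᵀ`, with `D` the diagonal matrix of out-degrees. -/
def dirLap {n : ℕ} (A : Matrix (Fin n) (Fin n) ℝ) : Matrix (Fin n) (Fin n) ℝ :=
  diagonal (outDeg A) - Aᵀ

/-- The undirectification: the edge `{u, v}` gets the weight `(A u v + A v u) / 2`. -/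
def undirectify {n : ℕ} (A : Matrix (Fin n) (Fin n) ℝ) : Matrix (Fin n) (Fin n) ℝ :=
  (1 / 2 : ℝ) • (A + Aᵀ)

/-- The spectral norm of a square matrix. -/
def specNorm {n : ℕ} (M : Matrix (Fin n) (Fin n) ℝ) : ℝ :=
  ‖toEuclideanCLM (n := Fin n) (𝕜 := ℝ) M‖

/-- `M^{+/2}`, the square root of the Moore-Penrose pseudoinverse of a positive semidefinite
matrix `M`: the eigenvalue `0` is kept and an eigenvalue `x > 0` becomes `1 / √x`. -/
def pinvSqrt {n : ℕ} (M : Matrix (Fin n) (Fin n) ℝ) : Matrix (Fin n) (Fin n) ℝ :=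
  cfc (fun x : ℝ => (√x)⁻¹) M

/-- The directed graph `At` is an `ε`-graph-approximation of the directed graph `A`. With
`U = L_{𝒰(G)}` the Laplacian of the undirectification of `A`: `U` is positive semidefinite, its
kernel lies in the kernels of `L_{At} - L_A` and of its transpose, and
`‖U^{+/2} (L_{At} - L_A) U^{+/2}‖₂ ≤ ε`. -/
def IsGraphApprox {n : ℕ} (ε : ℝ) (At A : Matrix (Fin n) (Fin n) ℝ) : Prop :=
  (dirLap (undirectify A)).PosSemidef ∧
  (∀ x : Fin n → ℝ, dirLap (undirectify A) *ᵥ x = 0 →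
    (dirLap At - dirLap A) *ᵥ x = 0 ∧ (dirLap At - dirLap A)ᵀ *ᵥ x = 0) ∧
  specNorm (pinvSqrt (dirLap (undirectify A)) * (dirLap At - dirLap A) *
    pinvSqrt (dirLap (undirectify A))) ≤ ε

/-! ### Product graphs -/

/-- The adjacency matrix `b aᵀ / d` of the directed product graph of `a` and `b`, where
`d = ‖a‖₁`. -/
def prodAdj {n : ℕ} (a b : Fin n → ℝ) : Matrix (Fin n) (Fin n) ℝ :=
  (l1Norm a)⁻¹ • vecMulVec b a

/-- The Laplacian of the directed product graph is `diag(b) - a bᵀ / d`. -/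
theorem dirLap_prodAdj {n : ℕ} (a b : Fin n → ℝ) (ha : ∀ i, 0 ≤ a i) (ha0 : a ≠ 0) :
    dirLap (prodAdj a b) = diagonal b - (l1Norm a)⁻¹ • vecMulVec a b := by
  have hd : ∑ i, a i = l1Norm a := by
    unfold l1Norm
    exact Finset.sum_congr rfl fun i _ => (abs_of_nonneg (ha i)).symm
  have hpos : l1Norm a ≠ 0 := by
    rw [← hd]
    intro h
    apply ha0
    funext i
    exact (Finset.sum_eq_zero_iff_of_nonneg fun i _ => ha i).1 h i (Finset.mem_univ i)
  have hout : outDeg (prodAdj a b) = b := by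
    funext i
    simp only [outDeg, prodAdj, Matrix.smul_apply, vecMulVec_apply, smul_eq_mul]
    rw [← Finset.mul_sum, ← Finset.mul_sum, hd]
    field_simp
  unfold dirLap
  rw [hout]
  congr 1
  ext i j
  simp [prodAdj, vecMulVec_apply, mul_comm]

/-- The matrix `diag(b, a) - (0, C; Cᵀ, 0)` on two copies of `Fin n`. -/
def bipLap {n : ℕ} (a b : Fin n → ℝ) (C : Matrix (Fin n) (Fin n) ℝ) :
    Matrix (Fin n ⊕ Fin n) (Fin n ⊕ Fin n) ℝ :=
  fromBlocks (diagonal b) (-C) (-Cᵀ) (diagonal a)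

/-- The Laplacian of the undirected bipartite product graph of `a` and `b`. -/
def bipProdLap {n : ℕ} (a b : Fin n → ℝ) : Matrix (Fin n ⊕ Fin n) (Fin n ⊕ Fin n) ℝ :=
  bipLap a b (prodAdj a b)

/-- `L` is an `ε`-bipartite-sparsifier of the bipartite product graph of `a` and `b`, with constant
`K` in the sparsity bound: it is the Laplacian of a bipartite graph with non-negative weights and
with the degrees of the product graph, it approximates the Laplacian of the product graph within
`1 ± ε` in the Loewner order, and it is sparse. -/
def IsBipartiteSparsifier {n : ℕ} (K ε : ℝ) (a b : Fin n → ℝ)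
    (L : Matrix (Fin n ⊕ Fin n) (Fin n ⊕ Fin n) ℝ) : Prop :=
  (∃ C : Matrix (Fin n) (Fin n) ℝ, (∀ i j, 0 ≤ C i j) ∧ L = bipLap a b C) ∧
  L *ᵥ (fun _ => 1) = 0 ∧
  (bipProdLap a b - (1 - ε) • L).PosSemidef ∧
  ((1 + ε) • L - bipProdLap a b).PosSemidef ∧
  (matNnz L : ℝ) ≤ K * ((nnz a : ℝ) + (nnz b : ℝ)) / ε ^ 4

/-- The directed graph returned for the bipartite graph with Laplacian `L`: the transpose of its
adjacency matrix is the bottom left block of the adjacency matrix of the bipartite graph. -/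
def blockAdj {n : ℕ} (L : Matrix (Fin n ⊕ Fin n) (Fin n ⊕ Fin n) ℝ) :
    Matrix (Fin n) (Fin n) ℝ :=
  (-L.toBlocks₂₁)ᵀ

/-! ### The real RAM

Registers and array cells hold real numbers. A program names finitely many registers and arrays;
arrays are addressed indirectly, by a register that holds a natural number. Every arithmetic
operation, memory access and comparison is exact and costs one step. A division by zero and an
array access at an index that is not a natural number have no continuation. -/

/-- A memory state: the registers and the arrays. -/
structure RAMState where
  reg : ℕ → ℝ
  arr : ℕ → ℕ → ℝ

/-- Write a register. -/
def RAMState.setReg (s : RAMState) (r : ℕ) (v : ℝ) : RAMState :=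
  { s with reg := Function.update s.reg r v }

/-- Write cell `i` of array `k`. -/
def RAMState.setArr (s : RAMState) (k i : ℕ) (v : ℝ) : RAMState :=
  { s with arr := Function.update s.arr k (Function.update (s.arr k) i v) }

/-- Programs. Constants are integers, so that no information is hidden in a real constant. -/
inductive RAMProg where
  | skip : RAMProg
  | const (r : ℕ) (c : ℤ) : RAMProg
  | copy (r x : ℕ) : RAMProg
  | add (r x y : ℕ) : RAMProg
  | sub (r x y : ℕ) : RAMProg
  | mul (r x y : ℕ) : RAMProg
  | div (r x y : ℕ) : RAMProg
  | load (r k x : ℕ) : RAMProg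
  | store (k x y : ℕ) : RAMProg
  | seq (p q : RAMProg) : RAMProg
  | ifLt (x y : ℕ) (p q : RAMProg) : RAMProg
  | whileLt (x y : ℕ) (p : RAMProg) : RAMProg

/-- `RAMExec p s t s'`: started in `s`, the program `p` halts in `s'` after exactly `t` steps. -/
inductive RAMExec : RAMProg → RAMState → ℕ → RAMState → Prop
  | skip (s : RAMState) : RAMExec .skip s 1 s
  | const (s : RAMState) (r : ℕ) (c : ℤ) : RAMExec (.const r c) s 1 (s.setReg r (c : ℝ))
  | copy (s : RAMState) (r x : ℕ) : RAMExec (.copy r x) s 1 (s.setReg r (s.reg x))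
  | add (s : RAMState) (r x y : ℕ) :
      RAMExec (.add r x y) s 1 (s.setReg r (s.reg x + s.reg y))
  | sub (s : RAMState) (r x y : ℕ) :
      RAMExec (.sub r x y) s 1 (s.setReg r (s.reg x - s.reg y))
  | mul (s : RAMState) (r x y : ℕ) :
      RAMExec (.mul r x y) s 1 (s.setReg r (s.reg x * s.reg y))
  | div (s : RAMState) (r x y : ℕ) (h : s.reg y ≠ 0) :
      RAMExec (.div r x y) s 1 (s.setReg r (s.reg x / s.reg y))
  | load (s : RAMState) (r k x i : ℕ) (h : s.reg x = (i : ℝ)) :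
      RAMExec (.load r k x) s 1 (s.setReg r (s.arr k i))
  | store (s : RAMState) (k x y i : ℕ) (h : s.reg x = (i : ℝ)) :
      RAMExec (.store k x y) s 1 (s.setArr k i (s.reg y))
  | seq (p q : RAMProg) (s s' s'' : RAMState) (t t' : ℕ) (hp : RAMExec p s t s')
      (hq : RAMExec q s' t' s'') : RAMExec (.seq p q) s (t + t') s''
  | ifTrue (x y : ℕ) (p q : RAMProg) (s s' : RAMState) (t : ℕ) (h : s.reg x < s.reg y)
      (hp : RAMExec p s t s') : RAMExec (.ifLt x y p q) s (t + 1) s'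
  | ifFalse (x y : ℕ) (p q : RAMProg) (s s' : RAMState) (t : ℕ) (h : ¬ s.reg x < s.reg y)
      (hq : RAMExec q s t s') : RAMExec (.ifLt x y p q) s (t + 1) s'
  | whileTrue (x y : ℕ) (p : RAMProg) (s s' s'' : RAMState) (t t' : ℕ)
      (h : s.reg x < s.reg y) (hp : RAMExec p s t s')
      (hw : RAMExec (.whileLt x y p) s' t' s'') : RAMExec (.whileLt x y p) s (t + t' + 1) s''
  | whileFalse (x y : ℕ) (p : RAMProg) (s : RAMState) (h : ¬ s.reg x < s.reg y) :
      RAMExec (.whileLt x y p) s 1 s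

/-- The initial state for the input `(a, b, ε)`. Registers `0, 1, 2, 3` hold `n`, `nnz a`, `nnz b`
and `ε`. Arrays `0` and `1` list the positions and the values of the non-zero entries of `a`, in the
order `ea`; arrays `2` and `3` do this for `b`, in the order `eb`. Everything else is `0`. -/
def inputState {n : ℕ} (a b : Fin n → ℝ) (ε : ℝ) (ea : Fin (nnz a) ≃ {i : Fin n // a i ≠ 0})
    (eb : Fin (nnz b) ≃ {i : Fin n // b i ≠ 0}) : RAMState where
  reg
    | 0 => (n : ℝ)
    | 1 => (nnz a : ℝ)
    | 2 => (nnz b : ℝ)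
    | 3 => ε
    | _ => 0
  arr
    | 0 => fun k => if h : k < nnz a then (((ea ⟨k, h⟩ : Fin n) : ℕ) : ℝ) else 0
    | 1 => fun k => if h : k < nnz a then a (ea ⟨k, h⟩ : Fin n) else 0
    | 2 => fun k => if h : k < nnz b then (((eb ⟨k, h⟩ : Fin n) : ℕ) : ℝ) else 0
    | 3 => fun k => if h : k < nnz b then b (eb ⟨k, h⟩ : Fin n) else 0
    | _ => fun _ => 0

/-- The state `s` holds the matrix `A` as its output: register `4` holds the number of non-zero
entries, and arrays `4, 5, 6` list their rows, columns and values, each entry once, in some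
order. -/
def HoldsOutput {n : ℕ} (s : RAMState) (A : Matrix (Fin n) (Fin n) ℝ) : Prop :=
  s.reg 4 = (matNnz A : ℝ) ∧
  ∃ e : Fin (matNnz A) ≃ {p : Fin n × Fin n // A p.1 p.2 ≠ 0},
    ∀ k : Fin (matNnz A),
      s.arr 4 k = (((e k).1.1 : ℕ) : ℝ) ∧ s.arr 5 k = (((e k).1.2 : ℕ) : ℝ) ∧
      s.arr 6 k = A (e k).1.1 (e k).1.2

end

/-! Write P for `prodAdj a b`, d for the common ℓ₁ norm and C for the off-diagonal block of a
sparsifier. The condition L𝟏 = 0 says that C has row sums b and column sums a (`IsCoupling`). Hence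
the degrees agree, and the difference of the directed Laplacians is -(C - P)ᵀ, which kills constants
on both sides. Everything depends on the bilinear form B(x, y) = xᵀ(C - P)y. The Loewner bounds,
applied to vectors with their means removed, give |B(x, y)| ≤ δ(Var_b x + Var_a y), where Var is
`varForm` (`abs_form_le_of_loewner`). Both variances are at most twice the form of U, so the
normalised difference has norm at most 4δ ≤ ε (`isGraphApprox_of_loewner`). Conversely, a coupling
with small B satisfies the Loewner bounds (`loewner_of_correlation`).

For the algorithm, a and b are each cut into M cells of the same weight w = d/M, every cell made of
at most three pieces of coordinates. The cells are joined by a regular expander, and each edge is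
spread over the pieces in proportion to their weights (`cellAdj`). A contraction factor lam of the
expander bounds B with the constant lam/2 (`cellAdj_correlation`), so lam of order ε and M of order
nnz a + nnz b suffice. Cutting is greedy: a cell takes one item lighter than w and is topped up from
at most two heavier ones.

The expander has to be explicit, to exist at nearly every size and to be computable in time linear
in its number of edges. Let q be a prime with N ≤ q ≤ 2N, where N = ⌈8192/ε⌉. On (ℤ/q)^j the q²
translations by y(1, z, …, z^(j-1)) contract by j/q, because a non-zero polynomial of degree below j
has at most j roots (`isExp_momentShift`). A zig-zag product contracts by lw + 2 lh
(`IsExp.zigzag`). From q⁴ permutations with factor 19/q, squaring gives q⁸ permutations with factor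
at most 3/q; the zig-zag product with the translations of (ℤ/q)^8 then has factor 3/q + 16/q = 19/q,
again q⁴ permutations, and q⁸ times as many points. Rotations of a cycle start this recursion, and
the costs form a geometric series (`expanderProg_runs`). If nnz a + nnz b < q², the full product is
already sparse enough.

The program is written in a small language with rules for correctness and time, and is compiled with
the same number of steps (`Stmt.Exec.refine`). Since the machine cannot round, quotients,
remainders, thresholds and primes are found by counting. -/

/-! ### A small imperative language compiled to the real RAM -/

/-- Arithmetic expressions over registers and array cells. -/
inductive RExpr where
  | var (r : ℕ) : RExpr
  | int (c : ℤ) : RExpr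
  | add (e f : RExpr) : RExpr
  | sub (e f : RExpr) : RExpr
  | mul (e f : RExpr) : RExpr
  | div (e f : RExpr) : RExpr
  | get (k : ℕ) (e : RExpr) : RExpr

namespace RExpr

instance : Add RExpr := ⟨add⟩
instance : Sub RExpr := ⟨sub⟩
instance : Mul RExpr := ⟨mul⟩
instance : Div RExpr := ⟨div⟩
instance (n : ℕ) : OfNat RExpr n := ⟨int n⟩

/-- The value of an expression. -/
noncomputable def eval (s : RAMState) : RExpr → ℝ
  | var r => s.reg r
  | int c => c
  | add e f => e.eval s + f.eval s
  | sub e f => e.eval s - f.eval s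
  | mul e f => e.eval s * f.eval s
  | div e f => e.eval s / f.eval s
  | get k e => s.arr k ⌊e.eval s⌋₊

/-- No division by zero, and array accesses only at natural numbers. -/
def Ok (s : RAMState) : RExpr → Prop
  | var _ => True
  | int _ => True
  | add e f => e.Ok s ∧ f.Ok s
  | sub e f => e.Ok s ∧ f.Ok s
  | mul e f => e.Ok s ∧ f.Ok s
  | div e f => e.Ok s ∧ f.Ok s ∧ f.eval s ≠ 0
  | get _ e => e.Ok s ∧ ((⌊e.eval s⌋₊ : ℕ) : ℝ) = e.eval s

/-- The number of steps of the evaluation. -/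
def cost : RExpr → ℕ
  | var _ => 1
  | int _ => 1
  | add e f => e.cost + f.cost + 1
  | sub e f => e.cost + f.cost + 1
  | mul e f => e.cost + f.cost + 1
  | div e f => e.cost + f.cost + 1
  | get _ e => e.cost + 1

/-- Only registers below `1000` occur; the others hold intermediate results. -/
def low : RExpr → Bool
  | var r => decide (r < 1000)
  | int _ => true
  | add e f => e.low && f.low
  | sub e f => e.low && f.low
  | mul e f => e.low && f.low
  | div e f => e.low && f.low
  | get _ e => e.low

/-- The program that writes the value of the expression to register `t`. -/
def code (t : ℕ) : RExpr → RAMProg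
  | var r => .copy t r
  | int c => .const t c
  | add e f => .seq (.seq (e.code t) (f.code (t + 1))) (.add t t (t + 1))
  | sub e f => .seq (.seq (e.code t) (f.code (t + 1))) (.sub t t (t + 1))
  | mul e f => .seq (.seq (e.code t) (f.code (t + 1))) (.mul t t (t + 1))
  | div e f => .seq (.seq (e.code t) (f.code (t + 1))) (.div t t (t + 1))
  | get k e => .seq (e.code t) (.load t k t)

section simp
variable (s : RAMState) (e f : RExpr) (r k : ℕ)
@[simp] theorem eval_var : (var r).eval s = s.reg r := rfl
@[simp] theorem eval_ofNat (n : ℕ) [n.AtLeastTwo] :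
    RExpr.eval s ofNat(n) = OfNat.ofNat n :=
  (Int.cast_natCast n).trans (Nat.cast_ofNat (R := ℝ) (n := n))
@[simp] theorem eval_zero : RExpr.eval s (0 : RExpr) = 0 := by
  change (((0 : ℕ) : ℤ) : ℝ) = _
  simp
@[simp] theorem eval_one : RExpr.eval s (1 : RExpr) = 1 := by
  change (((1 : ℕ) : ℤ) : ℝ) = _
  simp
@[simp] theorem eval_add : (e + f).eval s = e.eval s + f.eval s := rfl
@[simp] theorem eval_sub : (e - f).eval s = e.eval s - f.eval s := rfl
@[simp] theorem eval_mul : (e * f).eval s = e.eval s * f.eval s := rfl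
@[simp] theorem eval_div : (e / f).eval s = e.eval s / f.eval s := rfl
@[simp] theorem eval_get : (get k e).eval s = s.arr k ⌊e.eval s⌋₊ := rfl
@[simp] theorem ok_var : (var r).Ok s := trivial
@[simp] theorem ok_ofNat (n : ℕ) [n.AtLeastTwo] : RExpr.Ok s ofNat(n) := trivial
@[simp] theorem ok_zero : RExpr.Ok s (0 : RExpr) := trivial
@[simp] theorem ok_one : RExpr.Ok s (1 : RExpr) := trivial
@[simp] theorem ok_add : (e + f).Ok s ↔ e.Ok s ∧ f.Ok s := Iff.rfl
@[simp] theorem ok_sub : (e - f).Ok s ↔ e.Ok s ∧ f.Ok s := Iff.rfl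
@[simp] theorem ok_mul : (e * f).Ok s ↔ e.Ok s ∧ f.Ok s := Iff.rfl
@[simp] theorem ok_div : (e / f).Ok s ↔ e.Ok s ∧ f.Ok s ∧ f.eval s ≠ 0 := Iff.rfl
@[simp] theorem ok_get :
    (get k e).Ok s ↔ e.Ok s ∧ ((⌊e.eval s⌋₊ : ℕ) : ℝ) = e.eval s := Iff.rfl
end simp

end RExpr

/-- Two states agree up to intermediate results. -/
def Agree (s s' : RAMState) : Prop := (∀ r < 1000, s.reg r = s'.reg r) ∧ s.arr = s'.arr

/-- The code of an expression computes its value and keeps the arrays and the lower registers. -/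
theorem RExpr.code_exec (σ : RAMState) : ∀ (e : RExpr) (t : ℕ) (s : RAMState), e.low = true →
    Agree s σ → e.Ok σ → 1000 ≤ t → ∃ s', RAMExec (e.code t) s e.cost s' ∧
      s'.reg t = e.eval σ ∧ (∀ r < t, s'.reg r = s.reg r) ∧ s'.arr = s.arr := by
  -- One argument serves the four binary operations: register `t` keeps the value of `e`, because
  -- the code of `f` writes only from `t + 1` upwards.
  have key : ∀ (e f : RExpr) (op : ℕ → ℕ → ℕ → RAMProg) (v : ℝ → ℝ → ℝ),
      (∀ (s : RAMState) (t : ℕ), s.reg t = e.eval σ → s.reg (t + 1) = f.eval σ →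
        RAMExec (op t t (t + 1)) s 1 (s.setReg t (v (s.reg t) (s.reg (t + 1))))) →
      (∀ (t : ℕ) (s : RAMState), e.low = true →
        Agree s σ → e.Ok σ → 1000 ≤ t → ∃ s', RAMExec (e.code t) s e.cost s' ∧
        s'.reg t = e.eval σ ∧ (∀ r < t, s'.reg r = s.reg r) ∧ s'.arr = s.arr) →
      (∀ (t : ℕ) (s : RAMState), f.low = true →
        Agree s σ → f.Ok σ → 1000 ≤ t → ∃ s', RAMExec (f.code t) s f.cost s' ∧
        s'.reg t = f.eval σ ∧ (∀ r < t, s'.reg r = s.reg r) ∧ s'.arr = s.arr) →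
      ∀ (t : ℕ) (s : RAMState), e.low = true → f.low = true → Agree s σ → e.Ok σ → f.Ok σ →
        1000 ≤ t → ∃ s', RAMExec (.seq (.seq (e.code t) (f.code (t + 1))) (op t t (t + 1))) s
          (e.cost + f.cost + 1) s' ∧
          s'.reg t = v (e.eval σ) (f.eval σ) ∧ (∀ r < t, s'.reg r = s.reg r) ∧
          s'.arr = s.arr := by
    intro e f op v hop ihe ihf t s hle hlf hs hoe hof ht
    obtain ⟨s1, x1, v1, r1, a1⟩ := ihe t s hle hs hoe ht
    have hs1 : Agree s1 σ := ⟨fun r hr => (r1 r (hr.trans_le ht)).trans (hs.1 r hr), a1.trans hs.2⟩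
    obtain ⟨s2, x2, v2, r2, a2⟩ := ihf (t + 1) s1 hlf hs1 hof (by omega)
    have v2' : s2.reg t = e.eval σ := (r2 t (by omega)).trans v1
    refine ⟨_, .seq _ _ _ _ _ _ _ (.seq _ _ _ _ _ _ _ x1 x2) (hop s2 t v2' v2), ?_, ?_, ?_⟩
    · simp [RAMState.setReg, v2', v2]
    · intro r hr
      simp only [RAMState.setReg, Function.update_of_ne hr.ne]
      rw [r2 r (by omega), r1 r hr]
    · simp [RAMState.setReg, a2, a1]
  intro e
  induction e with
  | var r =>
    intro t s hl hs _ ht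
    simp only [low, decide_eq_true_eq] at hl
    refine ⟨_, .copy s t r, ?_, ?_, rfl⟩
    · simp [RAMState.setReg, eval, hs.1 r hl]
    · intro r' hr'; simp [RAMState.setReg, Function.update_of_ne hr'.ne]
  | int c =>
    intro t s hl hs _ ht
    refine ⟨_, .const s t c, ?_, ?_, rfl⟩
    · simp [RAMState.setReg, eval]
    · intro r' hr'; simp [RAMState.setReg, Function.update_of_ne hr'.ne]
  | get k e ih =>
    intro t s hl hs ho ht
    obtain ⟨s1, x1, v1, r1, a1⟩ := ih t s hl hs ho.1 ht
    refine ⟨_, .seq _ _ _ _ _ _ _ x1 (.load s1 t k t ⌊e.eval σ⌋₊ (v1.trans ho.2.symm)),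
      ?_, ?_, ?_⟩
    · simp [RAMState.setReg, eval, a1, hs.2]
    · intro r hr
      simp only [RAMState.setReg, Function.update_of_ne hr.ne]
      exact r1 r hr
    · simp [RAMState.setReg, a1]
  | add e f ihe ihf =>
    intro t s hl hs ho ht
    simp only [low, Bool.and_eq_true] at hl
    exact key e f .add (· + ·) (fun s t _ _ => .add s t t (t + 1)) ihe ihf t s hl.1 hl.2 hs
      ho.1 ho.2 ht
  | sub e f ihe ihf =>
    intro t s hl hs ho ht
    simp only [low, Bool.and_eq_true] at hl
    exact key e f .sub (· - ·) (fun s t _ _ => .sub s t t (t + 1)) ihe ihf t s hl.1 hl.2 hs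
      ho.1 ho.2 ht
  | mul e f ihe ihf =>
    intro t s hl hs ho ht
    simp only [low, Bool.and_eq_true] at hl
    exact key e f .mul (· * ·) (fun s t _ _ => .mul s t t (t + 1)) ihe ihf t s hl.1 hl.2 hs
      ho.1 ho.2 ht
  | div e f ihe ihf =>
    intro t s hl hs ho ht
    simp only [low, Bool.and_eq_true] at hl
    exact key e f .div (· / ·)
      (fun s t _ h => .div s t t (t + 1) (by rw [h]; exact ho.2.2)) ihe ihf t s hl.1 hl.2 hs
      ho.1 ho.2.1 ht

/-- Statements. -/
inductive Stmt where
  | skip : Stmt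
  | set (r : ℕ) (e : RExpr) : Stmt
  | put (k : ℕ) (e f : RExpr) : Stmt
  | seq (p q : Stmt) : Stmt
  | ite (e f : RExpr) (p q : Stmt) : Stmt
  | loop (e f : RExpr) (p : Stmt) : Stmt

namespace Stmt

/-- The RAM program of a statement. -/
def code : Stmt → RAMProg
  | skip => .skip
  | set r e => .seq (e.code 1000) (.copy r 1000)
  | put k e f => .seq (.seq (e.code 1000) (f.code 1001)) (.store k 1000 1001)
  | seq p q => .seq p.code q.code
  | ite e f p q => .seq (.seq (e.code 1000) (f.code 1001)) (.ifLt 1000 1001 p.code q.code)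
  | loop e f p => .seq (.seq (e.code 1000) (f.code 1001))
      (.whileLt 1000 1001 (.seq p.code (.seq (e.code 1000) (f.code 1001))))

/-- Only registers below `1000` occur. -/
def low : Stmt → Bool
  | skip => true
  | set r e => decide (r < 1000) && e.low
  | put _ e f => e.low && f.low
  | seq p q => p.low && q.low
  | ite e f p q => (e.low && f.low) && (p.low && q.low)
  | loop e f p => (e.low && f.low) && p.low

/-- The registers that are written. -/
def wreg : Stmt → List ℕ
  | skip => []
  | set r _ => [r]
  | put _ _ _ => []
  | seq p q => p.wreg ++ q.wreg
  | ite _ _ p q => p.wreg ++ q.wreg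
  | loop _ _ p => p.wreg

/-- The arrays that are written. -/
def warr : Stmt → List ℕ
  | skip => []
  | set _ _ => []
  | put k _ _ => [k]
  | seq p q => p.warr ++ q.warr
  | ite _ _ p q => p.warr ++ q.warr
  | loop _ _ p => p.warr

/-- Execution of a statement, with the number of steps. -/
inductive Exec : Stmt → RAMState → ℕ → RAMState → Prop
  | skip (s) : Exec .skip s 1 s
  | set (s) (r) (e : RExpr) (h : e.Ok s) : Exec (.set r e) s (e.cost + 1) (s.setReg r (e.eval s))
  | put (s) (k) (e f : RExpr) (he : e.Ok s) (hf : f.Ok s)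
      (h : ((⌊e.eval s⌋₊ : ℕ) : ℝ) = e.eval s) :
      Exec (.put k e f) s (e.cost + f.cost + 1) (s.setArr k ⌊e.eval s⌋₊ (f.eval s))
  | seq (p q s s' s'' t t') (hp : Exec p s t s') (hq : Exec q s' t' s'') :
      Exec (.seq p q) s (t + t') s''
  | iteTrue (e f : RExpr) (p q s s' t) (he : e.Ok s) (hf : f.Ok s) (h : e.eval s < f.eval s)
      (hp : Exec p s t s') : Exec (.ite e f p q) s (e.cost + f.cost + (t + 1)) s'
  | iteFalse (e f : RExpr) (p q s s' t) (he : e.Ok s) (hf : f.Ok s) (h : ¬ e.eval s < f.eval s)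
      (hp : Exec q s t s') : Exec (.ite e f p q) s (e.cost + f.cost + (t + 1)) s'
  | loopTrue (e f : RExpr) (p s s' s'' t t') (he : e.Ok s) (hf : f.Ok s)
      (h : e.eval s < f.eval s) (hp : Exec p s t s') (hl : Exec (.loop e f p) s' t' s'') :
      Exec (.loop e f p) s (e.cost + f.cost + (t + t' + 1)) s''
  | loopFalse (e f : RExpr) (p s) (he : e.Ok s) (hf : f.Ok s) (h : ¬ e.eval s < f.eval s) :
      Exec (.loop e f p) s (e.cost + f.cost + 1) s

end Stmt

theorem RExpr.code_pair {σ s : RAMState} (e f : RExpr) (hle : e.low = true) (hlf : f.low = true)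
    (hs : Agree s σ) (he : e.Ok σ) (hf : f.Ok σ) :
    ∃ s', RAMExec (.seq (e.code 1000) (f.code 1001)) s (e.cost + f.cost) s' ∧
      s'.reg 1000 = e.eval σ ∧ s'.reg 1001 = f.eval σ ∧ Agree s' σ := by
  obtain ⟨s1, x1, v1, r1, a1⟩ := e.code_exec σ 1000 s hle hs he le_rfl
  have hs1 : Agree s1 σ := ⟨fun r hr => (r1 r hr).trans (hs.1 r hr), a1.trans hs.2⟩
  obtain ⟨s2, x2, v2, r2, a2⟩ := f.code_exec σ 1001 s1 hlf hs1 hf (by omega)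
  exact ⟨s2, .seq _ _ _ _ _ _ _ x1 x2, (r2 1000 (by omega)).trans v1, v2,
    fun r hr => (r2 r (by omega)).trans (hs1.1 r hr), a2.trans hs1.2⟩

/-- The compiled program simulates the statement, with the same number of steps. -/
theorem Stmt.Exec.refine {p : Stmt} {σ σ' : RAMState} {t : ℕ} (h : p.Exec σ t σ') :
    ∀ s, p.low = true → Agree s σ → ∃ s', RAMExec p.code s t s' ∧ Agree s' σ' := by
  induction h with
  | skip σ => intro s _ hs; exact ⟨s, .skip s, hs⟩
  | set σ r e h =>
    intro s hl hs
    simp only [low, Bool.and_eq_true, decide_eq_true_eq] at hl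
    obtain ⟨s1, x1, v1, r1, a1⟩ := e.code_exec σ 1000 s hl.2 hs h le_rfl
    refine ⟨_, .seq _ _ _ _ _ _ _ x1 (.copy s1 r 1000), ?_, ?_⟩
    · intro r' hr'
      by_cases hrr : r' = r
      · subst hrr; simp [RAMState.setReg, v1]
      · simp only [RAMState.setReg, Function.update_of_ne hrr]
        exact (r1 r' hr').trans (hs.1 r' hr')
    · simp only [RAMState.setReg]; exact a1.trans hs.2
  | put σ k e f he hf h =>
    intro s hl hs
    simp only [low, Bool.and_eq_true] at hl
    obtain ⟨s1, x1, v1, w1, hs1⟩ := e.code_pair f hl.1 hl.2 hs he hf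
    refine ⟨_, .seq _ _ _ _ _ _ _ x1 (.store s1 k 1000 1001 ⌊e.eval σ⌋₊ (v1.trans h.symm)),
      ?_, ?_⟩
    · intro r hr; exact hs1.1 r hr
    · simp only [RAMState.setArr, hs1.2, w1]
  | seq p q σ σ' σ'' t t' _ _ ihp ihq =>
    intro s hl hs
    simp only [low, Bool.and_eq_true] at hl
    obtain ⟨s1, x1, h1⟩ := ihp s hl.1 hs
    obtain ⟨s2, x2, h2⟩ := ihq s1 hl.2 h1
    exact ⟨s2, .seq _ _ _ _ _ _ _ x1 x2, h2⟩
  | iteTrue e f p q σ σ' t he hf h _ ih =>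
    intro s hl hs
    simp only [low, Bool.and_eq_true] at hl
    obtain ⟨s1, x1, v1, w1, hs1⟩ := e.code_pair f hl.1.1 hl.1.2 hs he hf
    obtain ⟨s2, x2, h2⟩ := ih s1 hl.2.1 hs1
    exact ⟨s2, .seq _ _ _ _ _ _ _ x1 (.ifTrue _ _ _ _ _ _ _ (by rwa [v1, w1]) x2), h2⟩
  | iteFalse e f p q σ σ' t he hf h _ ih =>
    intro s hl hs
    simp only [low, Bool.and_eq_true] at hl
    obtain ⟨s1, x1, v1, w1, hs1⟩ := e.code_pair f hl.1.1 hl.1.2 hs he hf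
    obtain ⟨s2, x2, h2⟩ := ih s1 hl.2.2 hs1
    exact ⟨s2, .seq _ _ _ _ _ _ _ x1 (.ifFalse _ _ _ _ _ _ _ (by rwa [v1, w1]) x2), h2⟩
  | loopTrue e f p σ σ' σ'' t t' he hf h _ _ ihp ihl =>
    intro s hl hs
    have hl' := hl
    simp only [low, Bool.and_eq_true] at hl'
    obtain ⟨s1, x1, v1, w1, hs1⟩ := e.code_pair f hl'.1.1 hl'.1.2 hs he hf
    obtain ⟨s2, x2, h2⟩ := ihp s1 hl'.2 hs1
    obtain ⟨s3, x3, h3⟩ := ihl s2 hl h2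
    -- The remaining loop begins by evaluating its condition. In the compiled code this evaluation
    -- is the end of the loop body, so it is split off and appended to the run of the body.
    cases x3 with
    | seq _ _ _ s4 _ t1 t2 y1 y2 =>
      refine ⟨s3, ?_, h3⟩
      have := RAMExec.seq _ _ _ _ _ _ _ x1 (.whileTrue _ _ _ _ _ _ _ _ (by rwa [v1, w1])
        (.seq _ _ _ _ _ _ _ x2 y1) y2)
      rwa [← add_assoc t] 
  | loopFalse e f p σ he hf h =>
    intro s hl hs
    simp only [low, Bool.and_eq_true] at hl
    obtain ⟨s1, x1, v1, w1, hs1⟩ := e.code_pair f hl.1.1 hl.1.2 hs he hf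
    exact ⟨s1, .seq _ _ _ _ _ _ _ x1 (.whileFalse _ _ _ _ (by rwa [v1, w1])), hs1⟩

/-! ### Frame conditions and rules for correctness with time bounds. -/

namespace RAMState

@[simp] theorem reg_setReg (s : RAMState) (r r' : ℕ) (v : ℝ) :
    (s.setReg r v).reg r' = if r' = r then v else s.reg r' := by
  simp [setReg, Function.update_apply]

@[simp] theorem arr_setReg (s : RAMState) (r : ℕ) (v : ℝ) : (s.setReg r v).arr = s.arr := rfl

@[simp] theorem reg_setArr (s : RAMState) (k i : ℕ) (v : ℝ) : (s.setArr k i v).reg = s.reg := rfl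

@[simp] theorem arr_setArr (s : RAMState) (k i k' : ℕ) (v : ℝ) :
    (s.setArr k i v).arr k' = if k' = k then Function.update (s.arr k) i v else s.arr k' := by
  simp only [setArr, Function.update_apply]

end RAMState

/-- `s'` arises from `s` by writing only the given registers and arrays. -/
structure Same (R A : List ℕ) (s s' : RAMState) : Prop where
  reg : ∀ r, r ∉ R → s'.reg r = s.reg r
  arr : ∀ k, k ∉ A → s'.arr k = s.arr k

theorem Same.refl {R A : List ℕ} (s : RAMState) : Same R A s s := ⟨fun _ _ => rfl, fun _ _ => rfl⟩

theorem Same.trans {R A R' A' : List ℕ} {s s' s'' : RAMState} (h : Same R A s s')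
    (h' : Same R' A' s' s'') : Same (R ++ R') (A ++ A') s s'' := by
  constructor
  · intro r hr
    rw [List.mem_append, not_or] at hr
    rw [h'.reg r hr.2, h.reg r hr.1]
  · intro r hr
    rw [List.mem_append, not_or] at hr
    rw [h'.arr r hr.2, h.arr r hr.1]

theorem Same.mono {R A R' A' : List ℕ} {s s' : RAMState} (h : Same R A s s') (hR : R ⊆ R')
    (hA : A ⊆ A') : Same R' A' s s' :=
  ⟨fun r hr => h.reg r fun h => hr (hR h), fun k hk => h.arr k fun h => hk (hA h)⟩

/-- The frame rule. It reduces the claim that a register or array survives a block of code to a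
decidable membership in a list read off from the program text. -/
theorem Stmt.Exec.same {p : Stmt} {s s' : RAMState} {t : ℕ} (h : p.Exec s t s') :
    Same p.wreg p.warr s s' := by
  induction h with
  | skip | loopFalse => exact .refl _
  | set s r e h =>
    refine ⟨fun r' hr' => ?_, fun k _ => rfl⟩
    have : r' ≠ r := by simpa [wreg] using hr'
    simp [this]
  | put s k e f he hf h =>
    refine ⟨fun r' hr' => rfl, fun k' hk => ?_⟩
    have : k' ≠ k := by simpa [warr] using hk
    simp [this]
  | seq p q s s' s'' t t' _ _ ihp ihq => exact ihp.trans ihq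
  | iteTrue e f p q s s' t he hf h _ ih =>
    exact ih.mono (List.subset_append_left _ _) (List.subset_append_left _ _)
  | iteFalse e f p q s s' t he hf h _ ih =>
    exact ih.mono (List.subset_append_right _ _) (List.subset_append_right _ _)
  | loopTrue e f p s s' s'' t t' he hf h _ _ ihp ihl =>
    have := ihp.trans ihl
    simp only [wreg, warr] at this ⊢
    exact this.mono (by simp) (by simp)

/-- Started in `s`, the statement `p` halts within `T` steps in a state satisfying `Q`. -/
def Runs (p : Stmt) (s : RAMState) (T : ℕ) (Q : RAMState → Prop) : Prop :=
  ∃ t s', p.Exec s t s' ∧ t ≤ T ∧ Q s'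

namespace Runs

variable {p q : Stmt} {s : RAMState} {T T' : ℕ} {Q Q' : RAMState → Prop}

theorem mono (h : Runs p s T Q) (hT : T ≤ T') (hQ : ∀ s', Same p.wreg p.warr s s' → Q s' → Q' s') :
    Runs p s T' Q' := by
  obtain ⟨t, s', x, ht, hq⟩ := h
  exact ⟨t, s', x, ht.trans hT, hQ s' x.same hq⟩

theorem seq (h : Runs p s T (fun s' => Runs q s' T' Q)) : Runs (p.seq q) s (T + T') Q := by
  obtain ⟨t, s', x, ht, t', s'', x', ht', hq⟩ := h
  exact ⟨_, s'', .seq _ _ _ _ _ _ _ x x', add_le_add ht ht', hq⟩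

theorem andThen (h : Runs p s T Q)
    (h' : ∀ s', Same p.wreg p.warr s s' → Q s' → Runs q s' T' Q') :
    Runs (p.seq q) s (T + T') Q' :=
  seq (h.mono le_rfl h')

theorem ite {e f : RExpr} (he : e.Ok s) (hf : f.Ok s)
    (h : e.eval s < f.eval s → Runs p s T Q) (h' : ¬ e.eval s < f.eval s → Runs q s T Q) :
    Runs (.ite e f p q) s (e.cost + f.cost + (T + 1)) Q := by
  by_cases hc : e.eval s < f.eval s
  · obtain ⟨t, s', x, ht, hq⟩ := h hc
    exact ⟨_, s', .iteTrue _ _ _ _ _ _ _ he hf hc x, by omega, hq⟩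
  · obtain ⟨t, s', x, ht, hq⟩ := h' hc
    exact ⟨_, s', .iteFalse _ _ _ _ _ _ _ he hf hc x, by omega, hq⟩

/-- Loops: `Inv k` holds after `k` iterations, there are at most `n` iterations, and the iteration
number `k` takes at most `T k` steps. -/
theorem loopSum {e f : RExpr} (T : ℕ → ℕ) (n : ℕ) (Inv : ℕ → RAMState → Prop) (h0 : Inv 0 s)
    (hok : ∀ k s', Same p.wreg p.warr s s' → Inv k s' → e.Ok s' ∧ f.Ok s')
    (hstep : ∀ k s', Same p.wreg p.warr s s' → Inv k s' → e.eval s' < f.eval s' →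
      k < n ∧ Runs p s' (T k) (Inv (k + 1))) :
    Runs (.loop e f p) s ((n + 1) * (e.cost + f.cost + 1) + ∑ k ∈ Finset.range n, T k)
      (fun s' => ∃ k ≤ n, Inv k s' ∧ ¬ e.eval s' < f.eval s') := by
  -- Induction on the number `j` of iterations that may still come. The condition is evaluated once
  -- more than the body, whence the factor `j + 1`.
  have key : ∀ (j k : ℕ) (s' : RAMState), k + j = n → Same p.wreg p.warr s s' → Inv k s' →
      Runs (.loop e f p) s' ((j + 1) * (e.cost + f.cost + 1) + ∑ i ∈ Finset.Ico k n, T i)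
        (fun s' => ∃ k ≤ n, Inv k s' ∧ ¬ e.eval s' < f.eval s') := by
    intro j
    induction j with
    | zero =>
      intro k s' hk hs hi
      obtain ⟨h1, h2⟩ := hok k s' hs hi
      by_cases hc : e.eval s' < f.eval s'
      · exact absurd (hstep k s' hs hi hc).1 (by omega)
      · exact ⟨_, s', .loopFalse _ _ _ _ h1 h2 hc, by omega, k, by omega, hi, hc⟩
    | succ j ih =>
      intro k s' hk hs hi
      obtain ⟨h1, h2⟩ := hok k s' hs hi
      by_cases hc : e.eval s' < f.eval s'
      · obtain ⟨hkn, t, s1, x, ht, hi'⟩ := hstep k s' hs hi hc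
        obtain ⟨t', s2, x', ht', hq⟩ := ih (k + 1) s1 (by omega)
          ((hs.trans x.same).mono (by simp) (by simp)) hi'
        refine ⟨_, s2, .loopTrue _ _ _ _ _ _ _ _ h1 h2 hc x x', ?_, hq⟩
        rw [add_mul (j + 1), Finset.sum_eq_sum_Ico_succ_bot hkn]
        omega
      · refine ⟨_, s', .loopFalse _ _ _ _ h1 h2 hc, ?_, k, by omega, hi, hc⟩
        rw [add_mul (j + 1)]
        omega
  rw [Finset.range_eq_Ico]
  exact key n 0 s (by omega) (.refl s) h0

/-- Loops: `Inv k` holds after `k` iterations, and there are at most `n` iterations. -/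
theorem loop {e f : RExpr} (n : ℕ) (Inv : ℕ → RAMState → Prop) (h0 : Inv 0 s)
    (hok : ∀ k s', Same p.wreg p.warr s s' → Inv k s' → e.Ok s' ∧ f.Ok s')
    (hstep : ∀ k s', Same p.wreg p.warr s s' → Inv k s' → e.eval s' < f.eval s' →
      k < n ∧ Runs p s' T (Inv (k + 1))) :
    Runs (.loop e f p) s ((n + 1) * (e.cost + f.cost + T + 1))
      (fun s' => ∃ k ≤ n, Inv k s' ∧ ¬ e.eval s' < f.eval s') := by
  refine (loopSum (fun _ => T) n Inv h0 hok hstep).mono ?_ fun _ _ h => h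
  rw [Finset.sum_const, Finset.card_range, smul_eq_mul, add_right_comm _ T, mul_add (n + 1) _ T]
  exact Nat.add_le_add_left (Nat.mul_le_mul_right T n.le_succ) _

end Runs

namespace Stmt

/-- `for i := 0, …, reg r - 1 do p`. -/
def forLoop (i r : ℕ) (p : Stmt) : Stmt :=
  .seq (.set i 0) (.loop (.var i) (.var r) (.seq p (.set i (.var i + 1))))

/-- The weakest precondition of loop-free code. -/
def wp : Stmt → (RAMState → Prop) → RAMState → Prop
  | skip, Q, s => Q s
  | set r e, Q, s => e.Ok s ∧ Q (s.setReg r (e.eval s))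
  | put k e f, Q, s => e.Ok s ∧ f.Ok s ∧ ((⌊e.eval s⌋₊ : ℕ) : ℝ) = e.eval s ∧
      Q (s.setArr k ⌊e.eval s⌋₊ (f.eval s))
  | seq p q, Q, s => p.wp (q.wp Q) s
  | ite e f p q, Q, s => e.Ok s ∧ f.Ok s ∧ (e.eval s < f.eval s → p.wp Q s) ∧
      (¬ e.eval s < f.eval s → q.wp Q s)
  | loop _ _ _, _, _ => False

/-- A bound for the time of loop-free code. -/
def bound : Stmt → ℕ
  | skip => 1
  | set _ e => e.cost + 1
  | put _ e f => e.cost + f.cost + 1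
  | seq p q => p.bound + q.bound
  | ite e f p q => e.cost + f.cost + (p.bound + q.bound + 1)
  | loop _ _ _ => 0

end Stmt

theorem Runs.of_wp {T : ℕ} : ∀ {p : Stmt} {s : RAMState} {Q : RAMState → Prop}, p.wp Q s →
    p.bound ≤ T → Runs p s T Q := by
  have key : ∀ {p : Stmt} {s : RAMState} {Q : RAMState → Prop}, p.wp Q s →
      Runs p s p.bound Q := by
    intro p
    induction p with
    | skip => intro s Q h; exact ⟨_, _, .skip s, le_rfl, h⟩
    | set r e => intro s Q h; exact ⟨_, _, .set s r e h.1, le_rfl, h.2⟩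
    | put k e f =>
      intro s Q h
      exact ⟨_, _, .put s k e f h.1 h.2.1 h.2.2.1, le_rfl, h.2.2.2⟩
    | seq p q ihp ihq =>
      intro s Q h
      exact Runs.seq ((ihp h).mono le_rfl fun s' _ h' => ihq h')
    | ite e f p q ihp ihq =>
      intro s Q h
      refine Runs.mono (Runs.ite (T := p.bound + q.bound) h.1 h.2.1
        (fun hc => (ihp (h.2.2.1 hc)).mono (by omega) fun _ _ h => h)
        (fun hc => (ihq (h.2.2.2 hc)).mono (by omega) fun _ _ h => h)) le_rfl fun _ _ h => h
    | loop e f p => intro s Q h; exact h.elim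
  intro p s Q h hT
  exact (key h).mono hT fun _ _ h => h

/-- The rule for `for` loops: `Inv k` holds before the iteration with counter `k`,
which takes at most `T k` steps. -/
theorem Runs.forLoopSum {i r : ℕ} {p : Stmt} {s : RAMState} {N : ℕ} (T : ℕ → ℕ) (Inv : ℕ → RAMState → Prop)
    (hr : s.reg r = (N : ℝ)) (hir : r ≠ i) (hrp : r ∉ p.wreg) (hip : i ∉ p.wreg)
    (h0 : Inv 0 (s.setReg i 0))
    (hstep : ∀ k < N, ∀ s', Same (i :: p.wreg) p.warr s s' → s'.reg i = (k : ℝ) → Inv k s' →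
      Runs p s' (T k) (fun s'' => Inv (k + 1) (s''.setReg i (k + 1 : ℕ)))) :
    Runs (.forLoop i r p) s (2 + ((N + 1) * 7 + ∑ k ∈ Finset.range N, T k)) (fun s' => s'.reg i = (N : ℝ) ∧ Inv N s') := by
  refine Runs.andThen (p := .set i 0) (Q := fun s' => s' = s.setReg i 0)
    (Runs.of_wp (by simp [Stmt.wp]) (Nat.le_of_ble_eq_true rfl)) ?_
  rintro s1 - rfl
  -- Incrementing the counter costs 4 steps and testing the condition 3, which makes the 7 per
  -- iteration of the time bound.
  have := Runs.loopSum (p := .seq p (.set i (.var i + 1))) (e := .var i) (f := .var r)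
    (s := s.setReg i 0) (T := fun k => T k + 4) N
    (fun k s' => s'.reg i = (k : ℝ) ∧ s'.reg r = (N : ℝ) ∧ k ≤ N ∧ Inv k s')
    ⟨by simp, by simp [hir, hr], by omega, h0⟩ (fun _ _ _ _ => ⟨trivial, trivial⟩) (by
      rintro k s' hs ⟨hi, hr', hk, hI⟩ hlt
      simp only [RExpr.eval_var, hi, hr'] at hlt
      have hkN : k < N := by exact_mod_cast hlt
      refine ⟨hkN, ?_⟩
      have hs' : Same (i :: p.wreg) p.warr s s' := by
        constructor
        · intro x hx
          rw [List.mem_cons, not_or] at hx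
          rw [hs.reg x (by simp [Stmt.wreg, hx]), RAMState.reg_setReg, if_neg hx.1]
        · intro x hx
          rw [hs.arr x (by simp [Stmt.warr, hx])]
          rfl
      refine Runs.andThen (hstep k hkN s' hs' hi hI) ?_
      intro s2 hs2 hI2
      refine Runs.of_wp ?_ (Nat.le_of_ble_eq_true rfl)
      have e1 : s2.reg i = (k : ℝ) := (hs2.reg i hip).trans hi
      have e2 : s2.reg r = (N : ℝ) := (hs2.reg r hrp).trans hr'
      simp only [Stmt.wp, RExpr.ok_add, RExpr.ok_var, RExpr.ok_one, RExpr.eval_add, RExpr.eval_var,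
        RExpr.eval_one, e1, true_and, RAMState.reg_setReg, if_true, if_neg hir, e2]
      exact ⟨by push_cast; rfl, by omega, by exact_mod_cast hI2⟩)
  refine this.mono ?_ ?_
  · simp only [RExpr.cost, Finset.sum_add_distrib, Finset.sum_const, Finset.card_range, smul_eq_mul]
    omega
  · rintro s' - ⟨k, hk, ⟨hi, hr', -, hI⟩, hlt⟩
    simp only [RExpr.eval_var, hi, hr'] at hlt
    have : k = N := le_antisymm hk (by exact_mod_cast (not_lt.1 hlt))
    subst this
    exact ⟨hi, hI⟩

/-- The rule for `for` loops: `Inv k` holds before the iteration with counter `k`. -/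
theorem Runs.forLoop {i r : ℕ} {p : Stmt} {s : RAMState} {N T : ℕ} (Inv : ℕ → RAMState → Prop)
    (hr : s.reg r = (N : ℝ)) (hir : r ≠ i) (hrp : r ∉ p.wreg) (hip : i ∉ p.wreg)
    (h0 : Inv 0 (s.setReg i 0))
    (hstep : ∀ k < N, ∀ s', Same (i :: p.wreg) p.warr s s' → s'.reg i = (k : ℝ) → Inv k s' →
      Runs p s' T (fun s'' => Inv (k + 1) (s''.setReg i (k + 1 : ℕ)))) :
    Runs (.forLoop i r p) s (2 + (N + 1) * (T + 7)) (fun s' => s'.reg i = (N : ℝ) ∧ Inv N s') := by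
  refine (Runs.forLoopSum (fun _ => T) Inv hr hir hrp hip h0 hstep).mono ?_ fun _ _ h => h
  rw [Finset.sum_const, Finset.card_range, smul_eq_mul, mul_add (N + 1), add_mul N 1 T]
  omega

/-- A run of a statement gives a run of its program. -/
theorem Runs.exists_exec {p : Stmt} {s : RAMState} {T : ℕ} {Q : RAMState → Prop}
    (h : Runs p s T Q) (hl : p.low = true) :
    ∃ t s' σ, RAMExec p.code s t s' ∧ t ≤ T ∧ Agree s' σ ∧ Q σ := by
  obtain ⟨t, σ, x, ht, hq⟩ := h
  obtain ⟨s', x', ha⟩ := x.refine s hl ⟨fun _ _ => rfl, rfl⟩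
  exact ⟨t, s', σ, x', ht, ha, hq⟩

infixr:60 " ;; " => Stmt.seq

/-! ### Families of permutations with a spectral gap -/

section expander

variable {V V' X L L' : Type*} [Fintype V] [Fintype V'] [Fintype X] [Fintype L] [Fintype L']

/-- The Euclidean norm of a function on a finite type. -/
noncomputable def nrm (f : V → ℝ) : ℝ := ‖WithLp.toLp 2 f‖

theorem nrm_nonneg (f : V → ℝ) : 0 ≤ nrm f := norm_nonneg _

theorem nrm_sq (f : V → ℝ) : nrm f ^ 2 = ∑ v, f v ^ 2 := by
  simp [nrm, EuclideanSpace.norm_sq_eq]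

theorem nrm_add_le (f g : V → ℝ) : nrm (fun v => f v + g v) ≤ nrm f + nrm g :=
  norm_add_le (WithLp.toLp 2 f) (WithLp.toLp 2 g)

theorem nrm_smul (c : ℝ) (f : V → ℝ) : nrm (fun v => c * f v) = |c| * nrm f :=
  norm_smul c (WithLp.toLp 2 f)

theorem nrm_sum_le {ι : Type*} (t : Finset ι) (f : ι → V → ℝ) :
    nrm (fun v => ∑ i ∈ t, f i v) ≤ ∑ i ∈ t, nrm (f i) := by
  have h : WithLp.toLp 2 (fun v => ∑ i ∈ t, f i v) = ∑ i ∈ t, WithLp.toLp 2 (f i) := by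
    ext v; simp
  rw [nrm, h]
  exact norm_sum_le _ _

theorem nrm_le_of_sq_le {f : V → ℝ} {g : V' → ℝ} {c : ℝ} (hc : 0 ≤ c)
    (h : ∑ v, f v ^ 2 ≤ c ^ 2 * ∑ v, g v ^ 2) : nrm f ≤ c * nrm g := by
  refine (le_abs_self _).trans (abs_le_of_sq_le_sq ?_ (mul_nonneg hc (nrm_nonneg _)))
  rw [mul_pow, nrm_sq, nrm_sq]
  exact h

theorem sum_sq_le_of_nrm_le {f : V → ℝ} {g : V' → ℝ} {c : ℝ} 
    (h : nrm f ≤ c * nrm g) : ∑ v, f v ^ 2 ≤ c ^ 2 * ∑ v, g v ^ 2 := by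
  rw [← nrm_sq, ← nrm_sq, ← mul_pow]
  exact pow_le_pow_left₀ (nrm_nonneg _) h 2

theorem nrm_comp_equiv (e : V' ≃ V) (f : V → ℝ) : nrm (fun v => f (e v)) = nrm f := by
  have : nrm (fun v => f (e v)) ^ 2 = nrm f ^ 2 := by
    rw [nrm_sq, nrm_sq]; exact e.sum_comp (fun v => f v ^ 2)
  exact (sq_eq_sq₀ (nrm_nonneg _) (nrm_nonneg _)).1 this

theorem nrm_comp_bijective {e : V → V} (he : e.Bijective) (f : V → ℝ) :
    nrm (fun v => f (e v)) = nrm f := nrm_comp_equiv (.ofBijective e he) f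

/-- The mean of a function. -/
noncomputable def mean (f : V → ℝ) : ℝ := (∑ v, f v) / Fintype.card V

theorem nrm_mean_le (f : V → ℝ) : nrm (fun _ : V => mean f) ≤ nrm f := by
  rw [← one_mul (nrm f)]
  refine nrm_le_of_sq_le zero_le_one ?_
  rcases isEmpty_or_nonempty V with h | h
  · simp
  · have hc : (0 : ℝ) < Fintype.card V := by exact_mod_cast Fintype.card_pos
    have := sq_sum_le_card_mul_sum_sq (s := Finset.univ) (f := f)
    simp only [mean, Finset.sum_const, Finset.card_univ, nsmul_eq_mul, div_pow, one_pow, one_mul]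
    rw [mul_div_assoc', div_le_iff₀ (by positivity)]
    rw [Finset.card_univ] at this
    nlinarith

/-- The average of a function over the images of a point under a family of maps. -/
noncomputable def walk (g : L → V → V) (f : V → ℝ) (v : V) : ℝ := mean fun l => f (g l v)

theorem mean_const [Nonempty V] (c : ℝ) : mean (fun _ : V => c) = c := by
  have hc : (Fintype.card V : ℝ) ≠ 0 := by exact_mod_cast Fintype.card_ne_zero
  simp only [mean, Finset.sum_const, Finset.card_univ, nsmul_eq_mul]
  field_simp

theorem mean_add (f g : V → ℝ) : mean (fun v => f v + g v) = mean f + mean g := by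
  simp only [mean, Finset.sum_add_distrib, add_div]

theorem mean_sub (f g : V → ℝ) : mean (fun v => f v - g v) = mean f - mean g := by
  simp only [mean, Finset.sum_sub_distrib, sub_div]

theorem mean_prod (f : V × X → ℝ) : mean f = mean fun v => mean fun x => f (v, x) := by
  simp only [mean, Fintype.sum_prod_type, Fintype.card_prod, ← Finset.sum_div, div_div]
  push_cast
  rw [mul_comm]

theorem mean_comm (f : V → X → ℝ) :
    (mean fun v => mean fun x => f v x) = mean fun x => mean fun v => f v x := by
  simp only [mean, ← Finset.sum_div, div_div]
  rw [Finset.sum_comm, mul_comm]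

theorem mean_comp_equiv (e : V' ≃ V) (f : V → ℝ) : mean (fun v => f (e v)) = mean f := by
  simp only [mean, e.sum_comp f, Fintype.card_congr e]

theorem mean_comp_bijective {e : V → V} (he : e.Bijective) (f : V → ℝ) :
    mean (fun v => f (e v)) = mean f := mean_comp_equiv (.ofBijective e he) f

/-- The family `g` consists of permutations, and averaging over it contracts functions of mean
`0` by the factor `lam`. -/
structure IsExp (g : L → V → V) (lam : ℝ) : Prop where
  bij : ∀ l, (g l).Bijective
  bound : ∀ f : V → ℝ, nrm (fun v => walk g f v - mean f) ≤ lam * nrm f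

/-- The walk is an average of permutation operators, each of which is an isometry. -/
theorem nrm_walk_le {g : L → V → V} (hg : ∀ l, (g l).Bijective) (f : V → ℝ) :
    nrm (walk g f) ≤ nrm f := by
  have h : walk g f = fun v => (Fintype.card L : ℝ)⁻¹ * ∑ l, f (g l v) := by
    funext v; rw [walk, mean, div_eq_inv_mul]
  rw [h, nrm_smul (f := fun v => ∑ l, f (g l v))]
  have := nrm_sum_le Finset.univ (fun l v => f (g l v))
  simp only [nrm_comp_bijective (hg _), Finset.sum_const, Finset.card_univ, nsmul_eq_mul] at this
  rw [abs_of_nonneg (by positivity)]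
  rcases isEmpty_or_nonempty L with h | h
  · simp [nrm_nonneg]
  · have hc : (0 : ℝ) < Fintype.card L := by exact_mod_cast Fintype.card_pos
    rw [inv_mul_le_iff₀ hc]
    exact this

theorem mean_walk [Nonempty L] {g : L → V → V} (hg : ∀ l, (g l).Bijective) (f : V → ℝ) :
    mean (walk g f) = mean f := by
  change (mean fun v => mean fun l => f (g l v)) = _
  rw [mean_comm]
  simp only [mean_comp_bijective (hg _), mean_const]

theorem IsExp.mono {g : L → V → V} {lam lam' : ℝ} (h : IsExp g lam) (hl : lam ≤ lam') :
    IsExp g lam' :=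
  ⟨h.bij, fun f => (h.bound f).trans (mul_le_mul_of_nonneg_right hl (nrm_nonneg _))⟩

/-- Walking along a pair of labels applies the averaging operator twice. Permutations preserve the
mean, so the deviation after the first application has mean zero and is contracted again. -/
theorem IsExp.comp [Nonempty L] [Nonempty V] {g : L → V → V} {lam : ℝ} (h : IsExp g lam)
    (hl : 0 ≤ lam) : IsExp (fun (p : L × L) v => g p.2 (g p.1 v)) (lam ^ 2) := by
  refine ⟨fun p => (h.bij p.2).comp (h.bij p.1), fun f => ?_⟩
  have e : ∀ v, walk (fun (p : L × L) v => g p.2 (g p.1 v)) f v = walk g (walk g f) v := by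
    intro v
    simp only [walk, mean_prod]
  have e' : ∀ v, walk g (walk g f) v - mean f =
      walk g (fun v => walk g f v - mean f) v - mean fun v => walk g f v - mean f := by
    intro v
    have e0 : (mean fun v => walk g f v - mean f) = 0 := by
      rw [mean_sub, mean_const]
      exact sub_eq_zero.2 (mean_walk h.bij f)
    rw [e0, sub_zero]
    simp only [walk, mean_sub, mean_const]
  simp only [e, e']
  refine (h.bound _).trans ?_
  rw [sq, mul_assoc]
  exact mul_le_mul_of_nonneg_left (h.bound f) hl

theorem IsExp.congr {g : L → V → V} {lam : ℝ} (h : IsExp g lam) (eL : L' ≃ L) (eV : V' ≃ V) :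
    IsExp (fun l v => eV.symm (g (eL l) (eV v))) lam := by
  refine ⟨fun l => eV.symm.bijective.comp ((h.bij _).comp eV.bijective), fun f => ?_⟩
  have := h.bound fun v => f (eV.symm v)
  rw [nrm_comp_equiv eV.symm f, mean_comp_equiv eV.symm f, ← nrm_comp_equiv eV] at this
  refine le_trans (le_of_eq ?_) this
  congr 1
  funext v
  rw [walk, walk, mean_comp_equiv eL (fun l => f (eV.symm (g l (eV v))))]

/-- The zig-zag product of a family of permutations of `V` indexed by `X` with a family of
permutations of `X`. -/
def zigzag (w : X → V → V) (h : L → X → X) (p : L × L) (u : V × X) : V × X :=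
  (w (h p.1 u.2) u.1, h p.2 (h p.1 u.2))

/-- Let H average over the labels in the second coordinate, J average over all of that coordinate,
and let P move the first coordinate by `w`. The zig-zag walk is H P H. On each fibre H differs from
J by an operator of norm at most `lh`, and J P J is the walk of `w` on fibre means. Replacing both
copies of H by J therefore costs `2 * lh`. Each `w x` is itself a permutation, so no compatible
numbering of reversed edges is needed. -/
theorem IsExp.zigzag [Nonempty V] [Nonempty X] [Nonempty L] {w : X → V → V} {h : L → X → X}
    {lw lh : ℝ} (hw : IsExp w lw) (hh : IsExp h lh) (hlh : 0 ≤ lh) (hlw : 0 ≤ lw) :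
    IsExp (zigzag w h) (lw + 2 * lh) := by
  let hx : L → V × X → V × X := fun l u => (u.1, h l u.2)
  let P : V × X → V × X := fun u => (w u.2 u.1, u.2)
  have bhx : ∀ l, (hx l).Bijective := fun l =>
    ((Equiv.refl V).prodCongr (.ofBijective _ (hh.bij l))).bijective
  have bP : P.Bijective := by
    have : P.Injective := by
      rintro ⟨v, x⟩ ⟨v', x'⟩ e
      simp only [P, Prod.mk.injEq] at e
      obtain ⟨e1, rfl⟩ := e
      rw [(hw.bij x).1 e1]
    exact Finite.injective_iff_bijective.1 this
  have hEb : ∀ k : V × X → ℝ,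
      nrm (fun u : V × X => walk hx k u - mean fun x => k (u.1, x)) ≤ lh * nrm k := by
    intro k
    refine nrm_le_of_sq_le hlh ?_
    rw [Fintype.sum_prod_type, Fintype.sum_prod_type, Finset.mul_sum]
    refine Finset.sum_le_sum fun v _ => ?_
    exact sum_sq_le_of_nrm_le (hh.bound fun x => k (v, x))
  have hJb : ∀ k : V × X → ℝ, nrm (fun u : V × X => mean fun x => k (u.1, x)) ≤ nrm k := by
    intro k
    rw [← one_mul (nrm k)]
    refine nrm_le_of_sq_le zero_le_one ?_
    rw [Fintype.sum_prod_type, Fintype.sum_prod_type, Finset.mul_sum]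
    refine Finset.sum_le_sum fun v _ => ?_
    refine sum_sq_le_of_nrm_le ?_
    rw [one_mul]
    exact nrm_mean_le fun x => k (v, x)
  constructor
  · rintro ⟨l, l'⟩
    exact (bhx l').comp (bP.comp (bhx l))
  intro f
  let F : V → ℝ := fun v => mean fun x => f (v, x)
  let JF : V × X → ℝ := fun u => F u.1
  let E : V × X → ℝ := fun u => walk hx f u - F u.1
  -- With H f = JF + E, the three summands are H P E, (H - J) P JF and the deviation of the walk of
  -- `w` on the fibre means.
  have hsplit : ∀ u : V × X, walk (_root_.zigzag w h) f u - mean f =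
      walk hx (fun u => E (P u)) u +
      ((walk hx (fun u => JF (P u)) u - mean fun x => JF (P (u.1, x))) +
        (walk w F u.1 - mean F)) := by
    intro u
    have e1 : mean f = mean F := mean_prod f
    have e2 : walk w F u.1 = mean fun x => JF (P (u.1, x)) := rfl
    have e3 : walk (_root_.zigzag w h) f u = walk hx (fun u => walk hx f (P u)) u := by
      simp only [walk, mean_prod]
      rfl
    have e4 : walk hx (fun u => walk hx f (P u)) u =
        walk hx (fun u => E (P u)) u + walk hx (fun u => JF (P u)) u := by
      rw [walk, walk, walk, ← mean_add]
      simp [E, JF]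
    rw [e1, e2, e3, e4]
    ring
  simp only [hsplit]
  have b1 : nrm (walk hx (fun u => E (P u))) ≤ lh * nrm f :=
    (nrm_walk_le bhx _).trans ((nrm_comp_bijective bP E).le.trans (hEb f))
  have b2 := (hEb (fun u => JF (P u))).trans (mul_le_mul_of_nonneg_left
    ((nrm_comp_bijective bP JF).le.trans (hJb f)) hlh)
  have b3 : nrm (fun u : V × X => walk w F u.1 - mean F) ≤ lw * nrm f := by
    refine le_trans ?_ (mul_le_mul_of_nonneg_left (hJb f) hlw)
    refine nrm_le_of_sq_le hlw ?_
    simp only [Fintype.sum_prod_type, Finset.sum_const, ← Finset.smul_sum]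
    rw [mul_smul_comm]
    exact nsmul_le_nsmul_right (sum_sq_le_of_nrm_le (hw.bound F)) _
  have := nrm_add_le (walk hx (fun u => E (P u)))
    (fun u => (walk hx (fun u => JF (P u)) u - mean fun x => JF (P (u.1, x))) +
        (walk w F u.1 - mean F))
  have := nrm_add_le (fun u : V × X => walk hx (fun u => JF (P u)) u - mean fun x => JF (P (u.1, x)))
    (fun u => walk w F u.1 - mean F)
  linarith

end expander

/-- The rotations of `Fin s` by `0, 1, …, X - 1`. -/
theorem isExp_rotation (s X : ℕ) [NeZero s] (hX : 0 < X) :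
    IsExp (fun (x : Fin X) (v : Fin s) => v + Fin.ofNat s x) ((s : ℝ) / X) := by
  refine ⟨fun x => (Equiv.addRight (Fin.ofNat s x)).bijective, fun f => ?_⟩
  have hs : (0 : ℝ) < s := by exact_mod_cast Nat.pos_of_ne_zero (NeZero.ne s)
  have hX' : (0 : ℝ) < X := by exact_mod_cast hX
  set f' : Fin s → ℝ := fun v => f v - mean f with hf'
  have hsum : ∀ v : Fin s, ∑ i ∈ Finset.range s, f' (v + Fin.ofNat s i) = 0 := by
    intro v
    rw [← Fin.sum_univ_eq_sum_range (fun i => f' (v + Fin.ofNat s i)) s]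
    rw [Fintype.sum_equiv (Equiv.addLeft v) (fun i : Fin s => f' (v + Fin.ofNat s i)) f'
      (fun i => by simp)]
    simp only [hf', Finset.sum_sub_distrib, mean]
    simp
    field_simp
    simp
  -- Any `s` consecutive rotations run once through the whole cycle and sum a function of mean zero
  -- to zero. Only the last `X % s` rotations, fewer than `s` of the `X`, contribute.
  have hcyc : ∀ (v : Fin s) (c r : ℕ), ∑ i ∈ Finset.range (c * s + r), f' (v + Fin.ofNat s i) =
      ∑ i ∈ Finset.range r, f' (v + Fin.ofNat s i) := by
    intro v c r
    induction c with
    | zero => simp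
    | succ c ih =>
      rw [show (c + 1) * s + r = s + (c * s + r) by ring, Finset.sum_range_add, hsum, zero_add,
        ← ih]
      refine Finset.sum_congr rfl fun i _ => ?_
      congr 2
      ext; simp
  have e : ∀ v, walk (fun (x : Fin X) (v : Fin s) => v + Fin.ofNat s x) f v - mean f =
      (X : ℝ)⁻¹ * ∑ i ∈ Finset.range (X % s), f' (v + Fin.ofNat s i) := by
    intro v
    rw [← hcyc v (X / s) (X % s), Nat.div_add_mod' X s,
      ← Fin.sum_univ_eq_sum_range (fun i => f' (v + Fin.ofNat s i)) X]
    simp only [hf', Finset.sum_sub_distrib, walk]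
    rw [mean]
    simp
    field_simp
  simp only [e]
  rw [nrm_smul (f := fun v => ∑ i ∈ Finset.range (X % s), f' (v + Fin.ofNat s i)),
    abs_of_pos (inv_pos.2 hX')]
  have h1 := nrm_sum_le (Finset.range (X % s)) (fun i v => f' (v + Fin.ofNat s i))
  have h2 : ∀ i, nrm (fun v => f' (v + Fin.ofNat s i)) = nrm f' := fun i =>
    nrm_comp_equiv (Equiv.addRight (Fin.ofNat s i)) f'
  simp only [h2, Finset.sum_const, Finset.card_range, nsmul_eq_mul] at h1
  have h3 : nrm f' ≤ nrm f := by
    rw [← one_mul (nrm f)]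
    refine nrm_le_of_sq_le zero_le_one ?_
    have hm : ∑ v, f v = s * mean f := by
      rw [mean]; simp; field_simp
    have : ∑ v, f' v ^ 2 = ∑ v, f v ^ 2 - s * mean f ^ 2 := by
      have : ∀ v, f' v ^ 2 = f v ^ 2 - 2 * mean f * f v + mean f ^ 2 := fun v => by
        simp only [hf']; ring
      simp only [this, Finset.sum_add_distrib, Finset.sum_sub_distrib, ← Finset.mul_sum, hm]
      simp; ring
    rw [this]
    nlinarith [sq_nonneg (mean f)]
  have h4 : ((X % s : ℕ) : ℝ) ≤ s := by
    exact_mod_cast (Nat.mod_lt _ (Nat.pos_of_ne_zero (NeZero.ne s))).le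
  rw [div_eq_inv_mul, mul_assoc]
  refine mul_le_mul_of_nonneg_left (h1.trans ?_) (inv_nonneg.2 hX'.le)
  exact mul_le_mul h4 h3 (nrm_nonneg _) hs.le

/-! ### Translations along the moment curve -/

section moment

variable {q j : ℕ} [NeZero q]

open ZMod

/-- The exponential sum of `f` at the frequency `ξ`. -/
noncomputable def expSum (f : (Fin j → ZMod q) → ℝ) (ξ : Fin j → ZMod q) : ℂ :=
  ∑ x, (f x : ℂ) * stdAddChar (ξ ⬝ᵥ x)

/-- Orthogonality of characters: for c ≠ 0 the map ξ ↦ ξ ⬝ᵥ c is a non-zero homomorphism, so its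
composition with the injective character is non-trivial. -/
theorem sum_stdAddChar_dotProduct (c : Fin j → ZMod q) :
    ∑ ξ : Fin j → ZMod q, (stdAddChar (ξ ⬝ᵥ c) : ℂ) = if c = 0 then (q : ℂ) ^ j else 0 := by
  split_ifs with hc
  · subst hc
    simp [ZMod.card]
  · let φ : (Fin j → ZMod q) →+ ZMod q :=
      ⟨⟨fun ξ => ξ ⬝ᵥ c, by simp⟩, fun ξ η => by simp [add_dotProduct]⟩
    have h : stdAddChar.compAddMonoidHom φ ≠ 1 := by
      intro h
      apply hc
      funext i
      have h1 : stdAddChar (φ (Pi.single i 1)) = (1 : ℂ) := by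
        have := DFunLike.congr_fun h (Pi.single i 1)
        simpa using this
      rw [← (stdAddChar (N := q)).map_zero_eq_one] at h1
      have := injective_stdAddChar h1
      simpa [φ] using this
    exact AddChar.sum_eq_zero_of_ne_one h

/-- Parseval's identity, by expanding the square and using orthogonality of characters. -/
theorem sum_normSq_expSum (f : (Fin j → ZMod q) → ℝ) :
    ∑ ξ, ‖expSum f ξ‖ ^ 2 = (q : ℝ) ^ j * ∑ x, f x ^ 2 := by
  have h : ∀ ξ, ((‖expSum f ξ‖ ^ 2 : ℝ) : ℂ) =
      ∑ x, ∑ x', ((f x * f x' : ℝ) : ℂ) * stdAddChar (ξ ⬝ᵥ (x - x')) := by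
    intro ξ
    rw [Complex.ofReal_pow, ← Complex.mul_conj', expSum, map_sum, Finset.sum_mul_sum]
    refine Finset.sum_congr rfl fun x _ => Finset.sum_congr rfl fun x' _ => ?_
    rw [map_mul, Complex.conj_ofReal, ← AddChar.map_neg_eq_conj, dotProduct_sub,
      sub_eq_add_neg, AddChar.map_add_eq_mul]
    push_cast
    ring
  have : ((∑ ξ, ‖expSum f ξ‖ ^ 2 : ℝ) : ℂ) = ((q : ℝ) ^ j * ∑ x, f x ^ 2 : ℝ) := by
    rw [Complex.ofReal_sum]
    simp only [h]
    rw [Finset.sum_comm]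
    have : ∀ x, ∑ ξ : Fin j → ZMod q, ∑ x', ((f x * f x' : ℝ) : ℂ) * stdAddChar (ξ ⬝ᵥ (x - x')) =
        ((q : ℝ) ^ j * f x ^ 2 : ℝ) := by
      intro x
      rw [Finset.sum_comm]
      simp only [← Finset.mul_sum, sum_stdAddChar_dotProduct, sub_eq_zero]
      simp
      ring
    simp only [this]
    rw [Finset.mul_sum, Complex.ofReal_sum]
  exact_mod_cast this

variable (q j) in
/-- The translation of `(ZMod q) ^ j` by `y (1, z, …, z ^ (j - 1))`. -/
def momentShift (p : ZMod q × ZMod q) (x : Fin j → ZMod q) : Fin j → ZMod q :=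
  x + p.1 • fun i : Fin j => p.2 ^ (i : ℕ)

-- The left side counts roots of the polynomial with coefficients ξ, which is non-zero of degree
-- below `j`.
omit [NeZero q] in
theorem card_roots_lt [Fact q.Prime] {ξ : Fin j → ZMod q} (hξ : ξ ≠ 0) :
    {z : ZMod q | ξ ⬝ᵥ (fun i => z ^ (i : ℕ)) = 0}.ncard ≤ j := by
  classical
  let P : Polynomial (ZMod q) := ∑ i : Fin j, Polynomial.monomial (i : ℕ) (ξ i)
  have hP : P ≠ 0 := by
    intro h
    apply hξ
    funext i
    have : P.coeff i = ξ i := by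
      simp only [P, Polynomial.finsetSum_coeff, Polynomial.coeff_monomial]
      rw [Finset.sum_eq_single i] <;> simp +contextual [Fin.ext_iff]
    rw [← this, h]; simp
  have hdeg : P.natDegree ≤ j := by
    refine Polynomial.natDegree_sum_le_of_forall_le _ _ fun i _ => ?_
    exact (Polynomial.natDegree_monomial_le _).trans i.2.le
  have hsub : {z : ZMod q | ξ ⬝ᵥ (fun i => z ^ (i : ℕ)) = 0} ⊆ (P.roots.toFinset : Set (ZMod q)) := by
    intro z hz
    simp only [Finset.mem_coe, Multiset.mem_toFinset, Polynomial.mem_roots hP, Polynomial.IsRoot,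
      P, Polynomial.eval_finsetSum, Polynomial.eval_monomial]
    exact hz
  calc _ ≤ (P.roots.toFinset : Set (ZMod q)).ncard := Set.ncard_le_ncard hsub
    _ = P.roots.toFinset.card := Set.ncard_coe_finset _
    _ ≤ P.roots.card := Multiset.toFinset_card_le _
    _ ≤ _ := (Polynomial.card_roots' P).trans hdeg

/-- Translations are diagonal in the Fourier basis. Averaging the character of -y·ξ(z) over y, where
ξ(z) is the polynomial with coefficients ξ, gives 1 if z is a root and 0 otherwise, so the
eigenvalue is the proportion of roots z. -/
theorem expSum_walk_momentShift [Fact q.Prime] (f : (Fin j → ZMod q) → ℝ) (ξ : Fin j → ZMod q) :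
    expSum (walk (momentShift q j) f) ξ =
      ({z : ZMod q | ξ ⬝ᵥ (fun i => z ^ (i : ℕ)) = 0}.ncard / q : ℝ) * expSum f ξ := by
  classical
  have hq : (q : ℂ) ≠ 0 := by exact_mod_cast NeZero.ne q
  have h1 : ∀ p : ZMod q × ZMod q, ∑ x, (f (momentShift q j p x) : ℂ) * stdAddChar (ξ ⬝ᵥ x) =
      stdAddChar (-p.1 * (ξ ⬝ᵥ fun i => p.2 ^ (i : ℕ))) * expSum f ξ := by
    intro p
    rw [expSum, Finset.mul_sum]
    refine Fintype.sum_equiv (Equiv.addRight (p.1 • fun i : Fin j => p.2 ^ (i : ℕ))) _ _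
      fun x => ?_
    simp only [Equiv.coe_addRight, momentShift, dotProduct_add, dotProduct_smul,
      AddChar.map_add_eq_mul, smul_eq_mul]
    have h0 : stdAddChar (-p.1 * (ξ ⬝ᵥ fun i => p.2 ^ (i : ℕ))) *
        stdAddChar (p.1 * (ξ ⬝ᵥ fun i => p.2 ^ (i : ℕ))) = (1 : ℂ) := by
      rw [← AddChar.map_add_eq_mul, neg_mul, neg_add_cancel, AddChar.map_zero_eq_one]
    linear_combination (-(f (x + p.1 • fun i : Fin j => p.2 ^ (i : ℕ)) : ℂ) *
      stdAddChar (ξ ⬝ᵥ x)) * h0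
  have h2 : expSum (walk (momentShift q j) f) ξ = ((q : ℂ) * q)⁻¹ *
      ∑ p : ZMod q × ZMod q, stdAddChar (-p.1 * (ξ ⬝ᵥ fun i => p.2 ^ (i : ℕ))) * expSum f ξ := by
    simp only [← h1]
    rw [Finset.sum_comm, Finset.mul_sum, expSum]
    refine Finset.sum_congr rfl fun x _ => ?_
    rw [← Finset.sum_mul, ← mul_assoc]
    congr 1
    simp [walk, mean, div_eq_inv_mul, ZMod.card]
  have h3 : ∀ z : ZMod q, ∑ y : ZMod q, (stdAddChar (-y * (ξ ⬝ᵥ fun i => z ^ (i : ℕ))) : ℂ) =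
      if ξ ⬝ᵥ (fun i => z ^ (i : ℕ)) = 0 then (q : ℂ) else 0 := by
    intro z
    have := AddChar.sum_mulShift (ξ ⬝ᵥ fun i => z ^ (i : ℕ)) (isPrimitive_stdAddChar q)
    rw [ZMod.card, Fintype.sum_equiv (Equiv.neg (ZMod q)) _
      (fun y => stdAddChar (-y * (ξ ⬝ᵥ fun i => z ^ (i : ℕ)))) (fun y => by simp)] at this
    rw [this]
    split_ifs <;> simp
  rw [h2, ← Finset.sum_mul, Fintype.sum_prod_type, Finset.sum_comm]
  simp only [h3]
  rw [← Finset.sum_filter, Finset.sum_const, nsmul_eq_mul, ← mul_assoc]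
  congr 1
  rw [Set.ncard_eq_toFinset_card', Set.toFinset_ofPred]
  push_cast
  field_simp

/-- By Parseval's identity it suffices to compare frequencies. Subtracting the mean removes the
frequency 0, and every other eigenvalue is at most `j / q` by the root count. -/
theorem isExp_momentShift [Fact q.Prime] : IsExp (momentShift q j) ((j : ℝ) / q) := by
  refine ⟨fun p => (Equiv.addRight (p.1 • fun i : Fin j => p.2 ^ (i : ℕ))).bijective,
    fun f => ?_⟩
  have hq : (0 : ℝ) < q := by exact_mod_cast Nat.pos_of_ne_zero (NeZero.ne q)
  refine nrm_le_of_sq_le (by positivity) ?_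
  have hqj : (0 : ℝ) < (q : ℝ) ^ j := by positivity
  refine le_of_mul_le_mul_left ?_ hqj
  rw [mul_left_comm, ← sum_normSq_expSum, ← sum_normSq_expSum, Finset.mul_sum]
  refine Finset.sum_le_sum fun ξ _ => ?_
  have hsplit : expSum (fun x => walk (momentShift q j) f x - mean f) ξ =
      expSum (walk (momentShift q j) f) ξ - mean f * if ξ = 0 then (q : ℂ) ^ j else 0 := by
    rw [← sum_stdAddChar_dotProduct ξ, expSum, expSum, Finset.mul_sum, ← Finset.sum_sub_distrib]
    refine Finset.sum_congr rfl fun x _ => ?_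
    rw [dotProduct_comm x ξ]
    push_cast
    ring
  rw [hsplit]
  by_cases hξ : ξ = 0
  · subst hξ
    have h0 : expSum (walk (momentShift q j) f) 0 = mean f * (q : ℂ) ^ j := by
      have hc : (q : ℂ) ≠ 0 := by exact_mod_cast NeZero.ne q
      rw [expSum_walk_momentShift]
      simp [Set.ncard_univ, ZMod.card, expSum, mean]
    rw [h0]
    simp
    positivity
  · rw [if_neg hξ, mul_zero, sub_zero, expSum_walk_momentShift, norm_mul, mul_pow]
    refine mul_le_mul_of_nonneg_right ?_ (by positivity)
    rw [Complex.norm_real, Real.norm_of_nonneg (by positivity)]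
    refine pow_le_pow_left₀ (by positivity) ?_ 2
    gcongr
    exact_mod_cast card_roots_lt hξ

end moment

/-- The translations along the moment curve, in terms of digits in base `q`. -/
theorem exists_isExp_digits {q : ℕ} (hq : q.Prime) (j : ℕ) :
    ∃ h : Fin (q * q) → Fin (q ^ j) → Fin (q ^ j), IsExp h ((j : ℝ) / q) ∧
      ∀ (y z : ℕ) (hyz : y * q + z < q * q) (x : Fin (q ^ j)), z < q →
        (h ⟨y * q + z, hyz⟩ x : ℕ) =
          ∑ i ∈ Finset.range j, ((x : ℕ) / q ^ i + y * z ^ i) % q * q ^ i := by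
  have : Fact q.Prime := ⟨hq⟩
  have : NeZero q := ⟨hq.ne_zero⟩
  let e : Fin q ≃ ZMod q := (ZMod.finEquiv q).toEquiv
  have he : ∀ i : Fin q, e i = ((i : ℕ) : ZMod q) := by
    intro i
    -- `ZMod q` is defined by cases on `q`; in the form k + 1 it unfolds to `Fin (k + 1)`.
    obtain ⟨k, rfl⟩ := Nat.exists_eq_succ_of_ne_zero hq.ne_zero
    exact (Fin.cast_val_eq_self i).symm
  have he' : ∀ a : ZMod q, (e.symm a : ℕ) = a.val := by
    intro a
    obtain ⟨k, rfl⟩ := Nat.exists_eq_succ_of_ne_zero hq.ne_zero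
    rfl
  let eX : Fin (q ^ j) ≃ (Fin j → ZMod q) :=
    finFunctionFinEquiv.symm.trans (Equiv.piCongrRight fun _ => e)
  let eL : Fin (q * q) ≃ ZMod q × ZMod q := finProdFinEquiv.symm.trans (e.prodCongr e)
  refine ⟨_, (isExp_momentShift (q := q) (j := j)).congr eL eX, ?_⟩
  intro y z hyz x hz
  have hy : y < q := by
    by_contra h
    have := Nat.mul_le_mul_right q (not_lt.1 h)
    omega
  have hL : eL ⟨y * q + z, hyz⟩ = ((y : ZMod q), (z : ZMod q)) := by
    have : (⟨y * q + z, hyz⟩ : Fin (q * q)) = finProdFinEquiv (⟨y, hy⟩, ⟨z, hz⟩) := by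
      ext; simp [finProdFinEquiv]; ring
    simp only [eL, Equiv.trans_apply, this, Equiv.symm_apply_apply, Equiv.prodCongr_apply,
      Prod.map_apply, he]
  rw [hL]
  simp only [eX, Equiv.symm_trans_apply, Equiv.symm_symm, Equiv.trans_apply,
    finFunctionFinEquiv_apply]
  rw [Finset.sum_range]
  refine Finset.sum_congr rfl fun i _ => ?_
  congr 1
  simp only [Equiv.piCongrRight, Equiv.coe_fn_mk, Equiv.coe_fn_symm_mk, Pi.map_apply, he', momentShift, Pi.add_apply,
    Pi.smul_apply, smul_eq_mul, he]
  rw [← ZMod.val_natCast]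
  congr 1
  push_cast
  congr 1
  simp [finFunctionFinEquiv]

/-! ### Quadratic forms of product graphs -/

section forms

variable {n : ℕ}

theorem l1Norm_eq_sum {a : Fin n → ℝ} (ha : ∀ i, 0 ≤ a i) : l1Norm a = ∑ i, a i :=
  Finset.sum_congr rfl fun i _ => abs_of_nonneg (ha i)

theorem l1Norm_pos {a : Fin n → ℝ} (ha0 : a ≠ 0) : 0 < l1Norm a := by
  obtain ⟨i, hi⟩ := Function.ne_iff.1 ha0
  exact Finset.sum_pos' (fun i _ => abs_nonneg _) ⟨i, Finset.mem_univ i, abs_pos.2 hi⟩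

/-- The total weight times the variance of `x` for the weights `w`. -/
noncomputable def varForm (w x : Fin n → ℝ) : ℝ := ∑ i, w i * x i ^ 2 - (w ⬝ᵥ x) ^ 2 / ∑ i, w i

/-- Cauchy-Schwarz with weights `w`. If the total weight is 0, the quotient is 0 by the convention
for division by zero. -/
theorem varForm_nonneg {w : Fin n → ℝ} (hw : ∀ i, 0 ≤ w i) (x : Fin n → ℝ) : 0 ≤ varForm w x := by
  have h : (w ⬝ᵥ x) ^ 2 ≤ (∑ i, w i) * ∑ i, w i * x i ^ 2 := by
    refine Finset.sum_sq_le_sum_mul_sum_of_sq_le_mul _ (fun i _ => hw i)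
      (fun i _ => mul_nonneg (hw i) (sq_nonneg _)) fun i _ => le_of_eq ?_
    ring
  rcases (Finset.sum_nonneg fun i _ => hw i : 0 ≤ ∑ i, w i).eq_or_lt with h0 | h0
  · rw [varForm, ← h0, div_zero, sub_zero]
    exact Finset.sum_nonneg fun i _ => mul_nonneg (hw i) (sq_nonneg _)
  · rw [varForm, sub_nonneg, div_le_iff₀ h0, mul_comm]
    exact h

theorem sum_mul_sub_mean_sq {w : Fin n → ℝ} (hw : 0 < ∑ i, w i) (x : Fin n → ℝ) :
    ∑ i, w i * (x i - (w ⬝ᵥ x) / ∑ i, w i) ^ 2 = varForm w x := by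
  set c := (w ⬝ᵥ x) / ∑ i, w i with hc
  have h : ∀ i, w i * (x i - c) ^ 2 = w i * x i ^ 2 - 2 * c * (w i * x i) + c ^ 2 * w i :=
    fun i => by ring
  simp only [h, Finset.sum_add_distrib, Finset.sum_sub_distrib, ← Finset.mul_sum]
  rw [show ∑ i, w i * x i = w ⬝ᵥ x from rfl, varForm, hc]
  field_simp
  ring

theorem dotProduct_diagonal_mulVec (w x : Fin n → ℝ) :
    x ⬝ᵥ diagonal w *ᵥ x = ∑ i, w i * x i ^ 2 := by
  simp only [dotProduct, mulVec_diagonal]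
  exact Finset.sum_congr rfl fun i _ => by ring

theorem dotProduct_prodAdj_mulVec (a b x y : Fin n → ℝ) :
    x ⬝ᵥ prodAdj a b *ᵥ y = (b ⬝ᵥ x) * (a ⬝ᵥ y) / l1Norm a := by
  rw [prodAdj, smul_mulVec, dotProduct_smul, vecMulVec_mulVec, dotProduct_smul]
  simp only [MulOpposite.smul_eq_mul_unop, MulOpposite.unop_op, smul_eq_mul, dotProduct_comm x b]
  ring

/-- The quadratic form of `bipLap a b C`. -/
theorem bipLap_form (a b : Fin n → ℝ) (C : Matrix (Fin n) (Fin n) ℝ) (x y : Fin n → ℝ) :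
    Sum.elim x y ⬝ᵥ bipLap a b C *ᵥ Sum.elim x y =
      ∑ i, b i * x i ^ 2 + ∑ i, a i * y i ^ 2 - 2 * (x ⬝ᵥ C *ᵥ y) := by
  rw [bipLap, fromBlocks_mulVec, sumElim_dotProduct_sumElim]
  simp only [Sum.elim_comp_inl, Sum.elim_comp_inr, dotProduct_add, dotProduct_diagonal_mulVec,
    neg_mulVec, dotProduct_neg]
  rw [mulVec_transpose, dotProduct_comm y (x ᵥ* C), ← dotProduct_mulVec]
  ring

variable {a b : Fin n → ℝ} (ha : ∀ i, 0 ≤ a i) (hb : ∀ i, 0 ≤ b i) (ha0 : a ≠ 0)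
  (hab : l1Norm a = l1Norm b)

include ha hb ha0 hab

/-- The form splits into a variance on each side and a multiple of the squared difference of the two
means. It therefore dominates the variances, and equals them on centred vectors. -/
theorem bipProdLap_form (x y : Fin n → ℝ) :
    Sum.elim x y ⬝ᵥ bipProdLap a b *ᵥ Sum.elim x y =
      varForm b x + varForm a y + (b ⬝ᵥ x - a ⬝ᵥ y) ^ 2 / l1Norm a := by
  have hd := (l1Norm_pos ha0).ne'
  rw [bipProdLap, bipLap_form, dotProduct_prodAdj_mulVec, varForm, varForm, ← l1Norm_eq_sum ha,
    ← l1Norm_eq_sum hb, ← hab]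
  field_simp
  ring

omit hb hab in
theorem outDeg_prodAdj : outDeg (prodAdj a b) = b := by
  have hd := (l1Norm_pos ha0).ne'
  funext i
  simp only [outDeg, prodAdj, Matrix.smul_apply, vecMulVec_apply, smul_eq_mul, ← Finset.mul_sum,
    ← l1Norm_eq_sum ha]
  field_simp

omit ha in
theorem inDeg_prodAdj : inDeg (prodAdj a b) = a := by
  have hd := (l1Norm_pos ha0).ne'
  funext i
  simp only [inDeg, prodAdj, Matrix.smul_apply, vecMulVec_apply, smul_eq_mul, ← Finset.mul_sum,
    ← Finset.sum_mul, ← l1Norm_eq_sum hb, ← hab]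
  field_simp

/-- The form of U is half the form of the bipartite product graph on the diagonal vectors (x, x).
This is how variances are compared with U. -/
theorem dirLap_undirectify_form (x : Fin n → ℝ) :
    x ⬝ᵥ dirLap (undirectify (prodAdj a b)) *ᵥ x =
      (varForm b x + varForm a x + (b ⬝ᵥ x - a ⬝ᵥ x) ^ 2 / l1Norm a) / 2 := by
  have hd := (l1Norm_pos ha0).ne'
  have hout : outDeg (undirectify (prodAdj a b)) = fun i => (1 / 2) * (b i + a i) := by
    funext i
    have h1 := congr_fun (outDeg_prodAdj (b := b) ha ha0) i
    have h2 := congr_fun (inDeg_prodAdj hb ha0 hab) i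
    simp only [outDeg, inDeg] at h1 h2
    simp only [outDeg, undirectify, Matrix.smul_apply, Matrix.add_apply, transpose_apply,
      smul_eq_mul, ← Finset.mul_sum, Finset.sum_add_distrib, h1, h2]
  rw [dirLap, sub_mulVec, dotProduct_sub, hout, dotProduct_diagonal_mulVec, mulVec_transpose,
    dotProduct_comm x, ← dotProduct_mulVec, undirectify, smul_mulVec, dotProduct_smul, add_mulVec,
    dotProduct_add, mulVec_transpose, dotProduct_comm x (x ᵥ* _), ← dotProduct_mulVec,
    dotProduct_prodAdj_mulVec, varForm, varForm, ← l1Norm_eq_sum ha, ← l1Norm_eq_sum hb, ← hab]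
  have : ∑ i, 1 / 2 * (b i + a i) * x i ^ 2 =
      (∑ i, b i * x i ^ 2 + ∑ i, a i * x i ^ 2) / 2 := by
    rw [← Finset.sum_add_distrib, Finset.sum_div]
    exact Finset.sum_congr rfl fun i _ => by ring
  rw [this, smul_eq_mul]
  field_simp
  ring

/-- A bilinear form that ignores constants and is bounded by the form of the product graph is
bounded by the variances. -/
theorem abs_form_le_varForm {D : Matrix (Fin n) (Fin n) ℝ} {κ : ℝ}
    (h1 : D *ᵥ (fun _ => 1) = 0) (h2 : Dᵀ *ᵥ (fun _ => 1) = 0)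
    (h : ∀ x y, |x ⬝ᵥ D *ᵥ y| ≤ κ * (∑ i, b i * x i ^ 2 + ∑ i, a i * y i ^ 2 -
      2 * ((b ⬝ᵥ x) * (a ⬝ᵥ y) / l1Norm a))) (x y : Fin n → ℝ) :
    |x ⬝ᵥ D *ᵥ y| ≤ κ * (varForm b x + varForm a y) := by
  have hd := l1Norm_pos ha0
  have hda : 0 < ∑ i, a i := by rwa [← l1Norm_eq_sum ha]
  have hdb : 0 < ∑ i, b i := by rwa [← l1Norm_eq_sum hb, ← hab]
  -- Both vectors are replaced by their deviations from the mean. The left side does not change,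
  -- because `D` kills constants on both sides; on the right the cross term vanishes and the sums of
  -- squares become variances.
  set c := (b ⬝ᵥ x) / ∑ i, b i
  set c' := (a ⬝ᵥ y) / ∑ i, a i
  have e1 : (fun i => x i - c) = x - c • fun _ => 1 := by funext i; simp
  have e2 : (fun i => y i - c') = y - c' • fun _ => 1 := by funext i; simp
  have e3 : a ⬝ᵥ (fun i => y i - c') = 0 := by
    rw [e2, dotProduct_sub, dotProduct_smul]
    simp only [dotProduct, mul_one, smul_eq_mul, c']
    field_simp
    ring
  have e4 : (fun i => x i - c) ⬝ᵥ D *ᵥ (fun i => y i - c') = x ⬝ᵥ D *ᵥ y := by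
    rw [e2, mulVec_sub, mulVec_smul, h1, smul_zero, sub_zero, e1, sub_dotProduct, smul_dotProduct,
      dotProduct_mulVec (fun _ => 1), ← mulVec_transpose, h2, zero_dotProduct, smul_zero, sub_zero]
  have := h (fun i => x i - c) (fun i => y i - c')
  rw [e4, e3, mul_zero, zero_div, mul_zero, sub_zero, sum_mul_sub_mean_sq hda,
    sum_mul_sub_mean_sq hdb] at this
  exact this

theorem form_eq_bipProdLap (x y : Fin n → ℝ) :
    ∑ i, b i * x i ^ 2 + ∑ i, a i * y i ^ 2 - 2 * ((b ⬝ᵥ x) * (a ⬝ᵥ y) / l1Norm a) =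
      varForm b x + varForm a y + (b ⬝ᵥ x - a ⬝ᵥ y) ^ 2 / l1Norm a := by
  rw [← bipProdLap_form ha hb ha0 hab, bipProdLap, bipLap_form, dotProduct_prodAdj_mulVec]

end forms

/-! ### The square root of the pseudoinverse -/

section pinvSqrt

variable {n : ℕ} {M : Matrix (Fin n) (Fin n) ℝ}

theorem pinvSqrt_isHermitian : (pinvSqrt M).IsHermitian :=
  cfc_predicate (R := ℝ) (p := IsSelfAdjoint) _ M

-- M^{+/2} M M^{+/2} is the orthogonal projection onto the range of M: its eigenvalues are 1 where M
-- is positive and 0 on the kernel, where the inverse of 0 is 0. A projection is at most the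
-- identity.
open scoped MatrixOrder in
theorem pinvSqrt_mul_mul_le (hM : M.PosSemidef) (x : Fin n → ℝ) :
    (pinvSqrt M *ᵥ x) ⬝ᵥ M *ᵥ (pinvSqrt M *ᵥ x) ≤ x ⬝ᵥ x := by
  have hsa : IsSelfAdjoint M := hM.1
  -- The spectrum is finite, so every function is continuous on it; the reciprocal square root jumps
  -- at 0.
  have hc : ∀ f : ℝ → ℝ, ContinuousOn f (spectrum ℝ M) := fun f =>
    M.finite_real_spectrum.continuousOn f
  have e : pinvSqrt M * M * pinvSqrt M = cfc (fun x : ℝ => (√x)⁻¹ * x * (√x)⁻¹) M := by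
    rw [cfc_mul _ _ M (hc _) (hc _), cfc_mul _ _ M (hc _) (hc _), cfc_id' ℝ M]
    rfl
  have h1 : (1 - pinvSqrt M * M * pinvSqrt M).PosSemidef := by
    rw [e]
    refine Matrix.le_iff.1 (cfc_le_one _ M fun x _ => ?_)
    rcases le_or_gt x 0 with hx | hx
    · rw [Real.sqrt_eq_zero_of_nonpos hx]; simp
    · have := Real.sqrt_pos.2 hx
      have h2 := Real.sq_sqrt hx.le
      field_simp
      rw [h2]
  have := h1.dotProduct_mulVec_nonneg x
  rw [sub_mulVec, one_mulVec, dotProduct_sub, star_trivial, sub_nonneg] at this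
  refine le_trans (le_of_eq ?_) this
  rw [← mulVec_mulVec, ← mulVec_mulVec, dotProduct_mulVec x, ← mulVec_transpose]
  have := (pinvSqrt_isHermitian (M := M)).eq
  rw [conjTranspose_eq_transpose_of_trivial] at this
  rw [this]

end pinvSqrt

theorem specNorm_le {n : ℕ} {M : Matrix (Fin n) (Fin n) ℝ} {c : ℝ} (hc : 0 ≤ c)
    (h : ∀ x y : Fin n → ℝ, x ⬝ᵥ x = 1 → y ⬝ᵥ y = 1 → x ⬝ᵥ M *ᵥ y ≤ c) : specNorm M ≤ c := by
  refine ContinuousLinearMap.opNorm_le_of_re_inner_le hc fun x y hx hy => ?_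
  have e : ∀ z : EuclideanSpace ℝ (Fin n), ‖z‖ = 1 → z.ofLp ⬝ᵥ z.ofLp = 1 := by
    intro z hz
    have := EuclideanSpace.real_norm_sq_eq z
    rw [hz] at this
    simp only [dotProduct, ← sq]
    linarith
  have := h y x (e y hy) (e x hx)
  rw [real_inner_comm, inner_toEuclideanCLM]
  simpa using this

/-! ### Graph approximation, Loewner bounds and correlation. -/

section graph

variable {n : ℕ} {a b : Fin n → ℝ} (ha : ∀ i, 0 ≤ a i) (hb : ∀ i, 0 ≤ b i) (ha0 : a ≠ 0)
  (hab : l1Norm a = l1Norm b)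

/-- `C` has the degrees of the product graph. -/
def IsCoupling {n : ℕ} (a b : Fin n → ℝ) (C : Matrix (Fin n) (Fin n) ℝ) : Prop :=
  outDeg C = b ∧ inDeg C = a

/-- The upper half of the equation concerns the row sums of C, the lower half its column sums. -/
theorem bipLap_mulVec_one {C : Matrix (Fin n) (Fin n) ℝ} :
    bipLap a b C *ᵥ (fun _ => 1) = 0 ↔ IsCoupling a b C := by
  have e : (fun _ => 1 : Fin n ⊕ Fin n → ℝ) = Sum.elim (fun _ => 1) (fun _ => 1) := by
    funext i; cases i <;> rfl
  rw [e, bipLap, fromBlocks_mulVec]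
  simp only [Sum.elim_comp_inl, Sum.elim_comp_inr, funext_iff, Sum.forall, Sum.elim_inl,
    Sum.elim_inr, IsCoupling]
  simp only [Pi.add_apply, mul_one, neg_mulVec, Pi.neg_apply, Pi.zero_apply,
    mulVec, dotProduct, transpose_apply, outDeg, inDeg, diagonal_apply, Finset.sum_ite_eq,
    Finset.mem_univ, if_true]
  refine and_congr (forall_congr' fun i => ?_) (forall_congr' fun i => ?_)
  · constructor <;> intro h <;> linarith
  · constructor <;> intro h <;> linarith

include ha hb ha0 hab

theorem IsCoupling.sub_mulVec_one {C : Matrix (Fin n) (Fin n) ℝ} (hC : IsCoupling a b C) :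
    (C - prodAdj a b) *ᵥ (fun _ => 1) = 0 ∧ (C - prodAdj a b)ᵀ *ᵥ (fun _ => 1) = 0 := by
  have h1 := outDeg_prodAdj (b := b) ha ha0
  have h2 := inDeg_prodAdj hb ha0 hab
  constructor
  · funext i
    have e1 := congr_fun hC.1 i
    have e2 := congr_fun h1 i
    simp only [outDeg] at e1 e2
    simp [mulVec, dotProduct, e1, e2]
  · funext i
    have e1 := congr_fun hC.2 i
    have e2 := congr_fun h2 i
    simp only [inDeg] at e1 e2
    simp [mulVec, dotProduct, e1, e2]

theorem bipProdLap_sub_form (C : Matrix (Fin n) (Fin n) ℝ) (x y : Fin n → ℝ) (c : ℝ) :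
    Sum.elim x y ⬝ᵥ (bipProdLap a b - c • bipLap a b C) *ᵥ Sum.elim x y =
      (1 - c) * (varForm b x + varForm a y + (b ⬝ᵥ x - a ⬝ᵥ y) ^ 2 / l1Norm a) +
        2 * c * (x ⬝ᵥ (C - prodAdj a b) *ᵥ y) := by
  rw [sub_mulVec, dotProduct_sub, smul_mulVec, dotProduct_smul, smul_eq_mul,
    ← bipProdLap_form ha hb ha0 hab, bipProdLap, bipLap_form, bipLap_form, sub_mulVec,
    dotProduct_sub]
  ring

/-- Loewner bounds give a bound for the difference of the adjacency matrices. -/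
theorem abs_form_le_of_loewner {C : Matrix (Fin n) (Fin n) ℝ} {δ : ℝ} (hδ0 : 0 ≤ δ)
    (hδ : δ ≤ 1 / 2) (hC : IsCoupling a b C)
    (h1 : (bipProdLap a b - (1 - δ) • bipLap a b C).PosSemidef)
    (h2 : ((1 + δ) • bipLap a b C - bipProdLap a b).PosSemidef) (x y : Fin n → ℝ) :
    |x ⬝ᵥ (C - prodAdj a b) *ᵥ y| ≤ δ * (varForm b x + varForm a y) := by
  obtain ⟨e1, e2⟩ := hC.sub_mulVec_one ha hb ha0 hab
  refine abs_form_le_varForm ha hb ha0 hab e1 e2 (fun x y => ?_) x y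
  rw [form_eq_bipProdLap ha hb ha0 hab]
  have f1 := h1.dotProduct_mulVec_nonneg (Sum.elim x y)
  have f2 := h2.dotProduct_mulVec_nonneg (Sum.elim x y)
  rw [star_trivial, bipProdLap_sub_form ha hb ha0 hab] at f1
  rw [star_trivial, ← neg_sub, neg_mulVec, dotProduct_neg,
    bipProdLap_sub_form ha hb ha0 hab] at f2
  set Q := varForm b x + varForm a y + (b ⬝ᵥ x - a ⬝ᵥ y) ^ 2 / l1Norm a with hQ
  have hQ0 : 0 ≤ Q := add_nonneg (add_nonneg (varForm_nonneg hb x) (varForm_nonneg ha y))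
    (div_nonneg (sq_nonneg _) (l1Norm_pos ha0).le)
  set B := x ⬝ᵥ (C - prodAdj a b) *ᵥ y
  have := mul_nonneg hδ0 hQ0
  -- The two Loewner bounds read 2(1 - δ)B ≥ -δQ and 2(1 + δ)B ≤ δQ. The first gives B ≥ -δQ because
  -- 2(1 - δ) ≥ 1.
  rw [abs_le]
  constructor
  · by_contra hB
    push Not at hB
    nlinarith
  · by_contra hB
    push Not at hB
    nlinarith

/-- The degrees and the Loewner bounds give a graph approximation. -/
theorem isGraphApprox_of_loewner {C : Matrix (Fin n) (Fin n) ℝ} {δ ε : ℝ} (hδ0 : 0 ≤ δ)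
    (hδ : δ ≤ 1 / 2) (hε : 4 * δ ≤ ε) (hC : IsCoupling a b C)
    (h1 : (bipProdLap a b - (1 - δ) • bipLap a b C).PosSemidef)
    (h2 : ((1 + δ) • bipLap a b C - bipProdLap a b).PosSemidef) :
    IsGraphApprox ε C (prodAdj a b) := by
  have hB := abs_form_le_of_loewner ha hb ha0 hab hδ0 hδ hC h1 h2
  have hU := dirLap_undirectify_form ha hb ha0 hab
  set U := dirLap (undirectify (prodAdj a b)) with hUdef
  have hd := l1Norm_pos ha0
  -- Twice the form of U is the sum of both variances and a square, so it bounds each variance.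
  have hvb : ∀ x, varForm b x ≤ 2 * (x ⬝ᵥ U *ᵥ x) := by
    intro x
    have := div_nonneg (sq_nonneg (b ⬝ᵥ x - a ⬝ᵥ x)) hd.le
    have := varForm_nonneg ha x
    rw [hU]; linarith
  have hva : ∀ x, varForm a x ≤ 2 * (x ⬝ᵥ U *ᵥ x) := by
    intro x
    have := div_nonneg (sq_nonneg (b ⬝ᵥ x - a ⬝ᵥ x)) hd.le
    have := varForm_nonneg hb x
    rw [hU]; linarith
  have hpsd : U.PosSemidef := by
    refine PosSemidef.of_dotProduct_mulVec_nonneg ?_ fun x => ?_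
    · rw [IsHermitian, conjTranspose_eq_transpose_of_trivial, hUdef, dirLap, transpose_sub,
        diagonal_transpose, undirectify]
      simp [add_comm]
    · rw [star_trivial]
      have := varForm_nonneg hb x
      have := hvb x
      linarith
  have hD : dirLap C - dirLap (prodAdj a b) = -(C - prodAdj a b)ᵀ := by
    rw [dirLap, dirLap, hC.1, outDeg_prodAdj ha ha0, transpose_sub]
    abel
  have hvan : ∀ x, U *ᵥ x = 0 → varForm b x = 0 ∧ varForm a x = 0 := by
    intro x hx
    have h3 := hvb x
    have h4 := hva x
    rw [hx, dotProduct_zero, mul_zero] at h3 h4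
    exact ⟨le_antisymm h3 (varForm_nonneg hb x), le_antisymm h4 (varForm_nonneg ha x)⟩
  -- A linear term that stays below a quadratic one for all t > 0 vanishes. For x in the kernel of U
  -- the variances of x are zero; testing the bound for B against t times the image of x makes the
  -- left side linear and the right side quadratic in t, so the image is zero.
  have hzero : ∀ A c : ℝ, 0 ≤ A → (∀ t : ℝ, 0 < t → t * A ≤ t ^ 2 * c) → A = 0 := by
    intro A c hA h
    by_contra hne
    have hA' : 0 < A := lt_of_le_of_ne hA (Ne.symm hne)
    have hc : 0 < c := by have := h 1 one_pos; linarith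
    have := h (A / (2 * c)) (by positivity)
    field_simp at this
    nlinarith
  have hscale : ∀ w x : Fin n → ℝ, ∀ t : ℝ, varForm w (t • x) = t ^ 2 * varForm w x := by
    intro w x t
    simp only [varForm, Pi.smul_apply, smul_eq_mul, dotProduct_smul, mul_pow, mul_sub,
      Finset.mul_sum]
    congr 1
    · exact Finset.sum_congr rfl fun i _ => by ring
    · ring
  refine ⟨hpsd, fun x hx => ?_, ?_⟩
  · obtain ⟨hx1, hx2⟩ := hvan x hx
    rw [hD]
    simp only [neg_mulVec, transpose_neg, transpose_transpose, neg_eq_zero]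
    constructor
    · set y := (C - prodAdj a b)ᵀ *ᵥ x with hy
      have : y ⬝ᵥ y = 0 := by
        refine hzero _ (δ * varForm a y) (Finset.sum_nonneg fun i _ => mul_self_nonneg (y i)) fun t ht => ?_
        have := hB x (t • y)
        rw [hx1, zero_add, hscale, mulVec_smul, dotProduct_smul, dotProduct_mulVec,
          ← mulVec_transpose, ← hy, smul_eq_mul] at this
        have := (le_abs_self _).trans this
        linarith
      exact dotProduct_self_eq_zero.1 this
    · set y := (C - prodAdj a b) *ᵥ x with hy
      have : y ⬝ᵥ y = 0 := by
        refine hzero _ (δ * varForm b y) (Finset.sum_nonneg fun i _ => mul_self_nonneg (y i)) fun t ht => ?_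
        have := hB (t • y) x
        rw [hx2, add_zero, hscale, smul_dotProduct, ← hy, smul_eq_mul] at this
        have := (le_abs_self _).trans this
        linarith
      exact dotProduct_self_eq_zero.1 this
  · refine specNorm_le (by linarith) fun x y hx hy => ?_
    have h3 := pinvSqrt_mul_mul_le hpsd x
    have h4 := pinvSqrt_mul_mul_le hpsd y
    have hsymm := (pinvSqrt_isHermitian (M := U)).eq
    rw [conjTranspose_eq_transpose_of_trivial] at hsymm
    have e : x ⬝ᵥ (pinvSqrt U * (dirLap C - dirLap (prodAdj a b)) * pinvSqrt U) *ᵥ y =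
        -((pinvSqrt U *ᵥ y) ⬝ᵥ (C - prodAdj a b) *ᵥ (pinvSqrt U *ᵥ x)) := by
      rw [hD, ← mulVec_mulVec, ← mulVec_mulVec, dotProduct_mulVec x, ← mulVec_transpose, hsymm,
        neg_mulVec, dotProduct_neg, mulVec_transpose, dotProduct_comm, ← dotProduct_mulVec]
    rw [e]
    -- For unit vectors each of the two variances is at most 2, so the bound is 4δ ≤ ε.
    have h5 := (neg_le_abs _).trans (hB (pinvSqrt U *ᵥ y) (pinvSqrt U *ᵥ x))
    have h6 := hvb (pinvSqrt U *ᵥ y)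
    have h7 := hva (pinvSqrt U *ᵥ x)
    nlinarith

/-- A coupling of small correlation satisfies the Loewner bounds. -/
theorem loewner_of_correlation {C : Matrix (Fin n) (Fin n) ℝ} {δ : ℝ} (hδ0 : 0 ≤ δ) (hδ : δ ≤ 1)
    (hC : IsCoupling a b C)
    (h : ∀ x y, |x ⬝ᵥ (C - prodAdj a b) *ᵥ y| ≤
      δ / 4 * (∑ i, b i * x i ^ 2 + ∑ i, a i * y i ^ 2)) :
    (bipProdLap a b - (1 - δ) • bipLap a b C).PosSemidef ∧
      ((1 + δ) • bipLap a b C - bipProdLap a b).PosSemidef := by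
  obtain ⟨e1, e2⟩ := hC.sub_mulVec_one ha hb ha0 hab
  have hda : 0 < ∑ i, a i := by rw [← l1Norm_eq_sum ha]; exact l1Norm_pos ha0
  have hdb : 0 < ∑ i, b i := by rw [← l1Norm_eq_sum hb, ← hab]; exact l1Norm_pos ha0
  have hB : ∀ x y, |x ⬝ᵥ (C - prodAdj a b) *ᵥ y| ≤
      δ / 4 * (varForm b x + varForm a y + (b ⬝ᵥ x - a ⬝ᵥ y) ^ 2 / l1Norm a) := by
    intro x y
    -- Centring again turns the sums of squares into variances; the non-negative square then
    -- completes them to the form Q of the product graph.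
    have f1 : (fun i => x i - (b ⬝ᵥ x) / ∑ i, b i) = x - ((b ⬝ᵥ x) / ∑ i, b i) • fun _ => 1 := by
      funext i; simp
    have f2 : (fun i => y i - (a ⬝ᵥ y) / ∑ i, a i) = y - ((a ⬝ᵥ y) / ∑ i, a i) • fun _ => 1 := by
      funext i; simp
    have := h (fun i => x i - (b ⬝ᵥ x) / ∑ i, b i) (fun i => y i - (a ⬝ᵥ y) / ∑ i, a i)
    rw [sum_mul_sub_mean_sq hda, sum_mul_sub_mean_sq hdb, f2, mulVec_sub, mulVec_smul, e1,
      smul_zero, sub_zero, f1, sub_dotProduct, smul_dotProduct,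
      dotProduct_mulVec (fun _ => 1), ← mulVec_transpose, e2, zero_dotProduct, smul_zero,
      sub_zero] at this
    refine this.trans (mul_le_mul_of_nonneg_left ?_ (by linarith))
    have := div_nonneg (sq_nonneg (b ⬝ᵥ x - a ⬝ᵥ y)) (l1Norm_pos ha0).le
    linarith
  have hQ0 : ∀ x y, 0 ≤ varForm b x + varForm a y + (b ⬝ᵥ x - a ⬝ᵥ y) ^ 2 / l1Norm a :=
    fun x y => add_nonneg (add_nonneg (varForm_nonneg hb x) (varForm_nonneg ha y))
      (div_nonneg (sq_nonneg _) (l1Norm_pos ha0).le)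
  have hherm : ∀ C : Matrix (Fin n) (Fin n) ℝ, (bipLap a b C).IsHermitian := by
    intro C
    rw [IsHermitian, conjTranspose_eq_transpose_of_trivial, bipLap, fromBlocks_transpose]
    simp
  have hsm : ∀ c : ℝ, (c • bipLap a b C).IsHermitian := fun c => by
    rw [IsHermitian, conjTranspose_smul, (hherm C).eq, star_trivial]
  have hz : ∀ z : Fin n ⊕ Fin n → ℝ, ∃ x y, z = Sum.elim x y :=
    fun z => ⟨z ∘ Sum.inl, z ∘ Sum.inr, (Sum.elim_comp_inl_inr z).symm⟩
  -- The two forms are δQ + 2(1 - δ)B and δQ - 2(1 + δ)B with |B| ≤ δQ/4. Both are non-negative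
  -- because 2(1 + δ)/4 ≤ 1.
  constructor
  · refine PosSemidef.of_dotProduct_mulVec_nonneg ((hherm _).sub (hsm _)) fun z => ?_
    obtain ⟨x, y, rfl⟩ := hz z
    rw [star_trivial, bipProdLap_sub_form ha hb ha0 hab]
    have h3 := abs_le.1 (hB x y)
    have h4 := hQ0 x y
    nlinarith [mul_nonneg hδ0 h4]
  · refine PosSemidef.of_dotProduct_mulVec_nonneg ((hsm _).sub (hherm _)) fun z => ?_
    obtain ⟨x, y, rfl⟩ := hz z
    rw [star_trivial, ← neg_sub, neg_mulVec, dotProduct_neg, bipProdLap_sub_form ha hb ha0 hab]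
    have h3 := abs_le.1 (hB x y)
    have h4 := hQ0 x y
    nlinarith [mul_nonneg hδ0 h4]

end graph

/-! ### Counting non-zero entries -/

section count

variable {n : ℕ} {a b : Fin n → ℝ}

theorem blockAdj_bipLap (C : Matrix (Fin n) (Fin n) ℝ) : blockAdj (bipLap a b C) = C := by
  simp [blockAdj, bipLap]

theorem matNnz_le_bipLap (C : Matrix (Fin n) (Fin n) ℝ) : matNnz C ≤ matNnz (bipLap a b C) := by
  refine Nat.card_le_card_of_injective
    (fun p => ⟨(Sum.inl p.1.1, Sum.inr p.1.2), by simpa [bipLap] using p.2⟩) ?_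
  rintro ⟨⟨i, j⟩, h⟩ ⟨⟨i', j'⟩, h'⟩ e
  simpa using e

/-- A diagonal entry of the directed Laplacian is charged to the diagonal entry b i of the bipartite
one: if b i = 0, the row i of the non-negative matrix C vanishes and so does the entry. Off-diagonal
entries are charged to the block -Cᵀ. -/
theorem matNnz_dirLap_le_bipLap {C : Matrix (Fin n) (Fin n) ℝ} (hC0 : ∀ i j, 0 ≤ C i j)
    (hC : outDeg C = b) : matNnz (dirLap C) ≤ matNnz (bipLap a b C) := by
  classical
  have hd : ∀ i, dirLap C i i ≠ 0 → b i ≠ 0 := by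
    intro i hi hb
    apply hi
    have h0 : outDeg C i = 0 := by rw [hC, hb]
    have : C i i = 0 :=
      (Finset.sum_eq_zero_iff_of_nonneg fun j _ => hC0 i j).1 h0 i (Finset.mem_univ i)
    simp [dirLap, h0, this]
  refine Nat.card_le_card_of_injective
    (fun p => ⟨if p.1.1 = p.1.2 then (Sum.inl p.1.1, Sum.inl p.1.1)
      else (Sum.inr p.1.1, Sum.inl p.1.2), ?_⟩) ?_
  · obtain ⟨⟨i, j⟩, h⟩ := p
    dsimp only at h ⊢
    split_ifs with hij
    · subst hij
      simpa [bipLap] using hd i h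
    · simpa [dirLap, bipLap, hij] using h
  · rintro ⟨⟨i, j⟩, h⟩ ⟨⟨i', j'⟩, h'⟩ e
    simp only [Subtype.mk.injEq] at e
    by_cases h1 : i = j <;> by_cases h2 : i' = j' <;> simp_all

theorem matNnz_bipLap_le (C : Matrix (Fin n) (Fin n) ℝ) :
    matNnz (bipLap a b C) ≤ nnz a + nnz b + 2 * matNnz C := by
  classical
  let T := ({i // a i ≠ 0} ⊕ {i // b i ≠ 0}) ⊕
    ({p : Fin n × Fin n // C p.1 p.2 ≠ 0} ⊕ {p : Fin n × Fin n // C p.1 p.2 ≠ 0})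
  have hT : Nat.card T = nnz a + nnz b + 2 * matNnz C := by
    simp only [T, Nat.card_sum, nnz, matNnz]
    ring
  rw [← hT]
  let f : T → (Fin n ⊕ Fin n) × (Fin n ⊕ Fin n) := fun t => match t with
    | .inl (.inl i) => (.inr i, .inr i)
    | .inl (.inr i) => (.inl i, .inl i)
    | .inr (.inl p) => (.inl p.1.1, .inr p.1.2)
    | .inr (.inr p) => (.inr p.1.2, .inl p.1.1)
  have hf : ∀ p : {p : (Fin n ⊕ Fin n) × (Fin n ⊕ Fin n) // bipLap a b C p.1 p.2 ≠ 0},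
      ∃ t, f t = p.1 := by
    rintro ⟨⟨i | i, j | j⟩, h⟩
    · by_cases hij : i = j
      · subst hij
        exact ⟨.inl (.inr ⟨i, by simpa [bipLap] using h⟩), rfl⟩
      · simp [bipLap, hij] at h
    · exact ⟨.inr (.inl ⟨(i, j), by simpa [bipLap] using h⟩), rfl⟩
    · exact ⟨.inr (.inr ⟨(j, i), by simpa [bipLap] using h⟩), rfl⟩
    · by_cases hij : i = j
      · subst hij
        exact ⟨.inl (.inl ⟨i, by simpa [bipLap] using h⟩), rfl⟩
      · simp [bipLap, hij] at h
  choose g hg using hf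
  refine Nat.card_le_card_of_injective g fun p p' e => ?_
  apply Subtype.ext
  rw [← hg p, ← hg p', e]

end count

/-- Every sparsifier gives a graph approximation. -/
theorem IsBipartiteSparsifier.graphApprox {n : ℕ} {a b : Fin n → ℝ} {ε K : ℝ}
    {L : Matrix (Fin n ⊕ Fin n) (Fin n ⊕ Fin n) ℝ} (ha : ∀ i, 0 ≤ a i) (hb : ∀ i, 0 ≤ b i)
    (ha0 : a ≠ 0) (hab : l1Norm a = l1Norm b) (hε0 : 0 < ε) (hε : ε ≤ 1 / 2)
    (h : IsBipartiteSparsifier K (ε / 128) a b L) :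
    (∀ i j, 0 ≤ blockAdj L i j) ∧ IsGraphApprox ε (blockAdj L) (prodAdj a b) ∧
      (∀ i, outDeg (blockAdj L) i = outDeg (prodAdj a b) i) ∧
      (∀ i, inDeg (blockAdj L) i = inDeg (prodAdj a b) i) ∧
      (matNnz (blockAdj L) : ℝ) ≤ 128 ^ 4 * K * ((nnz a : ℝ) + (nnz b : ℝ)) / ε ^ 4 ∧
      (matNnz (dirLap (blockAdj L)) : ℝ) ≤
        128 ^ 4 * K * ((nnz a : ℝ) + (nnz b : ℝ)) / ε ^ 4 := by
  obtain ⟨⟨C, hC0, rfl⟩, h1, h2, h3, h4⟩ := h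
  have hC := bipLap_mulVec_one.1 h1
  rw [blockAdj_bipLap]
  have h5 : (matNnz (bipLap a b C) : ℝ) ≤
      128 ^ 4 * K * ((nnz a : ℝ) + (nnz b : ℝ)) / ε ^ 4 := by
    refine h4.trans (le_of_eq ?_)
    field_simp
  refine ⟨hC0, isGraphApprox_of_loewner ha hb ha0 hab (by positivity) (by linarith) (by linarith)
    hC h2 h3, ?_, ?_, le_trans ?_ h5, le_trans ?_ h5⟩
  · rw [hC.1, outDeg_prodAdj ha ha0]; exact fun _ => rfl
  · rw [hC.2, inDeg_prodAdj hb ha0 hab]; exact fun _ => rfl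
  · exact_mod_cast matNnz_le_bipLap C
  · exact_mod_cast matNnz_dirLap_le_bipLap hC0 hC.1

/-! ### Couplings from expanders -/

section cells

variable {n M L : ℕ}

/-- A partition of the weights `a` into `M` cells of weight `w`, each with at most three pieces:
the piece `c` of the cell `u` has the weight `W u c` and belongs to `I u c`. -/
structure IsCells (a : Fin n → ℝ) (w : ℝ) (I : Fin M → Fin 3 → Fin n) (W : Fin M → Fin 3 → ℝ) :
    Prop where
  nonneg : ∀ u c, 0 ≤ W u c
  sum_eq : ∀ u, ∑ c, W u c = w
  total : ∀ f : Fin n → ℝ, ∑ u, ∑ c, W u c * f (I u c) = ∑ i, a i * f i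

/-- The coupling that joins the cells along the edges of an expander. -/
noncomputable def cellAdj (g : Fin L → Fin M → Fin M) (w : ℝ) (I I' : Fin M → Fin 3 → Fin n)
    (W W' : Fin M → Fin 3 → ℝ) : Matrix (Fin n) (Fin n) ℝ := fun i j =>
  ∑ u, ∑ l, ∑ c, ∑ c', if I u c = i ∧ I' (g l u) c' = j then W u c * W' (g l u) c' / (w * L) else 0

variable {g : Fin L → Fin M → Fin M} {w : ℝ} {I I' : Fin M → Fin 3 → Fin n}
  {W W' : Fin M → Fin 3 → ℝ} {a b : Fin n → ℝ}

/-- The coupling acts as the walk of the expander between the cell sums of x and those of y. Degrees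
and correlation follow from this formula. -/
theorem cellAdj_form (hL : 0 < L) (x y : Fin n → ℝ) :
    x ⬝ᵥ cellAdj g w I I' W W' *ᵥ y = w⁻¹ * ∑ u, (∑ c, W u c * x (I u c)) *
      walk g (fun v => ∑ c, W' v c * y (I' v c)) u := by
  have hL' : (L : ℝ) ≠ 0 := by positivity
  have h1 : ∀ i j, x i * (cellAdj g w I I' W W' i j * y j) =
      ∑ u, ∑ l, ∑ c, ∑ c', if I u c = i then (if I' (g l u) c' = j then
        x i * (W u c * W' (g l u) c' / (w * L)) * y j else 0) else 0 := by
    intro i j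
    simp only [cellAdj, Finset.sum_mul, Finset.mul_sum]
    refine Finset.sum_congr rfl fun u _ => Finset.sum_congr rfl fun l _ =>
      Finset.sum_congr rfl fun c _ => Finset.sum_congr rfl fun c' _ => ?_
    by_cases h1 : I u c = i <;> by_cases h2 : I' (g l u) c' = j <;> simp [h1, h2, mul_assoc]
  have h2 : x ⬝ᵥ cellAdj g w I I' W W' *ᵥ y =
      ∑ i, ∑ j, x i * (cellAdj g w I I' W W' i j * y j) := by
    simp only [dotProduct, mulVec, Finset.mul_sum]
  -- The sums over i and j are moved inside, where the two indicators select one term.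
  have hsw : ∀ F : Fin n → Fin n → Fin M → Fin L → Fin 3 → Fin 3 → ℝ,
      ∑ i, ∑ j, ∑ u, ∑ l, ∑ c, ∑ c', F i j u l c c' =
        ∑ u, ∑ l, ∑ c, ∑ c', ∑ i, ∑ j, F i j u l c c' := by
    intro F
    have e1 : ∀ {α : Type} [Fintype α] (F : Fin n → Fin n → α → ℝ),
        ∑ i, ∑ j, ∑ u, F i j u = ∑ u, ∑ i, ∑ j, F i j u := by
      intro α _ F
      rw [Finset.sum_comm]
      simp only [Finset.sum_comm (s := (Finset.univ : Finset α))]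
      rw [Finset.sum_comm]
    rw [e1]
    refine Finset.sum_congr rfl fun u _ => ?_
    rw [e1]
    refine Finset.sum_congr rfl fun l _ => ?_
    rw [e1]
    refine Finset.sum_congr rfl fun c _ => ?_
    rw [e1]
  rw [h2]
  simp only [h1]
  rw [hsw, Finset.mul_sum]
  refine Finset.sum_congr rfl fun u _ => ?_
  rw [walk, mean, Fintype.card_fin, Finset.sum_div, Finset.mul_sum, Finset.mul_sum]
  refine Finset.sum_congr rfl fun l _ => ?_
  rw [Finset.sum_mul, Finset.mul_sum]
  refine Finset.sum_congr rfl fun c _ => ?_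
  rw [Finset.sum_div, Finset.mul_sum, Finset.mul_sum]
  refine Finset.sum_congr rfl fun c' _ => ?_
  simp only [Finset.sum_ite_irrel, Finset.sum_const_zero, Finset.sum_ite_eq, Finset.mem_univ, if_true]
  field_simp

theorem cellAdj_nonneg (hI : IsCells b w I W) (hI' : IsCells a w I' W') (hw : 0 ≤ w)
    (i j : Fin n) : 0 ≤ cellAdj g w I I' W W' i j := by
  refine Finset.sum_nonneg fun u _ => Finset.sum_nonneg fun l _ => Finset.sum_nonneg fun c _ =>
    Finset.sum_nonneg fun c' _ => ?_
  split_ifs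
  · exact div_nonneg (mul_nonneg (hI.nonneg _ _) (hI'.nonneg _ _))
      (mul_nonneg hw (Nat.cast_nonneg _))
  · exact le_rfl

/-- Cauchy-Schwarz inside each cell, whose total weight is `w`. -/
theorem IsCells.sum_sq_le (hI : IsCells a w I W) (x : Fin n → ℝ) :
    ∑ u, (∑ c, W u c * x (I u c)) ^ 2 ≤ w * ∑ i, a i * x i ^ 2 := by
  rw [← hI.total fun i => x i ^ 2, Finset.mul_sum]
  refine Finset.sum_le_sum fun u _ => ?_
  rw [← hI.sum_eq u]
  refine Finset.sum_sq_le_sum_mul_sum_of_sq_le_mul _ (fun c _ => hI.nonneg u c)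
      (fun c _ => mul_nonneg (hI.nonneg u c) (sq_nonneg _)) fun c _ => le_of_eq ?_
  ring

theorem IsCells.mul_card (hI : IsCells a w I W) : w * M = ∑ i, a i := by
  have := hI.total fun _ => 1
  simp only [mul_one, hI.sum_eq] at this
  rw [← this]
  simp [mul_comm]

/-- Out-degrees come from y = 1, whose cell sums are constant and fixed by the walk. In-degrees come
from x = 1 and the fact that permutations preserve the mean. -/
theorem isCoupling_cellAdj [NeZero M] {lam : ℝ} (hL : 0 < L) (hg : IsExp g lam) (hw : 0 < w)
    (hI : IsCells b w I W) (hI' : IsCells a w I' W') :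
    IsCoupling a b (cellAdj g w I I' W W') := by
  have : Nonempty (Fin L) := ⟨⟨0, hL⟩⟩
  have hM : (M : ℝ) ≠ 0 := by exact_mod_cast NeZero.ne M
  constructor
  · funext i
    have := cellAdj_form (g := g) (w := w) (I := I) (I' := I') (W := W) (W' := W') hL
      (Pi.single i 1) (fun _ => 1)
    rw [single_one_dotProduct] at this
    simp only [mul_one, hI'.sum_eq, walk, mean_const, ← Finset.sum_mul, hI.total] at this
    simp only [Pi.single_apply, mul_ite, mul_one, mul_zero, Finset.sum_ite_eq', Finset.mem_univ,
      if_true, mulVec, dotProduct] at this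
    rw [outDeg, this]
    field_simp
  · funext i
    have := cellAdj_form (g := g) (w := w) (I := I) (I' := I') (W := W) (W' := W') hL
      (fun _ => 1) (Pi.single i 1)
    have h1 := mean_walk hg.bij (fun v => ∑ c, W' v c * (Pi.single i 1 : Fin n → ℝ) (I' v c))
    rw [mean, mean, div_left_inj' (by simpa using hM), hI'.total] at h1
    simp only [mul_one, hI.sum_eq, ← Finset.mul_sum, h1] at this
    simp only [Pi.single_apply, mul_ite, mul_one, mul_zero, Finset.sum_ite_eq', Finset.mem_univ,
      if_true, mulVec, dotProduct, one_mul] at this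
    rw [inDeg, this]
    field_simp

/-- Because w * M is the total weight, the product graph corresponds to replacing the walk by the
mean. The difference is controlled by Cauchy-Schwarz and the spectral gap, and the product of norms
by the arithmetic-geometric mean inequality. -/
theorem cellAdj_correlation [NeZero M] {lam : ℝ} (hL : 0 < L) (hg : IsExp g lam) (hw : 0 < w)
    (hlam : 0 ≤ lam) (ha : ∀ i, 0 ≤ a i) (hI : IsCells b w I W) (hI' : IsCells a w I' W')
    (x y : Fin n → ℝ) :
    |x ⬝ᵥ (cellAdj g w I I' W W' - prodAdj a b) *ᵥ y| ≤
      lam / 2 * (∑ i, b i * x i ^ 2 + ∑ i, a i * y i ^ 2) := by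
  have hM : (0 : ℝ) < M := by exact_mod_cast Nat.pos_of_ne_zero (NeZero.ne M)
  set X : Fin M → ℝ := fun u => ∑ c, W u c * x (I u c) with hX
  set Y : Fin M → ℝ := fun u => ∑ c, W' u c * y (I' u c) with hY
  have e : x ⬝ᵥ (cellAdj g w I I' W W' - prodAdj a b) *ᵥ y =
      w⁻¹ * ∑ u, X u * (walk g Y u - mean Y) := by
    have h1 : b ⬝ᵥ x = ∑ u, X u := (hI.total x).symm
    have h2 : a ⬝ᵥ y = ∑ u, Y u := (hI'.total y).symm
    rw [sub_mulVec, dotProduct_sub, cellAdj_form hL, dotProduct_prodAdj_mulVec, l1Norm_eq_sum ha,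
      ← hI'.mul_card, h1, h2]
    simp only [mul_sub, Finset.sum_sub_distrib, ← Finset.sum_mul, mean, Fintype.card_fin]
    field_simp
    rw [mul_comm]
  have hcs : |∑ u, X u * (walk g Y u - mean Y)| ≤ nrm X * nrm (fun u => walk g Y u - mean Y) := by
    refine abs_le_of_sq_le_sq ?_ (mul_nonneg (nrm_nonneg _) (nrm_nonneg _))
    rw [mul_pow, nrm_sq, nrm_sq]
    exact Finset.sum_mul_sq_le_sq_mul_sq _ _ _
  have h1 := hI.sum_sq_le x
  have h2 := hI'.sum_sq_le y
  have h3 := hg.bound Y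
  have h4 := nrm_sq X
  have h5 := nrm_sq Y
  rw [e, abs_mul, abs_of_pos (inv_pos.2 hw), inv_mul_le_iff₀ hw]
  have h6 : nrm X * nrm (fun u => walk g Y u - mean Y) ≤ nrm X * (lam * nrm Y) :=
    mul_le_mul_of_nonneg_left h3 (nrm_nonneg _)
  have h7 : nrm X * nrm Y ≤ (nrm X ^ 2 + nrm Y ^ 2) / 2 := by nlinarith [sq_nonneg (nrm X - nrm Y)]
  have h8 := mul_le_mul_of_nonneg_left h7 hlam
  have h9 : nrm X ^ 2 + nrm Y ^ 2 ≤ w * (∑ i, b i * x i ^ 2 + ∑ i, a i * y i ^ 2) := by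
    rw [h4, h5, mul_add]; exact add_le_add h1 h2
  have h10 := mul_le_mul_of_nonneg_left h9 hlam
  calc _ ≤ lam * (nrm X * nrm Y) := by linarith
    _ ≤ _ := by linarith

end cells

/-- A sparse coupling of small correlation is a sparsifier. -/
theorem isBipartiteSparsifier_of_correlation {n : ℕ} {a b : Fin n → ℝ} {δ K : ℝ}
    {C : Matrix (Fin n) (Fin n) ℝ} (ha : ∀ i, 0 ≤ a i) (hb : ∀ i, 0 ≤ b i) (ha0 : a ≠ 0)
    (hab : l1Norm a = l1Norm b) (hδ0 : 0 < δ) (hδ : δ ≤ 1) (hC0 : ∀ i j, 0 ≤ C i j)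
    (hC : IsCoupling a b C)
    (h : ∀ x y, |x ⬝ᵥ (C - prodAdj a b) *ᵥ y| ≤
      δ / 4 * (∑ i, b i * x i ^ 2 + ∑ i, a i * y i ^ 2))
    (hK : (nnz a : ℝ) + nnz b + 2 * matNnz C ≤ K * ((nnz a : ℝ) + nnz b) / δ ^ 4) :
    IsBipartiteSparsifier K δ a b (bipLap a b C) := by
  obtain ⟨h1, h2⟩ := loewner_of_correlation ha hb ha0 hab hδ0.le hδ hC h
  refine ⟨⟨C, hC0, rfl⟩, bipLap_mulVec_one.2 hC, h1, h2, le_trans ?_ hK⟩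
  exact_mod_cast matNnz_bipLap_le C

/-! ### The output table -/

theorem mul_add_lt_mul {i j p q : ℕ} (hi : i < q) (hj : j < p) : i * p + j < q * p := by
  have : (i + 1) * p ≤ q * p := Nat.mul_le_mul_right p hi
  rw [add_mul] at this
  omega

theorem mul_add_inj {i j i' j' p : ℕ} (hj : j < p) (hj' : j' < p) (h : i * p + j = i' * p + j') :
    i = i' ∧ j = j' := by
  have h1 : (i * p + j) / p = i := by
    rw [mul_comm, Nat.mul_add_div (by omega), Nat.div_eq_of_lt hj, add_zero]
  have h2 : (i' * p + j') / p = i' := by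
    rw [mul_comm, Nat.mul_add_div (by omega), Nat.div_eq_of_lt hj', add_zero]
  have : i = i' := by rw [← h1, ← h2, h]
  subst this
  exact ⟨rfl, by omega⟩

/-- The output arrays hold the matrix `X`, indexed by positions in the input lists: register `4`
holds the number `cnt` of non-zero entries, the entry number `k` is at the position `key k`, and
array `7` is the inverse of `key`, shifted by `1`. -/
structure Table (pa pb : ℕ) (X : ℕ → ℕ → ℝ) (cnt : ℕ) (key : ℕ → ℕ × ℕ) (s : RAMState) :
    Prop where
  count : s.reg 4 = (cnt : ℝ)
  fst_lt : ∀ k < cnt, (key k).1 < pb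
  snd_lt : ∀ k < cnt, (key k).2 < pa
  row : ∀ k < cnt, s.arr 4 k = s.arr 2 (key k).1
  col : ∀ k < cnt, s.arr 5 k = s.arr 0 (key k).2
  val : ∀ k < cnt, s.arr 6 k = X (key k).1 (key k).2
  pos : ∀ k < cnt, 0 < X (key k).1 (key k).2
  index : ∀ k < cnt, s.arr 7 ((key k).1 * pa + (key k).2) = ((k + 1 : ℕ) : ℝ)
  surj : ∀ i < pb, ∀ j < pa, X i j ≠ 0 → ∃ k < cnt, key k = (i, j)
  unseen : ∀ i < pb, ∀ j < pa, X i j = 0 → s.arr 7 (i * pa + j) = 0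

/-- The output arrays hold the matrix `X`, with at most `N` entries. -/
def Output (pa pb N : ℕ) (X : ℕ → ℕ → ℝ) (s : RAMState) : Prop :=
  ∃ cnt key, Table pa pb X cnt key s ∧ cnt ≤ N

theorem Output.congr {pa pb N : ℕ} {X : ℕ → ℕ → ℝ} {s s' : RAMState} (h : Output pa pb N X s)
    (h4 : s'.reg 4 = s.reg 4) (ha : ∀ k ∈ [0, 2, 4, 5, 6, 7], s'.arr k = s.arr k) :
    Output pa pb N X s' := by
  obtain ⟨cnt, key, h, hN⟩ := h
  simp only [List.mem_cons, List.not_mem_nil, or_false, forall_eq_or_imp, forall_eq] at ha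
  obtain ⟨a0, a2, a4, a5, a6, a7⟩ := ha
  refine ⟨cnt, key, ?_, hN⟩
  constructor
  · rw [h4, h.count]
  · exact h.fst_lt
  · exact h.snd_lt
  · rw [a4, a2]; exact h.row
  · rw [a5, a0]; exact h.col
  · rw [a6]; exact h.val
  · exact h.pos
  · rw [a7]; exact h.index
  · exact h.surj
  · rw [a7]; exact h.unseen

/-- The matrix with the single entry `w` at `(i, j)`. -/
noncomputable def entry (i j : ℕ) (w : ℝ) : ℕ → ℕ → ℝ := fun i' j' => if i = i' ∧ j = j' then w else 0

/-- Add the entry in register `42` at the position in registers `40, 41`. -/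
def emit : Stmt :=
  .ite 0 (.var 42)
    (.set 43 (.var 40 * .var 1 + .var 41) ;;
      .ite (.get 7 (.var 43)) 1
        (.put 4 (.var 4) (.get 2 (.var 40)) ;; .put 5 (.var 4) (.get 0 (.var 41)) ;;
          .put 6 (.var 4) (.var 42) ;; .set 4 (.var 4 + 1) ;; .put 7 (.var 43) (.var 4))
        (.put 6 (.get 7 (.var 43) - 1) (.get 6 (.get 7 (.var 43) - 1) + .var 42)))
    .skip

/-- Weights landing on the same position are added up, so every position is listed once. The value 0
in array `7` means that a position is new. As memory is initially 0, this index of size pa * pb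
never has to be cleared and costs nothing for positions never touched. Zero weights are skipped and
listed values are positive, so no listed entry can become zero by cancellation. -/
theorem emit_runs {pa pb N i j : ℕ} {X : ℕ → ℕ → ℝ} {w : ℝ} {s : RAMState} (h : Output pa pb N X s)
    (h1 : s.reg 1 = (pa : ℝ)) (h40 : s.reg 40 = (i : ℝ)) (h41 : s.reg 41 = (j : ℝ))
    (h42 : s.reg 42 = w) (hi : i < pb) (hj : j < pa) (hw : 0 ≤ w) :
    Runs emit s 60 (Output pa pb (N + 1) (X + entry i j w)) := by
  obtain ⟨cnt, key, h, hN⟩ := h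
  have hXe : ∀ i' j', (X + entry i j w) i' j' = X i' j' + if i = i' ∧ j = j' then w else 0 :=
    fun _ _ => rfl
  refine Runs.of_wp ?_ (Nat.le_of_ble_eq_true rfl)
  have h4 := h.count
  have hidx : (i : ℝ) * pa + j = ((i * pa + j : ℕ) : ℝ) := by push_cast; rfl
  simp only [emit, Stmt.wp, RExpr.ok_zero, RExpr.ok_var, RExpr.eval_zero, RExpr.eval_var, h42,
    true_and, RExpr.ok_add, RExpr.ok_mul, RExpr.eval_add, RExpr.eval_mul, h40, h1, h41,
    RExpr.ok_get, RExpr.eval_get, RExpr.ok_one, RExpr.eval_one, RExpr.ok_sub, RExpr.eval_sub,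
    RAMState.reg_setReg, RAMState.reg_setArr, RAMState.arr_setReg, RAMState.arr_setArr, hidx,
    Nat.floor_natCast, if_true, reduceIte, h4, and_true, reduceCtorEq, Nat.reduceEqDiff, if_false]
  constructor
  · intro hw0
    by_cases hX : X i j = 0
    · rw [h.unseen i hi j hj hX]
      refine ⟨fun _ => ?_, fun hc => absurd one_pos hc⟩
      have hne : ∀ k < cnt, key k ≠ (i, j) := by
        intro k hk he
        have := h.pos k hk
        rw [he] at this
        exact this.ne' hX
      have hne' : ∀ k < cnt, ¬ (i = (key k).1 ∧ j = (key k).2) :=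
        fun k hk e => hne k hk (Prod.ext e.1.symm e.2.symm)
      refine ⟨cnt + 1, Function.update key cnt (i, j), ?_, by omega⟩
      constructor
      · simp
      · intro k hk
        rcases Nat.lt_succ_iff_lt_or_eq.1 hk with hk | rfl
        · rw [Function.update_of_ne hk.ne]; exact h.fst_lt k hk
        · simpa using hi
      · intro k hk
        rcases Nat.lt_succ_iff_lt_or_eq.1 hk with hk | rfl
        · rw [Function.update_of_ne hk.ne]; exact h.snd_lt k hk
        · simpa using hj
      · intro k hk
        rcases Nat.lt_succ_iff_lt_or_eq.1 hk with hk | rfl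
        · simpa [Function.update_of_ne hk.ne] using h.row k hk
        · simp
      · intro k hk
        rcases Nat.lt_succ_iff_lt_or_eq.1 hk with hk | rfl
        · simpa [Function.update_of_ne hk.ne] using h.col k hk
        · simp
      · intro k hk
        rcases Nat.lt_succ_iff_lt_or_eq.1 hk with hk | rfl
        · rw [Function.update_of_ne hk.ne, hXe, if_neg (hne' k hk)]
          simpa [Function.update_of_ne hk.ne] using h.val k hk
        · simp [entry, hX]
      · intro k hk
        rcases Nat.lt_succ_iff_lt_or_eq.1 hk with hk | rfl
        · rw [Function.update_of_ne hk.ne, hXe, if_neg (hne' k hk), add_zero]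
          exact h.pos k hk
        · simpa [entry, hX] using hw0
      · intro k hk
        rcases Nat.lt_succ_iff_lt_or_eq.1 hk with hk | rfl
        · have : (key k).1 * pa + (key k).2 ≠ i * pa + j := fun e =>
            hne' k hk ⟨(mul_add_inj (h.snd_lt k hk) hj e).1.symm,
              (mul_add_inj (h.snd_lt k hk) hj e).2.symm⟩
          rw [Function.update_of_ne hk.ne]
          simpa [Function.update_of_ne this] using h.index k hk
        · simp
      · intro i' hi' j' hj' hne
        by_cases he : i = i' ∧ j = j'
        · exact ⟨cnt, by omega, by simp [he]⟩
        · rw [hXe, if_neg he, add_zero] at hne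
          obtain ⟨k, hk, e⟩ := h.surj i' hi' j' hj' hne
          exact ⟨k, by omega, by rw [Function.update_of_ne hk.ne, e]⟩
      · intro i' hi' j' hj' h0
        by_cases he : i = i' ∧ j = j'
        · rw [hXe, if_pos he, ← he.1, ← he.2, hX, zero_add] at h0
          exact absurd h0 hw0.ne'
        · rw [hXe, if_neg he, add_zero] at h0
          have : i' * pa + j' ≠ i * pa + j := fun e =>
            he ⟨(mul_add_inj hj' hj e).1.symm, (mul_add_inj hj' hj e).2.symm⟩
          simpa [Function.update_of_ne this] using h.unseen i' hi' j' hj' h0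
    · obtain ⟨k0, hk0, he0⟩ := h.surj i hi j hj hX
      have hix := h.index k0 hk0
      rw [he0] at hix
      have hk0' : ((k0 + 1 : ℕ) : ℝ) - 1 = (k0 : ℝ) := by push_cast; ring
      rw [hix, hk0', Nat.floor_natCast]
      refine ⟨fun hc => ?_, fun _ => ⟨rfl, rfl, ?_⟩⟩
      · push_cast at hc
        have : (0 : ℝ) ≤ k0 := Nat.cast_nonneg k0
        linarith
      -- Array `7` recovers the number of an entry from its position, so only the entry `k0`
      -- changes.
      have hinj : ∀ k < cnt, (i = (key k).1 ∧ j = (key k).2) → k = k0 := by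
        intro k hk e
        have := h.index k hk
        rw [← e.1, ← e.2, hix] at this
        have : k0 + 1 = k + 1 := by exact_mod_cast this
        omega
      refine ⟨cnt, key, ?_, by omega⟩
      constructor
      · simpa using h4
      · exact h.fst_lt
      · exact h.snd_lt
      · intro k hk; simpa using h.row k hk
      · intro k hk; simpa using h.col k hk
      · intro k hk
        by_cases hkk : k = k0
        · subst hkk
          have := h.val k hk
          rw [he0] at this
          simp [he0, entry, this]
        · rw [hXe, if_neg fun e => hkk (hinj k hk e), add_zero]
          simpa [Function.update_of_ne hkk] using h.val k hk
      · intro k hk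
        rw [hXe]
        have := h.pos k hk
        split_ifs <;> linarith
      · intro k hk; simpa using h.index k hk
      · intro i' hi' j' hj' hne
        by_cases he : i = i' ∧ j = j'
        · exact ⟨k0, hk0, by rw [he0, he.1, he.2]⟩
        · rw [hXe, if_neg he, add_zero] at hne
          exact h.surj i' hi' j' hj' hne
      · intro i' hi' j' hj' h0
        by_cases he : i = i' ∧ j = j'
        · rw [hXe, if_pos he, ← he.1, ← he.2] at h0
          have := h.pos k0 hk0
          rw [he0] at this
          exact absurd h0 (by positivity)
        · rw [hXe, if_neg he, add_zero] at h0
          simpa using h.unseen i' hi' j' hj' h0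
  · intro hw0
    have : w = 0 := le_antisymm (not_lt.1 hw0) hw
    have hE : X + entry i j w = X := by
      funext i' j'; rw [hXe, this]; simp
    rw [hE]
    exact ⟨cnt, key, h, by omega⟩

/-- A loop whose iterations add matrices to the output. -/
theorem Output.forLoop {pa pb N B i r K T : ℕ} {p : Stmt} {s : RAMState} {X : ℕ → ℕ → ℝ}
    (F : ℕ → ℕ → ℕ → ℝ) (h : Output pa pb B X s)
    (hr : s.reg r = (N : ℝ)) (hir : r ≠ i) (hrp : r ∉ p.wreg) (hip : i ∉ p.wreg) (hi4 : i ≠ 4)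
    (hstep : ∀ k < N, ∀ s', Same (i :: p.wreg) p.warr s s' → s'.reg i = (k : ℝ) → ∀ B X,
      Output pa pb B X s' → Runs p s' T (Output pa pb (B + K) (X + F k))) :
    Runs (.forLoop i r p) s (2 + (N + 1) * (T + 7))
      (Output pa pb (B + N * K) (X + ∑ k ∈ Finset.range N, F k)) := by
  refine (Runs.forLoop (T := T)
    (fun k => Output pa pb (B + k * K) (X + ∑ k ∈ Finset.range k, F k)) hr hir hrp hip ?_ ?_).mono
    le_rfl fun s' _ h => h.2
  · simp only [zero_mul, add_zero, Finset.range_zero, Finset.sum_empty]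
    exact h.congr (by simp [hi4.symm]) fun _ _ => rfl
  · intro k hk s' hs hik hA
    refine (hstep k hk s' hs hik _ _ hA).mono le_rfl fun s'' _ h' => ?_
    rw [Finset.sum_range_succ, ← add_assoc, add_mul, one_mul, ← add_assoc]
    exact h'.congr (by simp [hi4.symm]) fun _ _ => rfl

/-- The output arrays hold the matrix `C`. -/
theorem Output.holdsOutput {n N : ℕ} {a b : Fin n → ℝ} {ε : ℝ}
    {ea : Fin (nnz a) ≃ {i : Fin n // a i ≠ 0}} {eb : Fin (nnz b) ≃ {i : Fin n // b i ≠ 0}}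
    {X : ℕ → ℕ → ℝ} {s : RAMState} {C : Matrix (Fin n) (Fin n) ℝ}
    (h : Output (nnz a) (nnz b) N X s) (h0 : s.arr 0 = (inputState a b ε ea eb).arr 0)
    (h2 : s.arr 2 = (inputState a b ε ea eb).arr 2)
    (hC : ∀ i j, C (eb i) (ea j) = X i j) (hC0 : ∀ i j, C i j ≠ 0 → b i ≠ 0 ∧ a j ≠ 0) :
    HoldsOutput s C ∧ matNnz C ≤ N := by
  obtain ⟨cnt, key, h, hN⟩ := h
  let f : Fin cnt → {p : Fin n × Fin n // C p.1 p.2 ≠ 0} := fun k =>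
    ⟨((eb ⟨(key k).1, h.fst_lt k k.2⟩ : Fin n), (ea ⟨(key k).2, h.snd_lt k k.2⟩ : Fin n)), by
      rw [hC]; exact (h.pos k k.2).ne'⟩
  -- Injective because array `7` determines the number from the position; surjective because C
  -- vanishes outside the supports and every non-zero entry of X is listed.
  have hf : f.Bijective := by
    constructor
    · intro k k' e
      simp only [f, Subtype.mk.injEq, Prod.mk.injEq] at e
      have e1 := eb.injective (Subtype.ext e.1)
      have e2 := ea.injective (Subtype.ext e.2)
      simp only [Fin.mk.injEq] at e1 e2
      have := h.index k k.2
      rw [e1, e2, h.index k' k'.2] at this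
      have : (k' : ℕ) + 1 = k + 1 := by exact_mod_cast this
      exact Fin.ext (by omega)
    · rintro ⟨⟨i, j⟩, hp⟩
      obtain ⟨hb, ha⟩ := hC0 i j hp
      have e1 : (eb (eb.symm ⟨i, hb⟩) : Fin n) = i := by simp
      have e2 : (ea (ea.symm ⟨j, ha⟩) : Fin n) = j := by simp
      have hX : X (eb.symm ⟨i, hb⟩) (ea.symm ⟨j, ha⟩) ≠ 0 := by
        rw [← hC, e1, e2]; exact hp
      obtain ⟨k, hk, hkey⟩ := h.surj _ (eb.symm ⟨i, hb⟩).2 _ (ea.symm ⟨j, ha⟩).2 hX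
      refine ⟨⟨k, hk⟩, Subtype.ext (Prod.ext ?_ ?_)⟩
      · simp only [f, hkey, Fin.eta, e1]
      · simp only [f, hkey, Fin.eta, e2]
  have hcard : matNnz C = cnt := by
    have := Nat.card_congr (Equiv.ofBijective f hf)
    rw [Nat.card_fin] at this
    exact this.symm
  refine ⟨⟨by rw [h.count, hcard], (finCongr hcard).trans (Equiv.ofBijective f hf), fun k => ?_⟩,
    hcard.le.trans hN⟩
  have hk : (k : ℕ) < cnt := hcard ▸ k.2
  refine ⟨?_, ?_, ?_⟩
  · rw [h.row k hk, h2]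
    simp only [inputState]
    rw [dif_pos (h.fst_lt k hk)]
    rfl
  · rw [h.col k hk, h0]
    simp only [inputState]
    rw [dif_pos (h.snd_lt k hk)]
    rfl
  · rw [h.val k hk]
    exact (hC ⟨_, h.fst_lt k hk⟩ ⟨_, h.snd_lt k hk⟩).symm

/-! ### Writing the coupling of two families of cells. -/

/-- Arrays `kI` and `kW` hold cells with three pieces each. -/
structure CellTable (kI kW M p : ℕ) (I : ℕ → ℕ → ℕ) (W : ℕ → ℕ → ℝ) (s : RAMState) : Prop where
  owner : ∀ u < M, ∀ c < 3, s.arr kI (3 * u + c) = (I u c : ℝ)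
  weight : ∀ u < M, ∀ c < 3, s.arr kW (3 * u + c) = W u c
  lt : ∀ u < M, ∀ c < 3, I u c < p
  nonneg : ∀ u < M, ∀ c < 3, 0 ≤ W u c

theorem CellTable.congr {kI kW M p : ℕ} {I : ℕ → ℕ → ℕ} {W : ℕ → ℕ → ℝ} {s s' : RAMState}
    (h : CellTable kI kW M p I W s) (hI : s'.arr kI = s.arr kI) (hW : s'.arr kW = s.arr kW) :
    CellTable kI kW M p I W s' :=
  ⟨by rw [hI]; exact h.owner, by rw [hW]; exact h.weight, h.lt, h.nonneg⟩

/-- Array `k` holds the function `g` on pairs. -/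
def PairTable (k N L : ℕ) (g : ℕ → ℕ → ℕ) (s : RAMState) : Prop :=
  ∀ u < N, ∀ l < L, s.arr k (u * L + l) = (g u l : ℝ)

/-- Join two pieces. -/
def joinPieces : Stmt :=
  .set 40 (.get 15 (3 * .var 20 + .var 22)) ;; .set 41 (.get 17 (3 * .var 30 + .var 23)) ;;
    .set 42 (.get 16 (3 * .var 20 + .var 22) * .get 18 (3 * .var 30 + .var 23) /
      (.var 16 * .var 7)) ;; emit

/-- Output the coupling: register `10` holds the number of cells, register `7` the number of edges
at a cell, register `16` the weight of a cell and register `15` the number `3`. -/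
def outputCoupling : Stmt :=
  .forLoop 20 10 (.forLoop 21 7 (.set 30 (.get 12 (.var 20 * .var 7 + .var 21)) ;;
    .forLoop 22 15 (.forLoop 23 15 joinPieces)))

/-- The matrix written by `outputCoupling`. -/
noncomputable def couplingSum (M L : ℕ) (w : ℝ) (g : ℕ → ℕ → ℕ) (I I' : ℕ → ℕ → ℕ)
    (W W' : ℕ → ℕ → ℝ) : ℕ → ℕ → ℝ :=
  ∑ u ∈ Finset.range M, ∑ l ∈ Finset.range L, ∑ c ∈ Finset.range 3, ∑ c' ∈ Finset.range 3,
    entry (I u c) (I' (g u l) c') (W u c * W' (g u l) c' / (w * L))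

theorem joinPieces_runs {pa pb B M u c v c' L : ℕ} {w : ℝ} {I I' : ℕ → ℕ → ℕ} {W W' : ℕ → ℕ → ℝ}
    {X : ℕ → ℕ → ℝ} {s : RAMState} (h : Output pa pb B X s) (h1 : s.reg 1 = (pa : ℝ))
    (hI : CellTable 15 16 M pb I W s) (hI' : CellTable 17 18 M pa I' W' s)
    (hu : u < M) (hc : c < 3) (hv : v < M) (hc' : c' < 3) (hw : 0 < w) (hL : 0 < L)
    (h20 : s.reg 20 = (u : ℝ)) (h22 : s.reg 22 = (c : ℝ)) (h30 : s.reg 30 = (v : ℝ))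
    (h23 : s.reg 23 = (c' : ℝ)) (h16 : s.reg 16 = w) (h7 : s.reg 7 = (L : ℝ)) :
    Runs joinPieces s 120 (Output pa pb (B + 1)
      (X + entry (I u c) (I' v c') (W u c * W' v c' / (w * L)))) := by
  have hL' : (0 : ℝ) < L := by exact_mod_cast hL
  have e1 : (3 : ℝ) * u + c = ((3 * u + c : ℕ) : ℝ) := by push_cast; rfl
  have e2 : (3 : ℝ) * v + c' = ((3 * v + c' : ℕ) : ℝ) := by push_cast; rfl
  have hne : w * (L : ℝ) ≠ 0 := by positivity
  refine Runs.mono (T := 13 + (13 + (27 + 60))) (Runs.seq (T := 13) ?_) (by norm_num)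
    fun _ _ h => h
  refine Runs.of_wp ?_ (Nat.le_of_ble_eq_true rfl)
  simp only [Stmt.wp, RExpr.ok_get, RExpr.ok_add, RExpr.ok_mul, RExpr.ok_var, RExpr.ok_ofNat,
    RExpr.eval_add, RExpr.eval_mul, RExpr.eval_var, RExpr.eval_ofNat, h20, h22, e1,
    Nat.floor_natCast, true_and, RExpr.eval_get, hI.owner u hu c hc]
  refine Runs.seq (T := 13) ?_
  refine Runs.of_wp ?_ (Nat.le_of_ble_eq_true rfl)
  simp only [Stmt.wp, RExpr.ok_get, RExpr.ok_add, RExpr.ok_mul, RExpr.ok_var, RExpr.ok_ofNat,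
    RExpr.eval_add, RExpr.eval_mul, RExpr.eval_var, RExpr.eval_ofNat, RAMState.reg_setReg,
    Nat.reduceEqDiff, if_false, h30, h23, e2, RAMState.arr_setReg,
    Nat.floor_natCast, true_and, RExpr.eval_get, hI'.owner v hv c' hc']
  refine Runs.seq (T := 27) ?_
  refine Runs.of_wp ?_ (Nat.le_of_ble_eq_true rfl)
  simp only [Stmt.wp, RExpr.ok_get, RExpr.ok_add, RExpr.ok_mul, RExpr.ok_var, RExpr.ok_ofNat,
    RExpr.eval_add, RExpr.eval_mul, RExpr.eval_var, RExpr.eval_ofNat, RAMState.reg_setReg,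
    Nat.reduceEqDiff, if_false, h30, h23, e2, RAMState.arr_setReg, h20, h22, e1, RExpr.ok_div,
    RExpr.eval_div, h16, h7,
    Nat.floor_natCast, true_and, RExpr.eval_get, hI'.weight v hv c' hc', hI.weight u hu c hc]
  refine ⟨hne, ?_⟩
  refine emit_runs (h.congr (by simp) fun _ _ => rfl) (by simpa using h1) (by simp) (by simp)
    (by simp) (hI.lt u hu c hc) (hI'.lt v hv c' hc') ?_
  exact div_nonneg (mul_nonneg (hI.nonneg u hu c hc) (hI'.nonneg v hv c' hc')) (by positivity)

theorem outputCoupling_runs {pa pb B M L : ℕ} {w : ℝ} {g I I' : ℕ → ℕ → ℕ} {W W' : ℕ → ℕ → ℝ}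
    {X : ℕ → ℕ → ℝ} {s : RAMState} (h : Output pa pb B X s) (h1 : s.reg 1 = (pa : ℝ))
    (hI : CellTable 15 16 M pb I W s) (hI' : CellTable 17 18 M pa I' W' s)
    (hg : PairTable 12 M L g s) (hgM : ∀ u < M, ∀ l < L, g u l < M) (hw : 0 < w) (hL : 0 < L)
    (h10 : s.reg 10 = (M : ℝ)) (h7 : s.reg 7 = (L : ℝ)) (h15 : s.reg 15 = ((3 : ℕ) : ℝ))
    (h16 : s.reg 16 = w) :
    Runs outputCoupling s (2 + (M + 1) * ((2 + (L + 1) * 2087) + 7)) (Output pa pb (B + M * (L * 9))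
      (X + couplingSum M L w g I I' W W')) := by
  refine Output.forLoop _ h h10 (by decide) (by decide) (by decide) (by decide) ?_
  intro u hu s1 hs1 h20 B X h
  have f1 {r : ℕ} (hr : r ∈ [1, 7, 10, 15, 16]) : s1.reg r = s.reg r :=
    hs1.reg r (by revert hr; revert r; decide)
  have k1 {r : ℕ} (hr : r ∈ [12, 15, 16, 17, 18]) : s1.arr r = s.arr r :=
    hs1.arr r (by revert hr; revert r; decide)
  refine Output.forLoop (K := 9) _ h ((f1 (by decide)).trans h7) (by decide) (by decide) (by decide)
    (by decide) ?_
  intro l hl s2 hs2 h21 B X h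
  have f2 {r : ℕ} (hr : r ∈ [1, 7, 10, 15, 16, 20]) : s2.reg r = s1.reg r :=
    hs2.reg r (by revert hr; revert r; decide)
  have k2 {r : ℕ} (hr : r ∈ [12, 15, 16, 17, 18]) : s2.arr r = s1.arr r :=
    hs2.arr r (by revert hr; revert r; decide)
  have e7 : s2.reg 7 = (L : ℝ) := by rw [f2 (by decide), f1 (by decide), h7]
  have e20 : s2.reg 20 = (u : ℝ) := by rw [f2 (by decide), h20]
  have eG : s2.arr 12 (u * L + l) = (g u l : ℝ) := by
    rw [k2 (by decide), k1 (by decide)]; exact hg u hu l hl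
  have e1 : (u : ℝ) * L + l = ((u * L + l : ℕ) : ℝ) := by push_cast; rfl
  -- One edge costs 10 steps for finding its end and 2070 = 2 + 4·((2 + 4·(120 + 7)) + 7) for its
  -- nine pairs of pieces; with the 7 of the loop this is the 2087 of the bound.
  refine Runs.mono (T := 10 + 2070) (Runs.seq (T := 10) (T' := 2070) ?_) (by norm_num)
    fun _ _ h => h
  refine Runs.of_wp ?_ (Nat.le_of_ble_eq_true rfl)
  simp only [Stmt.wp, RExpr.ok_get, RExpr.ok_add, RExpr.ok_mul, RExpr.ok_var, 
    RExpr.eval_add, RExpr.eval_mul, RExpr.eval_var, e20, e7, h21, e1,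
    Nat.floor_natCast, true_and, RExpr.eval_get, eG]
  set s3 := s2.setReg 30 (g u l : ℝ) with hs3
  have h' : Output pa pb B X s3 := h.congr (by simp [hs3]) fun _ _ => rfl
  have f3 {r : ℕ} (hr : r ∈ [1, 7, 10, 15, 16]) : s3.reg r = s.reg r := by
    rw [← f1 hr, ← f2 (List.mem_append_left [20] hr), hs3, RAMState.reg_setReg,
      if_neg (by revert hr; revert r; decide)]
  have k3 {r : ℕ} (hr : r ∈ [12, 15, 16, 17, 18]) : s3.arr r = s.arr r := by
    rw [← k1 hr, ← k2 hr]; rfl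
  have e20' : s3.reg 20 = (u : ℝ) := by simp [hs3, e20]
  have e30' : s3.reg 30 = (g u l : ℝ) := by simp [hs3]
  refine Runs.mono (T := 2 + (3 + 1) * ((2 + (3 + 1) * (120 + 7)) + 7)) ?_ (by norm_num)
    fun _ _ h => h
  change Runs _ _ _ (Output pa pb (B + 3 * 3) _)
  refine Output.forLoop (N := 3) (K := 3) _ h' ((f3 (by decide)).trans h15) (by decide) (by decide)
    (by decide) (by decide) ?_
  intro c hc s4 hs4 h22 B X h
  have f4 {r : ℕ} (hr : r ∈ [1, 7, 10, 15, 16, 20, 30]) : s4.reg r = s3.reg r :=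
    hs4.reg r (by revert hr; revert r; decide)
  have k4 {r : ℕ} (hr : r ∈ [12, 15, 16, 17, 18]) : s4.arr r = s3.arr r :=
    hs4.arr r (by revert hr; revert r; decide)
  change Runs _ _ _ (Output pa pb (B + 3 * 1) _)
  refine Output.forLoop (N := 3) (K := 1) (T := 120) _ h
    (((f4 (by decide)).trans (f3 (by decide))).trans h15) (by decide) (by decide)
    (by decide) (by decide) ?_
  intro c' hc' s5 hs5 h23 B X h
  have f5 {r : ℕ} (hr : r ∈ [1, 7, 10, 15, 16, 20, 30]) : s5.reg r = s3.reg r := by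
    rw [← f4 hr]
    exact hs5.reg r (by revert hr; revert r; decide)
  have f5' {r : ℕ} (hr : r ∈ [1, 7, 10, 15, 16]) : s5.reg r = s.reg r := by
    rw [← f3 hr]; exact f5 (List.mem_append_left [20, 30] hr)
  have k5 {r : ℕ} (hr : r ∈ [12, 15, 16, 17, 18]) : s5.arr r = s.arr r := by
    rw [← k3 hr, ← k4 hr]
    exact hs5.arr r (by revert hr; revert r; decide)
  exact joinPieces_runs h ((f5' (by decide)).trans h1) (hI.congr (k5 (by decide)) (k5 (by decide)))
    (hI'.congr (k5 (by decide)) (k5 (by decide))) hu hc (hgM u hu l hl) hc' hw hL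
    ((f5 (by decide)).trans e20') ((hs5.reg 22 (by decide)).trans h22)
    ((f5 (by decide)).trans e30') h23 ((f5' (by decide)).trans h16) ((f5' (by decide)).trans h7)

/-! ### Tables -/

/-- The first `n` cells of array `k` hold the values of `F`. -/
def Prefix (k n : ℕ) (F : ℕ → ℕ) (s : RAMState) : Prop := ∀ x < n, s.arr k x = (F x : ℝ)

theorem Prefix.put {k n : ℕ} {F : ℕ → ℕ} {s : RAMState} (h : Prefix k n F s) {v : ℝ}
    (hv : v = F n) : Prefix k (n + 1) F (s.setArr k n v) := by
  intro x hx
  rw [RAMState.arr_setArr, if_pos rfl]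
  rcases Nat.lt_succ_iff_lt_or_eq.1 hx with hx | rfl
  · rw [Function.update_of_ne hx.ne]; exact h x hx
  · rw [Function.update_self, hv]

theorem Prefix.congr {k n : ℕ} {F : ℕ → ℕ} {s s' : RAMState} (h : Prefix k n F s)
    (he : s'.arr k = s.arr k) : Prefix k n F s' := by
  intro x hx; rw [he]; exact h x hx

theorem PairTable.congr {k N L : ℕ} {g : ℕ → ℕ → ℕ} {s s' : RAMState} (h : PairTable k N L g s)
    (he : s'.arr k = s.arr k) : PairTable k N L g s' := by
  intro u hu l hl; rw [he]; exact h u hu l hl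

theorem mul_add_div_eq {i j p : ℕ} (hj : j < p) : (i * p + j) / p = i := by
  rw [mul_comm, Nat.mul_add_div (by omega), Nat.div_eq_of_lt hj, add_zero]

theorem mul_add_mod_eq {i j p : ℕ} (hj : j < p) : (i * p + j) % p = j := by
  rw [mul_comm, Nat.mul_add_mod, Nat.mod_eq_of_lt hj]

theorem Prefix.pairTable {k N L : ℕ} {g : ℕ → ℕ → ℕ} {s : RAMState}
    (h : Prefix k (N * L) (fun x => g (x / L) (x % L)) s) : PairTable k N L g s := by
  intro u hu l hl
  rw [h _ (mul_add_lt_mul hu hl)]; simp only [mul_add_div_eq hl, mul_add_mod_eq hl]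

theorem Prefix.zero {k : ℕ} {F : ℕ → ℕ} {s : RAMState} : Prefix k 0 F s :=
  fun _ hx => absurd hx (Nat.not_lt_zero _)

/-- A loop each of whose iterations extends a table by `c` cells. -/
theorem Prefix.forLoop {k n c i r N T : ℕ} {F : ℕ → ℕ} {p : Stmt} {s : RAMState}
    (h : Prefix k n F s) (hr : s.reg r = (N : ℝ)) (hir : r ≠ i) (hrp : r ∉ p.wreg)
    (hip : i ∉ p.wreg)
    (hstep : ∀ j < N, ∀ s', Same (i :: p.wreg) p.warr s s' → s'.reg i = (j : ℝ) →
      Prefix k (n + j * c) F s' → Runs p s' T (Prefix k (n + (j + 1) * c) F)) :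
    Runs (.forLoop i r p) s (2 + (N + 1) * (T + 7)) (Prefix k (n + N * c) F) := by
  refine (Runs.forLoop (T := T) (fun j => Prefix k (n + j * c) F) hr hir hrp hip ?_ ?_).mono
    le_rfl fun s' _ h => h.2
  · rw [zero_mul, add_zero]; exact h.congr rfl
  · intro j hj s' hs hij hA
    exact (hstep j hj s' hs hij hA).mono le_rfl fun s'' _ h' => h'.congr rfl

/-! ### Tables of powers, quotients, remainders and translations. -/

/-- Register `11` becomes the power of register `5` with the exponent in register `12`. -/
def powProg : Stmt := .set 11 1 ;; .forLoop 20 12 (.set 11 (.var 11 * .var 5))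

theorem powProg_runs {q J : ℕ} {s : RAMState} (h5 : s.reg 5 = (q : ℝ)) (h12 : s.reg 12 = (J : ℝ)) :
    Runs powProg s (4 + (J + 1) * 11) (fun s' => s'.reg 11 = ((q ^ J : ℕ) : ℝ)) := by
  refine Runs.mono (T := 2 + (2 + (J + 1) * (4 + 7))) (Runs.seq (T := 2) ?_) (by omega)
    fun _ _ h => h
  refine Runs.of_wp ?_ (Nat.le_of_ble_eq_true rfl)
  simp only [Stmt.wp, RExpr.ok_one, RExpr.eval_one, true_and]
  refine (Runs.forLoop (N := J) (T := 4) (fun k s' => s'.reg 11 = ((q ^ k : ℕ) : ℝ)) (by simpa)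
    (by decide) (by decide) (by decide) (by simp) ?_).mono le_rfl fun _ _ h => h.2
  intro k hk s' hs _ h11
  refine Runs.of_wp ?_ (Nat.le_of_ble_eq_true rfl)
  have e5 : s'.reg 5 = (q : ℝ) := by rw [hs.reg 5 (by decide)]; simpa using h5
  simp only [Stmt.wp, RExpr.ok_mul, RExpr.ok_var, RExpr.eval_mul, RExpr.eval_var, h11, e5,
    RAMState.reg_setReg, true_and]
  push_cast
  ring

/-- Arrays `8` and `9` hold the quotients and the remainders modulo register `5` of the numbers
below register `11`. -/
def divModProg : Stmt :=
  .set 31 0 ;; .set 32 0 ;; .forLoop 20 11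
    (.put 8 (.var 20) (.var 31) ;; .put 9 (.var 20) (.var 32) ;; .set 32 (.var 32 + 1) ;;
      .ite (.var 32) (.var 5) .skip (.set 32 0 ;; .set 31 (.var 31 + 1)))

/-- The machine has no rounding, so quotient and remainder are carried along as a counter that wraps
around at `q`. Later reductions modulo `q` are table lookups. -/
theorem divModProg_runs {q X : ℕ} {s : RAMState} (hq : 0 < q) (h5 : s.reg 5 = (q : ℝ))
    (h11 : s.reg 11 = (X : ℝ)) :
    Runs divModProg s (6 + (X + 1) * 27)
      (fun s' => Prefix 8 X (· / q) s' ∧ Prefix 9 X (· % q) s') := by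
  refine Runs.mono (T := 2 + (2 + (2 + (X + 1) * (20 + 7)))) (Runs.seq (T := 2) ?_) (by omega)
    fun _ _ h => h
  refine Runs.of_wp ?_ (Nat.le_of_ble_eq_true rfl)
  refine ⟨trivial, Runs.seq (T := 2) ?_⟩
  refine Runs.of_wp ?_ (Nat.le_of_ble_eq_true rfl)
  refine ⟨trivial, ?_⟩
  refine (Runs.forLoop (N := X) (T := 20) (fun k s' => s'.reg 31 = ((k / q : ℕ) : ℝ) ∧
    s'.reg 32 = ((k % q : ℕ) : ℝ) ∧ Prefix 8 k (· / q) s' ∧ Prefix 9 k (· % q) s') (by simpa)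
    (by decide) (by decide) (by decide) (by simp [Prefix.zero]) ?_).mono le_rfl
    fun _ _ h => h.2.2.2
  rintro k hk s' hs h20 ⟨h31, h32, h8, h9⟩
  refine Runs.of_wp ?_ (Nat.le_of_ble_eq_true rfl)
  have e5 : s'.reg 5 = (q : ℝ) := by rw [hs.reg 5 (by decide)]; simpa using h5
  have e32 : ((k % q : ℕ) : ℝ) + 1 = ((k % q + 1 : ℕ) : ℝ) := by push_cast; rfl
  have e31 : ((k / q : ℕ) : ℝ) + 1 = ((k / q + 1 : ℕ) : ℝ) := by push_cast; rfl
  simp only [Stmt.wp, RExpr.ok_var, RExpr.ok_add, RExpr.ok_one, RExpr.ok_zero, RExpr.eval_var,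
    RExpr.eval_add, RExpr.eval_one, RExpr.eval_zero, h20, h31, h32, Nat.floor_natCast, true_and,
    RAMState.reg_setReg, RAMState.reg_setArr, if_true, Nat.reduceEqDiff, if_false, e5, e32, e31,
    Nat.cast_lt]
  have p8 := h8.put (v := ((k / q : ℕ) : ℝ)) rfl
  have p9 := (h9.congr (s' := s'.setArr 8 k ((k / q : ℕ) : ℝ)) (by simp)).put
    (v := ((k % q : ℕ) : ℝ)) rfl
  have hlt := Nat.mod_lt k hq
  have hdm := Nat.div_add_mod k q
  constructor
  · intro hc
    have e : k + 1 = (k / q) * q + (k % q + 1) := by rw [mul_comm]; omega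
    refine ⟨?_, ?_, ?_, p9⟩
    · rw [e, mul_add_div_eq hc]
    · rw [e, mul_add_mod_eq hc]
    · exact p8.congr (by simp)
  · intro hc
    have e : k + 1 = (k / q + 1) * q + 0 := by rw [add_mul, mul_comm]; omega
    refine ⟨?_, ?_, ?_, p9⟩
    · rw [e, mul_add_div_eq hq]
    · rw [e, mul_add_mod_eq hq]; simp
    · exact p8.congr (by simp)

/-- Translation along the moment curve, in digits. -/
def digitShift (q J x y z : ℕ) : ℕ := ∑ i ∈ Finset.range J, (x / q ^ i + y * z ^ i) % q * q ^ i

/-- One step of the sum `digitShift`. -/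
def digitStep : Stmt :=
  .set 33 (.var 33 + .get 9 (.get 9 (.var 31) + .var 32) * .var 34) ;;
    .set 32 (.get 9 (.var 32 * .var 22)) ;; .set 31 (.get 8 (.var 31)) ;;
    .set 34 (.var 34 * .var 5)

/-- Array `10` becomes the table of the translations along the moment curve. -/
def shiftProg : Stmt :=
  .forLoop 20 11 (.forLoop 21 5 (.forLoop 22 5
    (.set 31 (.var 20) ;; .set 32 (.var 21) ;; .set 33 0 ;; .set 34 1 ;;
      .forLoop 23 12 digitStep ;;
      .put 10 ((.var 20 * .var 5 + .var 21) * .var 5 + .var 22) (.var 33))))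

/-- After `k` rounds registers `31`, `32`, `34` hold x / q^k, y z^k mod q and q^k. The lookups are
legitimate since a sum of two residues and a product of two residues are below q * q ≤ X. -/
theorem digitSum_runs {q J X x y z : ℕ} {s : RAMState} (hq : 2 ≤ q) (hX : q * q ≤ X)
    (hx : x < X) (hy : y < q) (hz : z < q) (h5 : s.reg 5 = (q : ℝ)) (h12 : s.reg 12 = (J : ℝ))
    (h8 : Prefix 8 X (· / q) s) (h9 : Prefix 9 X (· % q) s) (h22 : s.reg 22 = (z : ℝ))
    (h31 : s.reg 31 = (x : ℝ)) (h32 : s.reg 32 = (y : ℝ)) (h33 : s.reg 33 = 0)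
    (h34 : s.reg 34 = 1) :
    Runs (.forLoop 23 12 digitStep) s (2 + (J + 1) * 32)
      (fun s' => s'.reg 33 = (digitShift q J x y z : ℝ)) := by
  refine (Runs.forLoop (N := J) (T := 25) (fun k s' => s'.reg 31 = ((x / q ^ k : ℕ) : ℝ) ∧
    s'.reg 32 = ((y * z ^ k % q : ℕ) : ℝ) ∧ s'.reg 33 = (digitShift q k x y z : ℝ) ∧
    s'.reg 34 = ((q ^ k : ℕ) : ℝ)) h12
    (by decide) (by decide) (by decide)
    (by simp [h31, h32, h33, h34, digitShift, Nat.mod_eq_of_lt hy]) ?_).mono le_rfl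
    fun _ _ h => h.2.2.2.1
  rintro k hk s' hs - ⟨e31, e32, e33, e34⟩
  have e8 := h8.congr (hs.arr 8 (by decide))
  have e9 := h9.congr (hs.arr 9 (by decide))
  have e5 : s'.reg 5 = (q : ℝ) := (hs.reg 5 (by decide)).trans h5
  have e22 : s'.reg 22 = (z : ℝ) := (hs.reg 22 (by decide)).trans h22
  have b1 : x / q ^ k < X := (Nat.div_le_self _ _).trans_lt hx
  have b2 : x / q ^ k % q < q := Nat.mod_lt _ (by omega)
  have b3 : y * z ^ k % q < q := Nat.mod_lt _ (by omega)
  have b4 : x / q ^ k % q + y * z ^ k % q < X := by nlinarith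
  have b5 : y * z ^ k % q * z < X := by nlinarith
  have c1 : ((x / q ^ k % q : ℕ) : ℝ) + ((y * z ^ k % q : ℕ) : ℝ) =
    ((x / q ^ k % q + y * z ^ k % q : ℕ) : ℝ) := by push_cast; rfl
  have c2 : ((y * z ^ k % q : ℕ) : ℝ) * z = ((y * z ^ k % q * z : ℕ) : ℝ) := by push_cast; rfl
  refine Runs.of_wp ?_ (Nat.le_of_ble_eq_true rfl)
  simp only [digitStep, Stmt.wp, RExpr.ok_var, RExpr.ok_add, RExpr.ok_mul, RExpr.ok_get,
    RExpr.eval_var, RExpr.eval_add, RExpr.eval_mul, RExpr.eval_get, Nat.floor_natCast, true_and,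
    RAMState.reg_setReg, RAMState.arr_setReg, if_true, Nat.reduceEqDiff, if_false, e5, e22, e31,
    e32, e33, e34, e9 _ b1, c1, e9 _ b4, c2, e9 _ b5, e8 _ b1]
  refine ⟨?_, ?_, ?_, ?_⟩
  · rw [Nat.div_div_eq_div_mul, pow_succ]
  · rw [Nat.mod_mul_mod, pow_succ, mul_assoc]
  · rw [digitShift, digitShift, Finset.sum_range_succ, Nat.add_mod (x / q ^ k)]
    push_cast
    rfl
  · push_cast; ring

theorem shiftProg_runs {q J X : ℕ} {s : RAMState} (hq : 2 ≤ q) (hX : q * q ≤ X)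
    (h5 : s.reg 5 = (q : ℝ)) (h11 : s.reg 11 = (X : ℝ)) (h12 : s.reg 12 = (J : ℝ))
    (h8 : Prefix 8 X (· / q) s) (h9 : Prefix 9 X (· % q) s) :
    Runs shiftProg s
      (2 + (X + 1) * ((2 + (q + 1) * ((2 + (q + 1) * ((30 + (J + 1) * 32) + 7)) + 7)) + 7))
      (PairTable 10 X (q * q) (fun x l => digitShift q J x (l / q) (l % q))) := by
  have hm := Prefix.forLoop (k := 10) (n := 0) (c := q * q) (i := 20) (r := 11) (s := s) (N := X)
    (T := 2 + (q + 1) * ((2 + (q + 1) * ((30 + (J + 1) * 32) + 7)) + 7))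
    (F := fun t => digitShift q J (t / (q * q)) (t % (q * q) / q) (t % (q * q) % q))
    (p := .forLoop 21 5 (.forLoop 22 5
    (.set 31 (.var 20) ;; .set 32 (.var 21) ;; .set 33 0 ;; .set 34 1 ;;
      .forLoop 23 12 digitStep ;;
      .put 10 ((.var 20 * .var 5 + .var 21) * .var 5 + .var 22) (.var 33)))) .zero h11
      (by decide) (by decide) (by decide) ?_
  · rw [zero_add] at hm
    exact hm.mono le_rfl fun s' _ h => h.pairTable
  intro x hx s1 hs1 h20 h
  have e5 : s1.reg 5 = (q : ℝ) := (hs1.reg 5 (by decide)).trans h5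
  rw [show 0 + (x + 1) * (q * q) = (0 + x * (q * q)) + q * q by ring]
  refine Prefix.forLoop h e5 (by decide) (by decide) (by decide) ?_
  intro y hy s2 hs2 h21 h
  have f5 : s2.reg 5 = (q : ℝ) := (hs2.reg 5 (by decide)).trans e5
  rw [show 0 + x * (q * q) + (y + 1) * q = (0 + x * (q * q) + y * q) + q * 1 by ring]
  refine Prefix.forLoop h f5 (by decide) (by decide) (by decide) ?_
  intro z hz s3 hs3 h22 h
  have g5 : s3.reg 5 = (q : ℝ) := (hs3.reg 5 (by decide)).trans f5
  have g21 : s3.reg 21 = (y : ℝ) := (hs3.reg 21 (by decide)).trans h21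
  have g20 : s3.reg 20 = (x : ℝ) := by
    rw [hs3.reg 20 (by decide), hs2.reg 20 (by decide), h20]
  have g12 : s3.reg 12 = (J : ℝ) := by
    rw [hs3.reg 12 (by decide), hs2.reg 12 (by decide), hs1.reg 12 (by decide), h12]
  have g8 : Prefix 8 X (· / q) s3 := h8.congr (by
    rw [hs3.arr 8 (by decide), hs2.arr 8 (by decide), hs1.arr 8 (by decide)])
  have g9 : Prefix 9 X (· % q) s3 := h9.congr (by
    rw [hs3.arr 9 (by decide), hs2.arr 9 (by decide), hs1.arr 9 (by decide)])
  refine Runs.mono (T := 2 + (2 + (2 + (2 + ((2 + (J + 1) * 32) + 11))))) ?_ (by omega)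
    fun _ _ h => h
  refine Runs.seq (Runs.of_wp ⟨trivial, ?_⟩ (Nat.le_of_ble_eq_true rfl))
  refine Runs.seq (Runs.of_wp ⟨trivial, ?_⟩ (Nat.le_of_ble_eq_true rfl))
  refine Runs.seq (Runs.of_wp ⟨trivial, ?_⟩ (Nat.le_of_ble_eq_true rfl))
  refine Runs.seq (Runs.of_wp ⟨trivial, ?_⟩ (Nat.le_of_ble_eq_true rfl))
  set s4 := (((s3.setReg 31 ((RExpr.var 20).eval s3)).setReg 32 _).setReg 33 _).setReg 34 _ with hs4
  refine (digitSum_runs hq hX hx hy hz (s := s4) (by simpa [hs4] using g5)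
    (by simpa [hs4] using g12) (g8.congr rfl) (g9.congr rfl) (by simpa [hs4] using h22)
    (by simpa [hs4] using g20) (by simpa [hs4] using g21) (by simp [hs4]) (by simp [hs4])).andThen ?_
  intro s5 hs5 h33
  have k20 : s5.reg 20 = (x : ℝ) := by rw [hs5.reg 20 (by decide)]; simpa [hs4] using g20
  have k21 : s5.reg 21 = (y : ℝ) := by rw [hs5.reg 21 (by decide)]; simpa [hs4] using g21
  have k22 : s5.reg 22 = (z : ℝ) := by rw [hs5.reg 22 (by decide)]; simpa [hs4] using h22
  have k5 : s5.reg 5 = (q : ℝ) := by rw [hs5.reg 5 (by decide)]; simpa [hs4] using g5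
  have k10 : s5.arr 10 = s3.arr 10 := by rw [hs5.arr 10 (by decide)]; rfl
  refine Runs.of_wp ?_ (Nat.le_of_ble_eq_true rfl)
  have c1 : ((x : ℝ) * q + y) * q + z = ((0 + x * (q * q) + y * q + z * 1 : ℕ) : ℝ) := by
    push_cast; ring
  simp only [Stmt.wp, RExpr.ok_var, RExpr.ok_add, RExpr.ok_mul, RExpr.eval_var, RExpr.eval_add,
    RExpr.eval_mul, k20, k21, k22, k5, c1, Nat.floor_natCast, true_and, h33]
  rw [show 0 + x * (q * q) + y * q + (z + 1) * 1 = (0 + x * (q * q) + y * q + z * 1) + 1 by ring]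
  refine (h.congr k10).put ?_
  have hyz : y * q + z < q * q := mul_add_lt_mul hy hz
  rw [show 0 + x * (q * q) + y * q + z * 1 = x * (q * q) + (y * q + z) by ring]
  simp only [mul_add_div_eq hyz, mul_add_mod_eq hyz, mul_add_div_eq hz, mul_add_mod_eq hz]

/-! ### Tables of expanders -/

/-- Array `k` holds a family of `L` permutations of `V` points with contraction factor `lam`. -/
def ExpTable (k V L : ℕ) (lam : ℝ) (s : RAMState) : Prop :=
  ∃ (G : ℕ → ℕ → ℕ) (g : Fin L → Fin V → Fin V), IsExp g lam ∧ (∀ l v, (g l v : ℕ) = G v l) ∧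
    PairTable k V L G s

theorem ExpTable.congr {k V L : ℕ} {lam : ℝ} {s s' : RAMState} (h : ExpTable k V L lam s)
    (he : s'.arr k = s.arr k) : ExpTable k V L lam s' := by
  obtain ⟨G, g, h1, h2, h3⟩ := h
  exact ⟨G, g, h1, h2, h3.congr he⟩

theorem ExpTable.mono {k V L : ℕ} {lam lam' : ℝ} {s : RAMState} (h : ExpTable k V L lam s)
    (hl : lam ≤ lam') : ExpTable k V L lam' s := by
  obtain ⟨G, g, h1, h2, h3⟩ := h
  exact ⟨G, g, h1.mono hl, h2, h3⟩

theorem expTable_digitShift {q J : ℕ} (hq : q.Prime) {s : RAMState}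
    (h : PairTable 10 (q ^ J) (q * q) (fun x l => digitShift q J x (l / q) (l % q)) s) :
    ExpTable 10 (q ^ J) (q * q) (J / q) s := by
  obtain ⟨g, hg, hg'⟩ := exists_isExp_digits hq J
  refine ⟨_, g, hg, fun l v => ?_, h⟩
  have e : (l : ℕ) / q * q + l % q = l := Nat.div_add_mod' _ _
  have hl : (l : ℕ) / q * q + l % q < q * q := e.symm ▸ l.2
  have := hg' (l / q) (l % q) hl v (Nat.mod_lt _ hq.pos)
  rw [digitShift, ← this]
  congr 3
  exact Fin.ext e.symm

/-- Array `12` becomes the zig-zag product of the families in the arrays `11` and `10`. -/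
def zigzagProg : Stmt :=
  .forLoop 20 10 (.forLoop 21 11 (.forLoop 22 6
    (.set 31 (.get 10 (.var 21 * .var 6 + .var 22)) ;;
      .set 32 (.get 11 (.var 20 * .var 11 + .var 31)) ;;
      .set 34 (((.var 20 * .var 11 + .var 21) * .var 6 + .var 22) * .var 6) ;;
      .forLoop 23 6 (.put 12 (.var 34 + .var 23)
        (.var 32 * .var 11 + .get 10 (.var 31 * .var 6 + .var 23))))))

/-- The zig-zag product on numbers. -/
def zigzagNat (X Q : ℕ) (W H : ℕ → ℕ → ℕ) (u l : ℕ) : ℕ :=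
  W (u / X) (H (u % X) (l / Q)) * X + H (H (u % X) (l / Q)) (l % Q)

theorem zigzagProg_runs_pairTable {V X Q : ℕ} {W H : ℕ → ℕ → ℕ} {s : RAMState}
    (h10 : s.reg 10 = (V : ℝ)) (h11 : s.reg 11 = (X : ℝ)) (h6 : s.reg 6 = (Q : ℝ))
    (hW : PairTable 11 V X W s) (hH : PairTable 10 X Q H s) (hHX : ∀ x < X, ∀ l < Q, H x l < X) :
    Runs zigzagProg s
      (2 + (V + 1) * ((2 + (X + 1) * ((2 + (Q + 1) * ((30 + (2 + (Q + 1) * 27)) + 7)) + 7)) + 7))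
      (PairTable 12 (V * X) (Q * Q) (zigzagNat X Q W H)) := by
  have hm := Prefix.forLoop (k := 12) (n := 0) (c := X * (Q * Q)) (i := 20) (r := 10) (s := s)
    (N := V) (T := 2 + (X + 1) * ((2 + (Q + 1) * ((30 + (2 + (Q + 1) * 27)) + 7)) + 7))
    (F := fun t => zigzagNat X Q W H (t / (Q * Q)) (t % (Q * Q)))
    (p := .forLoop 21 11 (.forLoop 22 6
    (.set 31 (.get 10 (.var 21 * .var 6 + .var 22)) ;;
      .set 32 (.get 11 (.var 20 * .var 11 + .var 31)) ;;
      .set 34 (((.var 20 * .var 11 + .var 21) * .var 6 + .var 22) * .var 6) ;;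
      .forLoop 23 6 (.put 12 (.var 34 + .var 23)
        (.var 32 * .var 11 + .get 10 (.var 31 * .var 6 + .var 23)))))) .zero h10
      (by decide) (by decide) (by decide) ?_
  · rw [zero_add, ← mul_assoc] at hm
    exact hm.mono le_rfl fun s' _ h => h.pairTable
  intro v hv s1 hs1 h20 h
  have f1 {r : ℕ} (hr : r ∈ [6, 10, 11]) : s1.reg r = s.reg r :=
    hs1.reg r (by revert hr; revert r; decide)
  have k1 {r : ℕ} (hr : r ∈ [10, 11]) : s1.arr r = s.arr r :=
    hs1.arr r (by revert hr; revert r; decide)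
  rw [show 0 + (v + 1) * (X * (Q * Q)) = (0 + v * (X * (Q * Q))) + X * (Q * Q) by ring]
  refine Prefix.forLoop h ((f1 (by decide)).trans h11) (by decide) (by decide) (by decide) ?_
  intro x hx s2 hs2 h21 h
  have f2 {r : ℕ} (hr : r ∈ [6, 10, 11]) : s2.reg r = s.reg r := by
    rw [← f1 hr]; exact hs2.reg r (by revert hr; revert r; decide)
  have k2 {r : ℕ} (hr : r ∈ [10, 11]) : s2.arr r = s.arr r := by
    rw [← k1 hr]; exact hs2.arr r (by revert hr; revert r; decide)
  rw [show 0 + v * (X * (Q * Q)) + (x + 1) * (Q * Q) =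
    (0 + v * (X * (Q * Q)) + x * (Q * Q)) + Q * Q by ring]
  refine Prefix.forLoop h ((f2 (by decide)).trans h6) (by decide) (by decide) (by decide) ?_
  intro l hl s3 hs3 h22 h
  have f3 {r : ℕ} (hr : r ∈ [6, 10, 11]) : s3.reg r = s.reg r := by
    rw [← f2 hr]; exact hs3.reg r (by revert hr; revert r; decide)
  have k3 {r : ℕ} (hr : r ∈ [10, 11]) : s3.arr r = s.arr r := by
    rw [← k2 hr]; exact hs3.arr r (by revert hr; revert r; decide)
  have g21 : s3.reg 21 = (x : ℝ) := (hs3.reg 21 (by decide)).trans h21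
  have g20 : s3.reg 20 = (v : ℝ) := by
    rw [hs3.reg 20 (by decide), hs2.reg 20 (by decide), h20]
  have g6 : s3.reg 6 = (Q : ℝ) := (f3 (by decide)).trans h6
  have g11 : s3.reg 11 = (X : ℝ) := (f3 (by decide)).trans h11
  have gH := hH.congr (k3 (r := 10) (by decide))
  have gW := hW.congr (k3 (r := 11) (by decide))
  set base := 0 + v * (X * (Q * Q)) + x * (Q * Q) + l * Q with hbase
  have e1 : (x : ℝ) * Q + l = ((x * Q + l : ℕ) : ℝ) := by push_cast; rfl
  have e2 : (v : ℝ) * X + (H x l : ℝ) = ((v * X + H x l : ℕ) : ℝ) := by push_cast; rfl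
  have e3 : (((v : ℝ) * X + x) * Q + l) * Q = (base : ℝ) := by
    rw [hbase]; push_cast; ring
  refine Runs.mono (T := 8 + (8 + (12 + (2 + (Q + 1) * (20 + 7))))) ?_ (by omega)
    fun _ _ h => h
  refine Runs.seq (Runs.of_wp ?_ (Nat.le_of_ble_eq_true rfl))
  simp only [Stmt.wp, RExpr.ok_get, RExpr.ok_add, RExpr.ok_mul, RExpr.ok_var, RExpr.eval_add,
    RExpr.eval_mul, RExpr.eval_var, g21, h22, g6, e1, Nat.floor_natCast, true_and, RExpr.eval_get,
    gH x hx l hl]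
  refine Runs.seq (Runs.of_wp ?_ (Nat.le_of_ble_eq_true rfl))
  simp only [Stmt.wp, RExpr.ok_get, RExpr.ok_add, RExpr.ok_mul, RExpr.ok_var, RExpr.eval_add,
    RExpr.eval_mul, RExpr.eval_var, g20, g11, e2, Nat.floor_natCast, true_and, RExpr.eval_get,
    RAMState.reg_setReg, RAMState.arr_setReg, if_true, Nat.reduceEqDiff, if_false,
    gW v hv _ (hHX x hx l hl)]
  refine Runs.seq (Runs.of_wp ?_ (Nat.le_of_ble_eq_true rfl))
  simp only [Stmt.wp, RExpr.ok_add, RExpr.ok_mul, RExpr.ok_var, RExpr.eval_add,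
    RExpr.eval_mul, RExpr.eval_var, g20, g11, g21, g6, h22, e3, true_and,
    RAMState.reg_setReg, Nat.reduceEqDiff, if_false]
  set s4 := ((s3.setReg 31 _).setReg 32 _).setReg 34 _ with hs4
  rw [show 0 + v * (X * (Q * Q)) + x * (Q * Q) + (l + 1) * Q = base + Q * 1 by rw [hbase]; ring]
  refine Prefix.forLoop (h.congr (s' := s4) rfl) (by simpa [hs4] using g6) (by decide) (by decide)
    (by decide) ?_
  intro l' hl' s5 hs5 h23 h
  have f5 {r : ℕ} (hr : r ∈ [6, 11, 31, 32, 34]) : s5.reg r = s4.reg r :=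
    hs5.reg r (by revert hr; revert r; decide)
  have k6 : s5.reg 6 = (Q : ℝ) := by rw [f5 (by decide)]; simpa [hs4] using g6
  have k11 : s5.reg 11 = (X : ℝ) := by rw [f5 (by decide)]; simpa [hs4] using g11
  have k31 : s5.reg 31 = (H x l : ℝ) := by rw [f5 (by decide)]; simp [hs4]
  have k32 : s5.reg 32 = (W v (H x l) : ℝ) := by rw [f5 (by decide)]; simp [hs4]
  have k34 : s5.reg 34 = (base : ℝ) := by rw [f5 (by decide)]; simp [hs4]
  have kH := gH.congr (s' := s5) (by rw [hs5.arr 10 (by decide)]; rfl)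
  have e4 : (base : ℝ) + l' = ((base + l' * 1 : ℕ) : ℝ) := by push_cast; ring
  have e5 : (H x l : ℝ) * Q + l' = ((H x l * Q + l' : ℕ) : ℝ) := by push_cast; rfl
  refine Runs.of_wp ?_ (Nat.le_of_ble_eq_true rfl)
  simp only [Stmt.wp, RExpr.ok_get, RExpr.ok_add, RExpr.ok_mul, RExpr.ok_var, RExpr.eval_add,
    RExpr.eval_mul, RExpr.eval_var, k34, k32, k31, k11, k6, h23, e4, e5, Nat.floor_natCast,
    true_and, RExpr.eval_get, kH _ (hHX x hx l hl) l' hl']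
  rw [show base + (l' + 1) * 1 = (base + l' * 1) + 1 by ring]
  refine h.put ?_
  have hll : l * Q + l' < Q * Q := mul_add_lt_mul hl hl'
  rw [show base + l' * 1 = (v * X + x) * (Q * Q) + (l * Q + l') by rw [hbase]; ring]
  simp only [mul_add_div_eq hll, mul_add_mod_eq hll, zigzagNat, mul_add_div_eq hx,
    mul_add_mod_eq hx, mul_add_div_eq hl', mul_add_mod_eq hl']
  push_cast
  rfl

theorem finProdFinEquiv_symm_val {m n : ℕ} (u : Fin (m * n)) :
    ((finProdFinEquiv.symm u).1 : ℕ) = u / n ∧ ((finProdFinEquiv.symm u).2 : ℕ) = u % n :=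
  ⟨rfl, rfl⟩

/-- The numbering v * X + x of points and l * Q + l' of labels is that of `finProdFinEquiv`, so the
computed table is the zig-zag product transported to numbers. -/
theorem zigzagProg_runs {V X Q : ℕ} {lw lh : ℝ} {s : RAMState}
    (h10 : s.reg 10 = (V : ℝ)) (h11 : s.reg 11 = (X : ℝ)) (h6 : s.reg 6 = (Q : ℝ))
    (hV : 0 < V) (hX : 0 < X) (hQ : 0 < Q) (hlw : 0 ≤ lw) (hlh : 0 ≤ lh)
    (hW : ExpTable 11 V X lw s) (hH : ExpTable 10 X Q lh s) :
    Runs zigzagProg s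
      (2 + (V + 1) * ((2 + (X + 1) * ((2 + (Q + 1) * ((30 + (2 + (Q + 1) * 27)) + 7)) + 7)) + 7))
      (ExpTable 12 (V * X) (Q * Q) (lw + 2 * lh)) := by
  obtain ⟨W, w, w1, w2, w3⟩ := hW
  obtain ⟨H, h, h1, h2, h3⟩ := hH
  have : Nonempty (Fin V) := ⟨⟨0, hV⟩⟩
  have : Nonempty (Fin X) := ⟨⟨0, hX⟩⟩
  have : Nonempty (Fin Q) := ⟨⟨0, hQ⟩⟩
  refine (zigzagProg_runs_pairTable h10 h11 h6 w3 h3 ?_).mono le_rfl fun s' _ h' =>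
    ⟨_, _, (w1.zigzag h1 hlh hlw).congr finProdFinEquiv.symm finProdFinEquiv.symm, ?_, h'⟩
  · intro x hx l hl
    rw [← h2 ⟨l, hl⟩ ⟨x, hx⟩]
    exact (h _ _).2
  · intro l u
    obtain ⟨u1, u2⟩ := finProdFinEquiv_symm_val u
    obtain ⟨l1, l2⟩ := finProdFinEquiv_symm_val l
    rw [zigzagNat, ← u1, ← u2, ← l1, ← l2, ← h2, ← h2, ← w2]
    simp only [zigzag, Equiv.symm_symm, finProdFinEquiv_apply_val]
    ring

/-- Array `11` becomes the square of the family in array `12`. -/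
def squareProg : Stmt :=
  .forLoop 20 10 (.forLoop 21 7 (.forLoop 22 7
    (.put 11 ((.var 20 * .var 7 + .var 21) * .var 7 + .var 22)
      (.get 12 (.get 12 (.var 20 * .var 7 + .var 21) * .var 7 + .var 22)))))

theorem squareProg_runs {V L : ℕ} {lam : ℝ} {s : RAMState}
    (h10 : s.reg 10 = (V : ℝ)) (h7 : s.reg 7 = (L : ℝ)) (hV : 0 < V) (hL : 0 < L) (hl : 0 ≤ lam)
    (hG : ExpTable 12 V L lam s) :
    Runs squareProg s (2 + (V + 1) * ((2 + (L + 1) * ((2 + (L + 1) * 32) + 7)) + 7))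
      (ExpTable 11 V (L * L) (lam ^ 2)) := by
  obtain ⟨G, g, g1, g2, g3⟩ := hG
  have : Nonempty (Fin V) := ⟨⟨0, hV⟩⟩
  have : Nonempty (Fin L) := ⟨⟨0, hL⟩⟩
  have hGV : ∀ v < V, ∀ l < L, G v l < V := by
    intro v hv l hl
    rw [← g2 ⟨l, hl⟩ ⟨v, hv⟩]
    exact (g _ _).2
  suffices hs : Runs squareProg s (2 + (V + 1) * ((2 + (L + 1) * ((2 + (L + 1) * 32) + 7)) + 7))
      (PairTable 11 V (L * L) (fun v l => G (G v (l / L)) (l % L))) by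
    refine hs.mono le_rfl fun s' _ h' =>
      ⟨_, _, (g1.comp hl).congr finProdFinEquiv.symm (Equiv.refl _), ?_, h'⟩
    intro l u
    obtain ⟨l1, l2⟩ := finProdFinEquiv_symm_val l
    simp only [← l1, ← l2, ← g2]
    rfl
  have hm := Prefix.forLoop (k := 11) (n := 0) (c := L * L) (i := 20) (r := 10) (s := s)
    (N := V) (T := 2 + (L + 1) * ((2 + (L + 1) * 32) + 7))
    (F := fun t => G (G (t / (L * L)) (t % (L * L) / L)) (t % (L * L) % L))
    (p := .forLoop 21 7 (.forLoop 22 7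
    (.put 11 ((.var 20 * .var 7 + .var 21) * .var 7 + .var 22)
      (.get 12 (.get 12 (.var 20 * .var 7 + .var 21) * .var 7 + .var 22))))) .zero h10
      (by decide) (by decide) (by decide) ?_
  · rw [zero_add] at hm
    exact hm.mono le_rfl fun s' _ h => h.pairTable
  intro v hv s1 hs1 h20 h
  have e7 : s1.reg 7 = (L : ℝ) := (hs1.reg 7 (by decide)).trans h7
  rw [show 0 + (v + 1) * (L * L) = (0 + v * (L * L)) + L * L by ring]
  refine Prefix.forLoop h e7 (by decide) (by decide) (by decide) ?_
  intro a ha s2 hs2 h21 h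
  have f7 : s2.reg 7 = (L : ℝ) := (hs2.reg 7 (by decide)).trans e7
  rw [show 0 + v * (L * L) + (a + 1) * L = (0 + v * (L * L) + a * L) + L * 1 by ring]
  refine Prefix.forLoop (T := 25) h f7 (by decide) (by decide) (by decide) ?_
  intro b hb s3 hs3 h22 h
  have i7 : s3.reg 7 = (L : ℝ) := (hs3.reg 7 (by decide)).trans f7
  have i21 : s3.reg 21 = (a : ℝ) := (hs3.reg 21 (by decide)).trans h21
  have i20 : s3.reg 20 = (v : ℝ) := by
    rw [hs3.reg 20 (by decide), hs2.reg 20 (by decide), h20]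
  have iG : PairTable 12 V L G s3 := g3.congr (by
    rw [hs3.arr 12 (by decide), hs2.arr 12 (by decide), hs1.arr 12 (by decide)])
  have e1 : (v : ℝ) * L + a = ((v * L + a : ℕ) : ℝ) := by push_cast; rfl
  have e2 : (G v a : ℝ) * L + b = ((G v a * L + b : ℕ) : ℝ) := by push_cast; rfl
  have e3 : ((v * L + a : ℕ) : ℝ) * L + b = ((0 + v * (L * L) + a * L + b * 1 : ℕ) : ℝ) := by
    push_cast; ring
  refine Runs.of_wp ?_ (Nat.le_of_ble_eq_true rfl)
  simp only [Stmt.wp, RExpr.ok_get, RExpr.ok_add, RExpr.ok_mul, RExpr.ok_var, RExpr.eval_add,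
    RExpr.eval_mul, RExpr.eval_var, i20, i21, i7, h22, e1, e2, e3, Nat.floor_natCast,
    true_and, RExpr.eval_get, iG v hv a ha, iG _ (hGV v hv a ha) b hb]
  rw [show 0 + v * (L * L) + a * L + (b + 1) * 1 = (0 + v * (L * L) + a * L + b * 1) + 1 by ring]
  refine h.put ?_
  have hab : a * L + b < L * L := mul_add_lt_mul ha hb
  rw [show 0 + v * (L * L) + a * L + b * 1 = v * (L * L) + (a * L + b) by ring]
  simp only [mul_add_div_eq hab, mul_add_mod_eq hab, mul_add_div_eq hb, mul_add_mod_eq hb]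

/-- Array `11` becomes the family of rotations. -/
def rotationProg : Stmt :=
  .forLoop 20 10 (.set 31 (.var 20) ;; .forLoop 21 11
    (.put 11 (.var 20 * .var 11 + .var 21) (.var 31) ;; .set 31 (.var 31 + 1) ;;
      .ite (.var 31) (.var 10) .skip (.set 31 0)))

/-- A counter reset at `V` replaces the reduction of v + x modulo `V`. -/
theorem rotationProg_runs {V X : ℕ} {s : RAMState} (h10 : s.reg 10 = (V : ℝ))
    (h11 : s.reg 11 = (X : ℝ)) (hV : 0 < V) (hX : 0 < X) :
    Runs rotationProg s (2 + (V + 1) * ((2 + (2 + (X + 1) * 27)) + 7))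
      (ExpTable 11 V X (V / X)) := by
  have : NeZero V := ⟨hV.ne'⟩
  suffices hs : Runs rotationProg s (2 + (V + 1) * ((2 + (2 + (X + 1) * 27)) + 7))
      (PairTable 11 V X (fun v x => (v + x) % V)) by
    refine hs.mono le_rfl fun s' _ h' => ⟨_, _, isExp_rotation V X hX, ?_, h'⟩
    intro l v
    simp [Fin.val_add]
  have hm := Prefix.forLoop (k := 11) (n := 0) (c := X) (i := 20) (r := 10) (s := s)
    (N := V) (T := 2 + (2 + (X + 1) * 27)) (F := fun t => (t / X + t % X) % V)
    (p := .set 31 (.var 20) ;; .forLoop 21 11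
    (.put 11 (.var 20 * .var 11 + .var 21) (.var 31) ;; .set 31 (.var 31 + 1) ;;
      .ite (.var 31) (.var 10) .skip (.set 31 0))) .zero h10
      (by decide) (by decide) (by decide) ?_
  · rw [zero_add] at hm
    exact hm.mono le_rfl fun s' _ h => h.pairTable
  intro v hv s1 hs1 h20 h
  refine Runs.seq (Runs.of_wp ⟨trivial, ?_⟩ (Nat.le_of_ble_eq_true rfl))
  set s2 := s1.setReg 31 _ with hs2
  refine (Runs.forLoop (N := X) (T := 20) (fun x s' => s'.reg 31 = (((v + x) % V : ℕ) : ℝ) ∧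
    Prefix 11 (v * X + x) (fun t => (t / X + t % X) % V) s') ?_
    (by decide) (by decide) (by decide) ?_ ?_).mono le_rfl fun s' _ h' => ?_
  · rw [hs2, RAMState.reg_setReg, if_neg (by decide), hs1.reg 11 (by decide), h11]
  · refine ⟨?_, ?_⟩
    · simp [hs2, h20, Nat.mod_eq_of_lt hv]
    · have := h.congr (s' := s2.setReg 21 0) rfl
      rwa [zero_add] at this
  · rintro x hx s3 hs3 h21 ⟨h31, hP⟩
    have i20 : s3.reg 20 = (v : ℝ) := by
      rw [hs3.reg 20 (by decide), hs2, RAMState.reg_setReg, if_neg (by decide), h20]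
    have i10 : s3.reg 10 = (V : ℝ) := by
      rw [hs3.reg 10 (by decide), hs2, RAMState.reg_setReg, if_neg (by decide),
        hs1.reg 10 (by decide), h10]
    have i11 : s3.reg 11 = (X : ℝ) := by
      rw [hs3.reg 11 (by decide), hs2, RAMState.reg_setReg, if_neg (by decide),
        hs1.reg 11 (by decide), h11]
    have e1 : (v : ℝ) * X + x = ((v * X + x : ℕ) : ℝ) := by push_cast; rfl
    have e2 : (((v + x) % V : ℕ) : ℝ) + 1 = (((v + x) % V + 1 : ℕ) : ℝ) := by push_cast; rfl
    have hP' := hP.put (v := (((v + x) % V : ℕ) : ℝ))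
      (by simp only [mul_add_div_eq hx, mul_add_mod_eq hx])
    have hlt := Nat.mod_lt (v + x) hV
    refine Runs.of_wp ?_ (Nat.le_of_ble_eq_true rfl)
    simp only [Stmt.wp, RExpr.ok_add, RExpr.ok_mul, RExpr.ok_var, RExpr.eval_add, RExpr.ok_one,
      RExpr.ok_zero, RExpr.eval_mul, RExpr.eval_var, i20, i10, i11, h21, h31, e1, e2,
      Nat.floor_natCast, true_and, RExpr.eval_one, RExpr.eval_zero, RAMState.reg_setReg,
      RAMState.reg_setArr, if_true, Nat.reduceEqDiff, if_false, Nat.cast_lt, ← add_assoc]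
    constructor
    · intro hc
      refine ⟨?_, hP'.congr (by simp)⟩
      rw [← Nat.mod_add_mod (v + x), Nat.mod_eq_of_lt hc]
    · intro hc
      refine ⟨?_, hP'.congr (by simp)⟩
      rw [← Nat.mod_add_mod (v + x), show (v + x) % V + 1 = V by omega, Nat.mod_self, Nat.cast_zero]
  · rw [zero_add, add_mul, one_mul]
    exact h'.2.2

/-! ### Distribution of the weights over cells -/

/-- The function with the values `x, y, z, z, …`. -/
def triple {α : Type} (x y z : α) : ℕ → α
  | 0 => x
  | 1 => y
  | _ => z

/-- The items below `p` are split into `ns` items of weight less than `w` and `nb` others. -/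
structure IsSplit (p : ℕ) (w : ℝ) (val : ℕ → ℝ) (ns nb : ℕ) (σ β : ℕ → ℕ) : Prop where
  small_lt : ∀ j < ns, σ j < p
  small_val : ∀ j < ns, val (σ j) < w
  big_lt : ∀ j < nb, β j < p
  big_val : ∀ j < nb, w ≤ val (β j)
  count : ns + nb = p
  total : ∀ f : ℕ → ℝ, ∑ j ∈ Finset.range ns, val (σ j) * f (σ j) +
    ∑ j ∈ Finset.range nb, val (β j) * f (β j) = ∑ k ∈ Finset.range p, val k * f k

/-- The weights are distributed over `M` cells of weight `w`. -/
structure IsFilling (p M : ℕ) (w : ℝ) (val : ℕ → ℝ) (I : ℕ → ℕ → ℕ) (W : ℕ → ℕ → ℝ) : Prop where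
  sum_eq : ∀ u < M, ∑ c ∈ Finset.range 3, W u c = w
  total : ∀ f : ℕ → ℝ, ∑ u ∈ Finset.range M, ∑ c ∈ Finset.range 3, W u c * f (I u c) =
    ∑ k ∈ Finset.range p, val k * f k

/-- The state of the distribution after `u` cells: the small items from `u` on and the big items
after `kb` are left, and the weight `rem` of the big item `kb`. -/
structure PartialFilling (p : ℕ) (w : ℝ) (val : ℕ → ℝ) (ns nb : ℕ) (σ β : ℕ → ℕ) (u kb : ℕ)
    (rem : ℝ) (I : ℕ → ℕ → ℕ) (W : ℕ → ℕ → ℝ) : Prop where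
  lt : kb < nb
  rem_nonneg : 0 ≤ rem
  sum_eq : ∀ v < u, ∑ c ∈ Finset.range 3, W v c = w
  total : ∀ f : ℕ → ℝ, ∑ v ∈ Finset.range u, ∑ c ∈ Finset.range 3, W v c * f (I v c) +
    ∑ j ∈ Finset.Ico u ns, val (σ j) * f (σ j) + rem * f (β kb) +
    ∑ j ∈ Finset.Ico (kb + 1) nb, val (β j) * f (β j) = ∑ k ∈ Finset.range p, val k * f k

section filling

variable {p M : ℕ} {w : ℝ} {val : ℕ → ℝ} {ns nb : ℕ} {σ β : ℕ → ℕ} {u kb : ℕ} {rem : ℝ}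
  {I : ℕ → ℕ → ℕ} {W : ℕ → ℕ → ℝ}

theorem sum_range_three_triple (x y z : ℝ) : ∑ c ∈ Finset.range 3, triple x y z c = x + y + z := by
  simp [Finset.sum_range_succ, triple]

/-- Conservation of the total weight, from the test function 1. It excludes running out of big items
and shows that nothing is left at the end. -/
theorem PartialFilling.mass (h : PartialFilling p w val ns nb σ β u kb rem I W)
    (hsum : ∑ k ∈ Finset.range p, val k = M * w) :
    u * w + ∑ j ∈ Finset.Ico u ns, val (σ j) + rem + ∑ j ∈ Finset.Ico (kb + 1) nb, val (β j) =
      M * w := by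
  have := h.total fun _ => 1
  simp only [mul_one] at this
  rw [← hsum, ← this, Finset.sum_congr rfl fun v hv => h.sum_eq v (Finset.mem_range.1 hv)]
  simp

/-- At most `M` items, all lighter than `w`, cannot have the total weight M * w. -/
theorem IsSplit.big_pos (hs : IsSplit p w val ns nb σ β) (hw : 0 < w) (hM : 0 < M) (hpM : p ≤ M)
    (hsum : ∑ k ∈ Finset.range p, val k = M * w) : 0 < nb := by
  by_contra hb
  have hb : nb = 0 := by omega
  subst hb
  have h1 := hs.total fun _ => 1
  simp only [mul_one, Finset.range_zero, Finset.sum_empty, add_zero, hsum] at h1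
  have hc := hs.count
  rcases Nat.eq_zero_or_pos ns with h0 | h0
  · rw [h0, Finset.range_zero, Finset.sum_empty] at h1
    have : (0 : ℝ) < M * w := by positivity
    linarith
  · have h2 : ∑ j ∈ Finset.range ns, val (σ j) < ∑ j ∈ Finset.range ns, w :=
      Finset.sum_lt_sum_of_nonempty ⟨0, Finset.mem_range.2 h0⟩
        fun j hj => hs.small_val j (Finset.mem_range.1 hj)
    rw [Finset.sum_const, Finset.card_range, nsmul_eq_mul] at h2
    have h3 : (ns : ℝ) * w ≤ M * w := by
      have : (ns : ℝ) ≤ M := by exact_mod_cast (by omega : ns ≤ M)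
      exact mul_le_mul_of_nonneg_right this hw.le
    linarith

theorem IsSplit.partialFilling (hs : IsSplit p w val ns nb σ β) (hw : 0 < w) (hM : 0 < M)
    (hpM : p ≤ M) (hsum : ∑ k ∈ Finset.range p, val k = M * w) :
    PartialFilling p w val ns nb σ β 0 0 (val (β 0)) I W := by
  have hb := hs.big_pos hw hM hpM hsum
  refine ⟨hb, hw.le.trans (hs.big_val 0 hb), fun v hv => absurd hv (Nat.not_lt_zero v), fun f => ?_⟩
  rw [← hs.total f, Finset.range_zero, Finset.sum_empty, zero_add, Finset.range_eq_Ico,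
    Finset.range_eq_Ico, Finset.sum_eq_sum_Ico_succ_bot hb]
  ring

/-- After `M ≥ p` cells every small item has been placed, and the cells already carry the whole
weight M * w. So the remainder is 0, and no big item is left, since it would weigh at least `w > 0`.
-/
theorem PartialFilling.isFilling (h : PartialFilling p w val ns nb σ β M kb rem I W)
    (hs : IsSplit p w val ns nb σ β) (hw : 0 < w) (hpM : p ≤ M)
    (hsum : ∑ k ∈ Finset.range p, val k = M * w) : IsFilling p M w val I W := by
  refine ⟨h.sum_eq, fun f => ?_⟩
  have hc := hs.count
  have hI : Finset.Ico M ns = ∅ := Finset.Ico_eq_empty (by omega)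
  have hm := h.mass hsum
  have ht := h.total f
  rw [hI, Finset.sum_empty, add_zero] at hm ht
  have h0 : 0 ≤ ∑ j ∈ Finset.Ico (kb + 1) nb, val (β j) := Finset.sum_nonneg fun j hj =>
    hw.le.trans (hs.big_val j (Finset.mem_Ico.1 hj).2)
  have hr : rem = 0 := by linarith [h.rem_nonneg]
  have he : Finset.Ico (kb + 1) nb = ∅ := by
    by_contra hne
    have : 0 < ∑ j ∈ Finset.Ico (kb + 1) nb, val (β j) :=
      Finset.sum_pos (fun j hj => hw.trans_le (hs.big_val j (Finset.mem_Ico.1 hj).2))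
        (Finset.nonempty_iff_ne_empty.2 hne)
    linarith [h.rem_nonneg]
  rw [he, Finset.sum_empty, hr, zero_mul, add_zero, add_zero] at ht
  exact ht

theorem sum_range_succ_update {α γ : Type} {n : ℕ} (F : α → γ → ℝ) (I : ℕ → α) (W : ℕ → γ) (x : α)
    (y : γ) : ∑ v ∈ Finset.range (n + 1), F (Function.update I n x v) (Function.update W n y v) =
      ∑ v ∈ Finset.range n, F (I v) (W v) + F x y := by
  rw [Finset.sum_range_succ, Function.update_self, Function.update_self]
  congr 1
  refine Finset.sum_congr rfl fun v hv => ?_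
  rw [Function.update_of_ne (Finset.mem_range.1 hv).ne,
    Function.update_of_ne (Finset.mem_range.1 hv).ne]

/-- Here `x` is the weight of the small item given to the cell `u`, with x = 0 once the small items
are used up. Both situations are then treated alike. -/
theorem sum_Ico_peel {i : ℕ} {x : ℝ} (hi : u < ns → i = σ u ∧ x = val (σ u))
    (hi' : ¬ u < ns → x = 0) (f : ℕ → ℝ) : ∑ j ∈ Finset.Ico u ns, val (σ j) * f (σ j) =
      x * f i + ∑ j ∈ Finset.Ico (u + 1) ns, val (σ j) * f (σ j) := by
  by_cases h : u < ns
  · rw [Finset.sum_eq_sum_Ico_succ_bot h, (hi h).1, (hi h).2]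
  · rw [hi' h, Finset.Ico_eq_empty (by omega), Finset.Ico_eq_empty (by omega)]
    simp

/-- The current big item suffices to top up the cell; the third piece is a dummy of weight 0. -/
theorem PartialFilling.step_ge (h : PartialFilling p w val ns nb σ β u kb rem I W) {i : ℕ} {x : ℝ}
    (hi : u < ns → i = σ u ∧ x = val (σ u)) (hi' : ¬ u < ns → x = 0) (hr : w - x ≤ rem) :
    PartialFilling p w val ns nb σ β (u + 1) kb (rem - (w - x))
      (Function.update I u (triple i (β kb) (β kb)))
      (Function.update W u (triple x (w - x) 0)) := by
  refine ⟨h.lt, by linarith, fun v hv => ?_, fun f => ?_⟩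
  · rcases Nat.lt_succ_iff_lt_or_eq.1 hv with hv | rfl
    · rw [Function.update_of_ne hv.ne]; exact h.sum_eq v hv
    · rw [Function.update_self, sum_range_three_triple]; ring
  · rw [← h.total f, sum_Ico_peel hi hi' f,
      sum_range_succ_update fun (i : ℕ → ℕ) (y : ℕ → ℝ) =>
        ∑ c ∈ Finset.range 3, y c * f (i c)]
    simp only [Finset.sum_range_succ, Finset.range_zero, Finset.sum_empty, triple]
    ring

/-- If no further big item were left, the weight outside the filled cells would be less than `w` for
this cell plus at most `w` for each later small item. With the `u` full cells this is less than
max(u + 1, ns) * w ≤ M * w, which contradicts conservation. -/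
theorem PartialFilling.succ_lt (h : PartialFilling p w val ns nb σ β u kb rem I W)
    (hs : IsSplit p w val ns nb σ β) {i : ℕ} {x : ℝ}
    (hi : u < ns → i = σ u ∧ x = val (σ u)) (hi' : ¬ u < ns → x = 0) (hr : rem < w - x)
    (hw : 0 < w) (hpM : p ≤ M) (hu : u < M) (hsum : ∑ k ∈ Finset.range p, val k = M * w) :
    kb + 1 < nb := by
  by_contra hb
  have hm := h.mass hsum
  have hpeel := sum_Ico_peel hi hi' fun _ => 1
  simp only [mul_one] at hpeel
  rw [hpeel, Finset.Ico_eq_empty (a := kb + 1) hb, Finset.sum_empty] at hm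
  have h1 : ∑ j ∈ Finset.Ico (u + 1) ns, val (σ j) ≤ ∑ j ∈ Finset.Ico (u + 1) ns, w :=
    Finset.sum_le_sum fun j hj => (hs.small_val j (Finset.mem_Ico.1 hj).2).le
  rw [Finset.sum_const, Nat.card_Ico, nsmul_eq_mul] at h1
  have hc := hs.count
  have h2 : ((u + 1 + (ns - (u + 1)) : ℕ) : ℝ) * w ≤ M * w := by
    have : ((u + 1 + (ns - (u + 1)) : ℕ) : ℝ) ≤ M := by
      exact_mod_cast (by omega : u + 1 + (ns - (u + 1)) ≤ M)
    exact mul_le_mul_of_nonneg_right this hw.le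
  push_cast at h2
  linarith

/-- The current big item is used up and the next one fills the gap. It suffices because it weighs at
least `w`, so three pieces are always enough. -/
theorem PartialFilling.step_lt (h : PartialFilling p w val ns nb σ β u kb rem I W)
    (hs : IsSplit p w val ns nb σ β) {i : ℕ} {x : ℝ} (hx : 0 ≤ x)
    (hi : u < ns → i = σ u ∧ x = val (σ u)) (hi' : ¬ u < ns → x = 0)
    (hb : kb + 1 < nb) :
    PartialFilling p w val ns nb σ β (u + 1) (kb + 1) (val (β (kb + 1)) - (w - x - rem))
      (Function.update I u (triple i (β kb) (β (kb + 1))))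
      (Function.update W u (triple x rem (w - x - rem))) := by
  refine ⟨hb, by linarith [hs.big_val _ hb, h.rem_nonneg], fun v hv => ?_, fun f => ?_⟩
  · rcases Nat.lt_succ_iff_lt_or_eq.1 hv with hv | rfl
    · rw [Function.update_of_ne hv.ne]; exact h.sum_eq v hv
    · rw [Function.update_self, sum_range_three_triple]; ring
  · rw [← h.total f, sum_Ico_peel hi hi' f, Finset.sum_eq_sum_Ico_succ_bot hb,
      sum_range_succ_update fun (i : ℕ → ℕ) (y : ℕ → ℝ) =>
        ∑ c ∈ Finset.range 3, y c * f (i c)]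
    simp only [Finset.sum_range_succ, Finset.range_zero, Finset.sum_empty, triple]
    ring

end filling

theorem CellTable.snoc {kI kW u p i0 i1 i2 : ℕ} {I : ℕ → ℕ → ℕ} {W : ℕ → ℕ → ℝ} {w0 w1 w2 : ℝ}
    {s s' : RAMState} (h : CellTable kI kW u p I W s)
    (hI : s'.arr kI = Function.update (Function.update (Function.update (s.arr kI) (3 * u) i0)
      (3 * u + 1) i1) (3 * u + 2) i2)
    (hW : s'.arr kW = Function.update (Function.update (Function.update (s.arr kW) (3 * u) w0)
      (3 * u + 1) w1) (3 * u + 2) w2) (h0 : i0 < p) (h1 : i1 < p) (h2 : i2 < p) (hw0 : 0 ≤ w0)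
    (hw1 : 0 ≤ w1) (hw2 : 0 ≤ w2) :
    CellTable kI kW (u + 1) p (Function.update I u (triple i0 i1 i2))
      (Function.update W u (triple w0 w1 w2)) s' := by
  have hne : ∀ v < u, ∀ c < 3, 3 * v + c ≠ 3 * u ∧ 3 * v + c ≠ 3 * u + 1 ∧ 3 * v + c ≠ 3 * u + 2 :=
    fun v hv c hc => by omega
  constructor
  all_goals
    intro v hv c hc
    rcases Nat.lt_succ_iff_lt_or_eq.1 hv with hv | rfl
  · obtain ⟨e0, e1, e2⟩ := hne v hv c hc
    rw [hI, Function.update_of_ne e2, Function.update_of_ne e1, Function.update_of_ne e0,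
      Function.update_of_ne hv.ne]
    exact h.owner v hv c hc
  · rw [hI, Function.update_self]
    interval_cases c <;> simp [triple]
  · obtain ⟨e0, e1, e2⟩ := hne v hv c hc
    rw [hW, Function.update_of_ne e2, Function.update_of_ne e1, Function.update_of_ne e0,
      Function.update_of_ne hv.ne]
    exact h.weight v hv c hc
  · rw [hW, Function.update_self]
    interval_cases c <;> simp [triple]
  · rw [Function.update_of_ne hv.ne]; exact h.lt v hv c hc
  · rw [Function.update_self]; interval_cases c <;> assumption
  · rw [Function.update_of_ne hv.ne]; exact h.nonneg v hv c hc
  · rw [Function.update_self]; interval_cases c <;> assumption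

/-! ### The program that fills the cells. -/

/-- Split the items in array `kV` into the small ones, listed in array `13`, and the big ones,
listed in array `14`. -/
def splitProg (kV rp : ℕ) : Stmt :=
  .set 31 0 ;; .set 32 0 ;; .forLoop 20 rp (.ite (.get kV (.var 20)) (.var 16)
    (.put 13 (.var 31) (.var 20) ;; .set 31 (.var 31 + 1))
    (.put 14 (.var 32) (.var 20) ;; .set 32 (.var 32 + 1)))

theorem splitProg_runs {kV rp p : ℕ} {w : ℝ} {s : RAMState} (hrp : s.reg rp = (p : ℝ))
    (hrp' : rp ∉ [20, 31, 32]) (hkV : kV ∉ [13, 14]) (h16 : s.reg 16 = w) :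
    Runs (splitProg kV rp) s (6 + (p + 1) * 27) (fun s' => ∃ ns nb σ β,
      IsSplit p w (s.arr kV) ns nb σ β ∧ s'.reg 31 = (ns : ℝ) ∧ s'.reg 32 = (nb : ℝ) ∧
      Prefix 13 ns σ s' ∧ Prefix 14 nb β s') := by
  simp only [List.mem_cons, List.not_mem_nil, or_false, not_or] at hrp' hkV
  refine Runs.mono (T := 2 + (2 + (2 + (p + 1) * (20 + 7)))) (Runs.seq (T := 2) ?_) (by omega)
    fun _ _ h => h
  refine Runs.of_wp ⟨trivial, ?_⟩ (Nat.le_of_ble_eq_true rfl)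
  refine Runs.seq (T := 2) (Runs.of_wp ⟨trivial, ?_⟩ (Nat.le_of_ble_eq_true rfl))
  refine (Runs.forLoop (N := p) (T := 20) (fun k s' => ∃ ns nb σ β,
      IsSplit k w (s.arr kV) ns nb σ β ∧ s'.reg 31 = (ns : ℝ) ∧ s'.reg 32 = (nb : ℝ) ∧
      Prefix 13 ns σ s' ∧ Prefix 14 nb β s') (by simp [hrp', hrp]) hrp'.1
    (by simp [Stmt.wreg, hrp']) (by simp [Stmt.wreg]) ?_ ?_).mono le_rfl fun _ _ h => h.2
  · refine ⟨0, 0, id, id, ?_, by simp, by simp, .zero, .zero⟩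
    constructor <;> simp
  rintro k hk s' hs h20 ⟨ns, nb, σ, β, hsp, h31, h32, h13, h14⟩
  have e16 : s'.reg 16 = w := by rw [hs.reg 16 (by simp [Stmt.wreg])]; simpa using h16
  have eV : s'.arr kV k = s.arr kV k := by
    rw [hs.arr kV (by simp [Stmt.warr, hkV])]; rfl
  refine Runs.of_wp ?_ (Nat.le_of_ble_eq_true rfl)
  have e31 : (ns : ℝ) + 1 = ((ns + 1 : ℕ) : ℝ) := by push_cast; rfl
  have e32 : (nb : ℝ) + 1 = ((nb + 1 : ℕ) : ℝ) := by push_cast; rfl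
  simp only [Stmt.wp, RExpr.ok_get, RExpr.ok_var, RExpr.ok_add, RExpr.ok_one, RExpr.eval_var,
    RExpr.eval_add, RExpr.eval_one, RExpr.eval_get, h20, h31, h32, Nat.floor_natCast, true_and,
    RAMState.reg_setReg, RAMState.reg_setArr, if_true, Nat.reduceEqDiff, if_false, e16, e31, e32,
    eV]
  have hc := hsp.count
  constructor
  · intro hlt
    refine ⟨ns + 1, nb, Function.update σ ns k, β, ?_, rfl, rfl, ?_, h14.congr (by simp)⟩
    · have hne : ∀ j < ns, Function.update σ ns k j = σ j :=
        fun j hj => Function.update_of_ne hj.ne _ _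
      refine ⟨fun j hj => ?_, fun j hj => ?_, fun j hj => (hsp.big_lt j hj).trans k.lt_succ_self,
        hsp.big_val, by omega, fun f => ?_⟩
      · rcases Nat.lt_succ_iff_lt_or_eq.1 hj with hj | rfl
        · rw [hne j hj]; exact (hsp.small_lt j hj).trans k.lt_succ_self
        · simp
      · rcases Nat.lt_succ_iff_lt_or_eq.1 hj with hj | rfl
        · rw [hne j hj]; exact hsp.small_val j hj
        · simpa using hlt
      · rw [Finset.sum_range_succ, Finset.sum_range_succ, ← hsp.total f, Function.update_self,
          Finset.sum_congr rfl fun j hj => by rw [hne j (Finset.mem_range.1 hj)]]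
        ring
    · have := Prefix.put (k := 13) (n := ns) (F := Function.update σ ns k) (s := s')
        (fun j hj => by rw [h13 j hj, Function.update_of_ne hj.ne]) (v := (k : ℝ)) (by simp)
      exact this.congr rfl
  · intro hlt
    refine ⟨ns, nb + 1, σ, Function.update β nb k, ?_, rfl, rfl, h13.congr (by simp), ?_⟩
    · have hne : ∀ j < nb, Function.update β nb k j = β j :=
        fun j hj => Function.update_of_ne hj.ne _ _
      refine ⟨fun j hj => (hsp.small_lt j hj).trans k.lt_succ_self, hsp.small_val,
        fun j hj => ?_, fun j hj => ?_, by omega, fun f => ?_⟩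
      · rcases Nat.lt_succ_iff_lt_or_eq.1 hj with hj | rfl
        · rw [hne j hj]; exact (hsp.big_lt j hj).trans k.lt_succ_self
        · simp
      · rcases Nat.lt_succ_iff_lt_or_eq.1 hj with hj | rfl
        · rw [hne j hj]; exact hsp.big_val j hj
        · simpa using hlt
      · rw [Finset.sum_range_succ, Finset.sum_range_succ, ← hsp.total f, Function.update_self,
          Finset.sum_congr (f := fun j => s.arr kV (Function.update β nb k j) * _) rfl
            fun j hj => by rw [hne j (Finset.mem_range.1 hj)]]
        ring
    · have := Prefix.put (k := 14) (n := nb) (F := Function.update β nb k) (s := s')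
        (fun j hj => by rw [h14 j hj, Function.update_of_ne hj.ne]) (v := (k : ℝ)) (by simp)
      exact this.congr rfl

/-- Fill one cell. -/
def fillCell (kV kI kW : ℕ) : Stmt :=
  .set 35 (3 * .var 20) ;;
    .ite (.var 20) (.var 31) (.set 36 (.get 13 (.var 20)) ;; .set 37 (.get kV (.var 36)))
      (.set 36 0 ;; .set 37 0) ;;
    .put kI (.var 35) (.var 36) ;; .put kW (.var 35) (.var 37) ;;
    .set 38 (.var 16 - .var 37) ;; .set 39 (.get 14 (.var 33)) ;;
    .put kI (.var 35 + 1) (.var 39) ;;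
    .ite (.var 34) (.var 38)
      (.put kW (.var 35 + 1) (.var 34) ;; .set 33 (.var 33 + 1) ;; .set 39 (.get 14 (.var 33)) ;;
        .set 38 (.var 38 - .var 34) ;; .set 34 (.get kV (.var 39) - .var 38))
      (.put kW (.var 35 + 1) (.var 38) ;; .set 34 (.var 34 - .var 38) ;; .set 38 0) ;;
    .put kI (.var 35 + 2) (.var 39) ;; .put kW (.var 35 + 2) (.var 38)

/-- Fill all cells. -/
def fillProg (kV rp kI kW : ℕ) : Stmt :=
  splitProg kV rp ;; .set 33 0 ;; .set 34 (.get kV (.get 14 0)) ;;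
    .forLoop 20 10 (fillCell kV kI kW)

theorem fillCell_runs {kV kI kW p M ns nb u kb : ℕ} {w rem : ℝ} {val : ℕ → ℝ} {σ β : ℕ → ℕ}
    {I : ℕ → ℕ → ℕ} {W : ℕ → ℕ → ℝ} {s : RAMState} (hd : [13, 14, kV, kI, kW].Nodup)
    (hsp : IsSplit p w val ns nb σ β) (hP : PartialFilling p w val ns nb σ β u kb rem I W)
    (hT : CellTable kI kW u p I W s) (hval : ∀ k < p, 0 ≤ val k) (hV : s.arr kV = val)
    (hw : 0 < w) (hpM : p ≤ M) (hu : u < M) (hsum : ∑ k ∈ Finset.range p, val k = M * w)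
    (h13 : Prefix 13 ns σ s) (h14 : Prefix 14 nb β s) (h31 : s.reg 31 = (ns : ℝ))
    (h33 : s.reg 33 = (kb : ℝ)) (h34 : s.reg 34 = rem) (h20 : s.reg 20 = (u : ℝ))
    (h16 : s.reg 16 = w) :
    Runs (fillCell kV kI kW) s 100 (fun s' => ∃ kb rem I W,
      PartialFilling p w val ns nb σ β (u + 1) kb rem I W ∧ CellTable kI kW (u + 1) p I W s' ∧
      s'.reg 33 = (kb : ℝ) ∧ s'.reg 34 = rem) := by
  simp only [List.nodup_cons, List.mem_cons, List.not_mem_nil, or_false, not_or,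
    not_false_eq_true, List.nodup_nil, and_true] at hd
  obtain ⟨⟨-, d1, d2, d3⟩, ⟨d4, d5, d6⟩, ⟨d7, d8⟩, d9⟩ := hd
  have e35 : (3 : ℝ) * u = ((3 * u : ℕ) : ℝ) := by push_cast; rfl
  have e1 : ((3 * u : ℕ) : ℝ) + 1 = ((3 * u + 1 : ℕ) : ℝ) := by push_cast; rfl
  have e2 : ((3 * u : ℕ) : ℝ) + 2 = ((3 * u + 2 : ℕ) : ℝ) := by push_cast; rfl
  have hp : 0 < p := by have := hsp.count; have := hP.lt; omega
  have e33 : (kb : ℝ) + 1 = ((kb + 1 : ℕ) : ℝ) := by push_cast; rfl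
  refine Runs.mono (T := 4 + (13 + 83)) (Runs.seq (T := 4) (Runs.of_wp
    (Q := fun s' => s' = s.setReg 35 ((3 * u : ℕ) : ℝ)) ?_
    (Nat.le_of_ble_eq_true rfl) |>.mono le_rfl ?_)) (by norm_num) fun _ _ h => h
  · simp [Stmt.wp, h20]
  rintro s1 - rfl
  have key : Runs (.ite (.var 20) (.var 31) (.set 36 (.get 13 (.var 20)) ;;
      .set 37 (.get kV (.var 36))) (.set 36 0 ;; .set 37 0))
      (s.setReg 35 ((3 * u : ℕ) : ℝ)) 13 (fun s' => ∃ (i : ℕ) (x : ℝ),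
        s' = ((s.setReg 35 ((3 * u : ℕ) : ℝ)).setReg 36 i).setReg 37 x ∧
        (u < ns → i = σ u ∧ x = val (σ u)) ∧ (¬ u < ns → x = 0) ∧ i < p ∧ 0 ≤ x ∧ x ≤ w) := by
    refine Runs.of_wp ?_ (Nat.le_of_ble_eq_true rfl)
    simp only [Stmt.wp, RExpr.ok_get, RExpr.ok_var, RExpr.ok_zero, RExpr.eval_var, RExpr.eval_zero,
      RExpr.eval_get, RAMState.reg_setReg, RAMState.arr_setReg, Nat.reduceEqDiff, if_false, if_true,
      h20, h31, Nat.floor_natCast, true_and, Nat.cast_lt]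
    constructor
    · intro hlt
      simp only [h13 u hlt, Nat.floor_natCast, true_and, hV]
      exact ⟨σ u, _, rfl, fun _ => ⟨rfl, rfl⟩, fun h => absurd hlt h, hsp.small_lt u hlt,
        hval _ (hsp.small_lt u hlt), (hsp.small_val u hlt).le⟩
    · intro hlt
      -- When the small items are used up, the first piece is a dummy: owner 0, a valid position
      -- because p > 0, and weight 0.
      refine ⟨0, 0, by simp, fun h => absurd h hlt, fun _ => rfl, hp, le_rfl, hw.le⟩
  refine Runs.andThen key ?_
  rintro s1 - ⟨i, x, rfl, hi, hi', hip, hx, hxw⟩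
  have n9 := Ne.symm d9
  refine Runs.of_wp ?_ (Nat.le_of_ble_eq_true rfl)
  simp only [Stmt.wp, RExpr.ok_get, RExpr.ok_var, RExpr.ok_zero, RExpr.ok_sub, RExpr.ok_add,
    RExpr.ok_one, RExpr.ok_ofNat, RExpr.eval_var, RExpr.eval_zero, RExpr.eval_sub, RExpr.eval_add,
    RExpr.eval_one, RExpr.eval_ofNat, RExpr.eval_get, RAMState.reg_setReg, RAMState.arr_setReg,
    RAMState.reg_setArr, RAMState.arr_setArr, Nat.reduceEqDiff, if_false, if_true, h33, h34, h16,
    Nat.floor_natCast, true_and, d5, d6, d7, d8, d9, n9, e1, e2, e33, h14 kb hP.lt, hV]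
  constructor
  · intro hr
    have hb := hP.succ_lt hsp hi hi' hr hw hpM hu hsum
    simp only [h14 _ hb, Nat.floor_natCast, true_and]
    refine ⟨kb + 1, _, _, _, hP.step_lt hsp hx hi hi' hb, hT.snoc ?_ ?_ hip (hsp.big_lt kb hP.lt)
      (hsp.big_lt _ hb) hx hP.rem_nonneg (by linarith), rfl, rfl⟩
    · simp [d9]
    · simp [n9]
  · intro hr
    refine ⟨kb, _, _, _, hP.step_ge hi hi' (not_lt.1 hr), hT.snoc ?_ ?_ hip (hsp.big_lt kb hP.lt)
      (hsp.big_lt kb hP.lt) hx (by linarith) le_rfl, rfl, rfl⟩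
    · simp [d9]
    · simp [n9]

theorem fillProg_runs {kV rp kI kW p M : ℕ} {w : ℝ} {s : RAMState}
    (hd : [13, 14, kV, kI, kW].Nodup) (hrp : s.reg rp = (p : ℝ)) (hrp' : rp ∉ [20, 31, 32])
    (hval : ∀ k < p, 0 ≤ s.arr kV k) (hw : 0 < w) (hM : 0 < M) (hpM : p ≤ M)
    (hsum : ∑ k ∈ Finset.range p, s.arr kV k = M * w) (h10 : s.reg 10 = (M : ℝ))
    (h16 : s.reg 16 = w) :
    Runs (fillProg kV rp kI kW) s (20 + (p + 1) * 27 + (M + 1) * 107) (fun s' => ∃ I W,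
      IsFilling p M w (s.arr kV) I W ∧ CellTable kI kW M p I W s') := by
  have hd' := hd
  simp only [List.nodup_cons, List.mem_cons, List.not_mem_nil, or_false, not_or,
    not_false_eq_true, List.nodup_nil, and_true] at hd'
  obtain ⟨⟨-, d1, d2, d3⟩, ⟨d4, d5, d6⟩, ⟨d7, d8⟩, d9⟩ := hd'
  refine Runs.mono (T := (6 + (p + 1) * 27) + (2 + (4 + (2 + (M + 1) * (100 + 7)))))
    (Runs.andThen (splitProg_runs hrp hrp' (by simp [Ne.symm d1, Ne.symm d4]) h16) ?_)
    (by omega) fun _ _ h => h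
  rintro s1 hs1 ⟨ns, nb, σ, β, hsp, h31, h32, h13, h14⟩
  have hb := hsp.big_pos hw hM hpM hsum
  have eV : s1.arr kV = s.arr kV :=
    hs1.arr kV (by simp [Ne.symm d1, Ne.symm d4, splitProg, Stmt.forLoop, Stmt.warr])
  refine Runs.seq (Runs.of_wp ⟨trivial, ?_⟩ (Nat.le_of_ble_eq_true rfl))
  refine Runs.seq (Runs.of_wp ?_ (Nat.le_of_ble_eq_true rfl))
  have e14 : s1.arr 14 0 = (β 0 : ℝ) := h14 0 hb
  simp only [Stmt.wp, RExpr.ok_get, RExpr.ok_zero, RExpr.eval_zero, RExpr.eval_get,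
    RAMState.arr_setReg, Nat.floor_zero, e14, Nat.floor_natCast, Nat.cast_zero, and_self, true_and,
    eV]
  set s2 := (s1.setReg 33 0).setReg 34 _ with hs2
  refine (Runs.forLoop (T := 100) (fun u s' => ∃ kb rem I W,
      PartialFilling p w (s.arr kV) ns nb σ β u kb rem I W ∧ CellTable kI kW u p I W s' ∧
      s'.reg 33 = (kb : ℝ) ∧ s'.reg 34 = rem) ?_ (by decide)
      (by simp [fillCell, Stmt.wreg]) (by simp [fillCell, Stmt.wreg]) ?_ ?_).mono le_rfl ?_
  · simp [hs2, hs1.reg 10 (by simp [splitProg, Stmt.forLoop, Stmt.wreg]), h10]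
  · refine ⟨0, _, fun _ _ => 0, fun _ _ => 0, hsp.partialFilling hw hM hpM hsum, ?_, by simp [hs2],
      by simp [hs2]⟩
    constructor <;> exact fun u hu => absurd hu (Nat.not_lt_zero u)
  · rintro u hu s3 hs3 h20 ⟨kb, rem, I, W, hP, hT, h33, h34⟩
    have f3 {k : ℕ} (h : k ∈ [13, 14, kV]) : s3.arr k = s1.arr k := by
      simp only [List.mem_cons, List.not_mem_nil, or_false] at h
      refine (hs3.arr k ?_).trans rfl
      rcases h with rfl | rfl | rfl <;>
        simp [fillCell, Stmt.warr, d2, d3, d5, d6, d7, d8]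
    have g31 : s3.reg 31 = (ns : ℝ) := by rw [hs3.reg 31 (by simp [fillCell, Stmt.wreg])]; simp [hs2, h31]
    have g16 : s3.reg 16 = w := by
      rw [hs3.reg 16 (by simp [fillCell, Stmt.wreg])]; simp [hs2, hs1.reg 16 (by simp [splitProg, Stmt.forLoop, Stmt.wreg]), h16]
    refine (fillCell_runs hd hsp hP hT hval ((f3 (by simp)).trans eV) hw hpM hu hsum
      (h13.congr (f3 (by simp))) (h14.congr (f3 (by simp))) g31 h33 h34 h20 g16).mono le_rfl ?_
    rintro s4 - ⟨kb, rem, I, W, hP, hT, h33, h34⟩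
    exact ⟨kb, rem, I, W, hP, hT.congr rfl rfl, by simpa using h33, by simpa using h34⟩
  · rintro s4 - ⟨-, kb, rem, I, W, hP, hT, -, -⟩
    exact ⟨I, W, hP.isFilling hsp hw hpM hsum, hT⟩

/-! ### From the tables to the coupling -/

section link

variable {n : ℕ} {a b : Fin n → ℝ}

/-- The list enumerates exactly the support, outside which the summand vanishes. -/
theorem sum_range_list {α : Type} [AddCommMonoid α] (e : Fin (nnz a) ≃ {i : Fin n // a i ≠ 0})
    {F : ℕ → α} {f : Fin n → α} (hF : ∀ k (h : k < nnz a), F k = f (e ⟨k, h⟩))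
    (hf : ∀ i, a i = 0 → f i = 0) : ∑ k ∈ Finset.range (nnz a), F k = ∑ i, f i := by
  rw [Finset.sum_range, Finset.sum_congr rfl fun (k : Fin (nnz a)) _ => hF k k.2,
    e.sum_comp (fun i : {i : Fin n // a i ≠ 0} => f i)]
  rw [← Finset.sum_filter_of_ne (p := fun i => a i ≠ 0) fun i _ hne h0 => hne (hf i h0)]
  exact (Finset.sum_subtype _ (by simp) f).symm

/-- The owner of a piece. -/
def pieceOwner {p M : ℕ} {I : ℕ → ℕ → ℕ} (e : Fin p ≃ {i : Fin n // a i ≠ 0})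
    (h : ∀ u < M, ∀ c < 3, I u c < p) (u : Fin M) (c : Fin 3) : Fin n :=
  e ⟨I u c, h u u.2 c c.2⟩

theorem IsFilling.isCells {M : ℕ} {w : ℝ} {val : ℕ → ℝ} {I : ℕ → ℕ → ℕ} {W : ℕ → ℕ → ℝ}
    (e : Fin (nnz a) ≃ {i : Fin n // a i ≠ 0}) (h : IsFilling (nnz a) M w val I W)
    (hlt : ∀ u < M, ∀ c < 3, I u c < nnz a) (h0 : ∀ u < M, ∀ c < 3, 0 ≤ W u c)
    (hval : ∀ k (h : k < nnz a), val k = a (e ⟨k, h⟩)) :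
    IsCells a w (pieceOwner e hlt) (fun u c => W u c) := by
  refine ⟨fun u c => h0 u u.2 c c.2, fun u => ?_, fun f => ?_⟩
  · rw [← h.sum_eq u u.2, Finset.sum_range]
  · let F : ℕ → ℝ := fun k => if h : k < nnz a then f (e ⟨k, h⟩) else 0
    have hF : ∀ k (h : k < nnz a), val k * F k = a (e ⟨k, h⟩) * f (e ⟨k, h⟩) := by
      intro k hk
      simp only [F, dif_pos hk, hval k hk]
    have := h.total F
    rw [sum_range_list e (f := fun i => a i * f i) hF fun i hi => by rw [hi, zero_mul]] at this
    rw [← this, Finset.sum_range]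
    refine Finset.sum_congr rfl fun u _ => ?_
    rw [Finset.sum_range]
    refine Finset.sum_congr rfl fun c _ => ?_
    simp only [F, dif_pos (hlt u u.2 c c.2)]
    rfl

theorem cellAdj_eq_couplingSum {M L pa pb : ℕ} {w : ℝ} {G I I' : ℕ → ℕ → ℕ} {W W' : ℕ → ℕ → ℝ}
    (ea : Fin pa ≃ {i : Fin n // a i ≠ 0}) (eb : Fin pb ≃ {i : Fin n // b i ≠ 0})
    (hI : ∀ u < M, ∀ c < 3, I u c < pb) (hI' : ∀ u < M, ∀ c < 3, I' u c < pa)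
    {g : Fin L → Fin M → Fin M} (hg : ∀ l v, (g l v : ℕ) = G v l) (i : Fin pb) (j : Fin pa) :
    cellAdj g w (pieceOwner eb hI) (pieceOwner ea hI') (fun u c => W u c) (fun u c => W' u c)
      (eb i) (ea j) = couplingSum M L w G I I' W W' i j := by
  have happ : ∀ {N : ℕ} (F : ℕ → ℕ → ℕ → ℝ) (i j : ℕ),
      (∑ k ∈ Finset.range N, F k) i j = ∑ k : Fin N, F k i j := by
    intro N F i j
    rw [Finset.sum_range, Finset.sum_apply, Finset.sum_apply]
  simp only [cellAdj, couplingSum, happ]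
  refine Finset.sum_congr rfl fun u _ => Finset.sum_congr rfl fun l _ =>
    Finset.sum_congr rfl fun c _ => Finset.sum_congr rfl fun c' _ => ?_
  have e1 : pieceOwner eb hI u c = (eb i : Fin n) ↔ I u c = i := by
    rw [pieceOwner, Subtype.coe_inj, eb.apply_eq_iff_eq, Fin.ext_iff]
  have e2 : pieceOwner ea hI' (g l u) c' = (ea j : Fin n) ↔ I' (G u l) c' = j := by
    rw [pieceOwner, Subtype.coe_inj, ea.apply_eq_iff_eq, Fin.ext_iff, ← hg]
  simp only [entry, e1, e2, hg]

theorem sum_entry {pa pb : ℕ} (F : ℕ → ℕ → ℝ) {i j : ℕ} (hi : i < pb) (hj : j < pa) :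
    (∑ k ∈ Finset.range pb, ∑ l ∈ Finset.range pa, entry k l (F k l)) i j = F i j := by
  simp only [Finset.sum_apply, entry]
  rw [Finset.sum_eq_single i, Finset.sum_eq_single j]
  · simp
  · intro l _ hl; simp [hl]
  · intro h; exact absurd (Finset.mem_range.2 hj) h
  · intro k _ hk; simp [hk]
  · intro h; exact absurd (Finset.mem_range.2 hi) h

end link

/-! ### Output of the full product. -/

theorem inputState_output {n : ℕ} {a b : Fin n → ℝ} {ε : ℝ}
    {ea : Fin (nnz a) ≃ {i : Fin n // a i ≠ 0}} {eb : Fin (nnz b) ≃ {i : Fin n // b i ≠ 0}} :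
    Output (nnz a) (nnz b) 0 0 (inputState a b ε ea eb) := by
  refine ⟨0, fun _ => (0, 0), ?_, le_rfl⟩
  constructor
  case count => simp [inputState]
  case surj => intro i _ j _ h; exact absurd rfl h
  case unseen => intro i _ j _ _; rfl
  all_goals intro k hk; exact absurd hk (Nat.not_lt_zero k)

/-- Output all products. -/
def outputProduct : Stmt :=
  .forLoop 20 2 (.forLoop 21 1 (.set 40 (.var 20) ;; .set 41 (.var 21) ;;
    .set 42 (.get 3 (.var 20) * .get 1 (.var 21) / .var 9) ;; emit))

theorem outputProduct_runs {pa pb B : ℕ} {d : ℝ} {X : ℕ → ℕ → ℝ} {s : RAMState}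
    (h : Output pa pb B X s) (h1 : s.reg 1 = (pa : ℝ)) (h2 : s.reg 2 = (pb : ℝ))
    (h9 : s.reg 9 = d) (hd : 0 < d) (ha : ∀ k < pa, 0 ≤ s.arr 1 k) (hb : ∀ k < pb, 0 ≤ s.arr 3 k) :
    Runs outputProduct s (2 + (pb + 1) * ((2 + (pa + 1) * 87) + 7)) (Output pa pb (B + pb * (pa * 1))
      (X + ∑ i ∈ Finset.range pb, ∑ j ∈ Finset.range pa,
        entry i j (s.arr 3 i * s.arr 1 j / d))) := by
  refine Output.forLoop _ h h2 (by decide) (by decide) (by decide) (by decide) ?_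
  intro i hi s1 hs1 h20 B X h
  refine Output.forLoop (K := 1) (T := 80) _ h ((hs1.reg 1 (by decide)).trans h1) (by decide)
    (by decide) (by decide) (by decide) ?_
  intro j hj s2 hs2 h21 B X h
  have e20 : s2.reg 20 = (i : ℝ) := (hs2.reg 20 (by decide)).trans h20
  have e9 : s2.reg 9 = d := by rw [hs2.reg 9 (by decide), hs1.reg 9 (by decide), h9]
  have e1 : s2.reg 1 = (pa : ℝ) := by rw [hs2.reg 1 (by decide), hs1.reg 1 (by decide), h1]
  have a1 : s2.arr 1 = s.arr 1 := by rw [hs2.arr 1 (by decide), hs1.arr 1 (by decide)]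
  have a3 : s2.arr 3 = s.arr 3 := by rw [hs2.arr 3 (by decide), hs1.arr 3 (by decide)]
  refine Runs.mono (T := 2 + (2 + (8 + 60))) (Runs.seq (T := 2) ?_) (by norm_num)
    fun _ _ h => h
  refine Runs.of_wp ⟨trivial, ?_⟩ (Nat.le_of_ble_eq_true rfl)
  refine Runs.seq (T := 2) (Runs.of_wp ⟨trivial, ?_⟩ (Nat.le_of_ble_eq_true rfl))
  refine Runs.seq (T := 8) (Runs.of_wp ?_ (Nat.le_of_ble_eq_true rfl))
  simp only [Stmt.wp, RExpr.ok_get, RExpr.ok_mul, RExpr.ok_div, RExpr.ok_var, RExpr.eval_mul,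
    RExpr.eval_div, RExpr.eval_var, RExpr.eval_get, RAMState.reg_setReg, RAMState.arr_setReg,
    Nat.reduceEqDiff, if_false, e20, h21, e9, a1, a3, Nat.floor_natCast, true_and]
  refine ⟨hd.ne', ?_⟩
  exact emit_runs (h.congr (by simp) fun _ _ => rfl) (by simpa using e1) (by simp) (by simp)
    (by simp) hi hj (div_nonneg (mul_nonneg (hb i hi) (ha j hj)) hd.le)

/-! ### Parameters -/

/-- Register `5` becomes the least natural number whose product with register `3` is at least
`8192`. -/
def thresholdProg : Stmt := .set 5 1 ;; .loop (.var 5 * .var 3) 8192 (.set 5 (.var 5 + 1))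

/-- Counting upwards replaces rounding: k * ε < 8192 holds exactly for k below ⌈8192 / ε⌉. -/
theorem thresholdProg_runs {ε : ℝ} {s : RAMState} (hε : 0 < ε) (h3 : s.reg 3 = ε) :
    Runs thresholdProg s (2 + (⌈8192 / ε⌉₊ + 1) * 9)
      (fun s' => s'.reg 5 = (⌈8192 / ε⌉₊ : ℝ)) := by
  have hN : 0 < ⌈8192 / ε⌉₊ := Nat.ceil_pos.2 (by positivity)
  have hlt : ∀ k : ℕ, (k : ℝ) * ε < 8192 ↔ k < ⌈8192 / ε⌉₊ := fun k => by
    rw [Nat.lt_ceil, lt_div_iff₀ hε]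
  refine Runs.seq (T := 2) (Runs.of_wp ⟨trivial, ?_⟩ (Nat.le_of_ble_eq_true rfl))
  refine (Runs.loop (T := 4) ⌈8192 / ε⌉₊ (fun k s' => s'.reg 5 = ((k + 1 : ℕ) : ℝ) ∧
    k + 1 ≤ ⌈8192 / ε⌉₊) ?_ ?_ ?_).mono le_rfl ?_
  · simp only [RAMState.reg_setReg, if_true, RExpr.eval_one]
    exact ⟨by simp, hN⟩
  · intro k s' _ _; exact ⟨⟨trivial, trivial⟩, trivial⟩
  · rintro k s' hs ⟨h5, hk⟩ hc
    have e3 : s'.reg 3 = ε := by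
      rw [hs.reg 3 (by decide), RAMState.reg_setReg, if_neg (by decide), h3]
    simp only [RExpr.eval_mul, RExpr.eval_var, RExpr.eval_ofNat, h5, e3, hlt] at hc
    refine ⟨by omega, Runs.of_wp ?_ (Nat.le_of_ble_eq_true rfl)⟩
    simp only [Stmt.wp, RExpr.ok_add, RExpr.ok_var, RExpr.ok_one, RExpr.eval_add, RExpr.eval_var,
      RExpr.eval_one, RAMState.reg_setReg, if_true, h5, true_and]
    exact ⟨by push_cast; rfl, by omega⟩
  · rintro s' hs ⟨k, -, ⟨h5, hk⟩, hc⟩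
    have e3 : s'.reg 3 = ε := by
      rw [hs.reg 3 (by decide), RAMState.reg_setReg, if_neg (by decide), h3]
    simp only [RExpr.eval_mul, RExpr.eval_var, RExpr.eval_ofNat, h5, e3, hlt] at hc
    rw [h5]
    exact_mod_cast (by omega : k + 1 = ⌈8192 / ε⌉₊)

/-- Register `30` holds the truth value of `P`. -/
def PropFlag (P : Prop) (s : RAMState) : Prop := P ∧ s.reg 30 = 1 ∨ ¬ P ∧ s.reg 30 = 0

theorem PropFlag.congr {P P' : Prop} {s s' : RAMState} (h : PropFlag P s) (hP : P ↔ P')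
    (he : s'.reg 30 = s.reg 30) : PropFlag P' s' := by
  rwa [PropFlag, ← hP, he]

/-- Trial multiplication tests primality without division with remainder. -/
theorem prime_iff_forall_mul_ne {q : ℕ} (hq : 2 ≤ q) :
    q.Prime ↔ ∀ i < q, ∀ j < q, i * j ≠ q := by
  constructor
  · intro h i hi j hj e
    rcases h.eq_one_or_self_of_dvd i ⟨j, e.symm⟩ with rfl | rfl
    · omega
    · exact lt_irrefl _ hi
  · intro h
    refine Nat.prime_def_lt.2 ⟨hq, fun m hm hd => ?_⟩
    obtain ⟨c, rfl⟩ := hd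
    by_contra h1
    have hm0 : m ≠ 0 := by rintro rfl; omega
    have hc0 : 0 < c := Nat.pos_of_ne_zero (by rintro rfl; omega)
    have hc : c < m * c := by
      have : 2 * c ≤ m * c := Nat.mul_le_mul_right c (by omega)
      omega
    exact h m hm c hc rfl

/-- Register `30` becomes `1` if register `5` is prime and `0` otherwise. -/
def testPrime : Stmt :=
  .set 30 1 ;; .forLoop 20 5 (.forLoop 21 5 (.ite (.var 20 * .var 21) (.var 5) .skip
    (.ite (.var 5) (.var 20 * .var 21) .skip (.set 30 0))))

theorem testPrime_runs {q : ℕ} {s : RAMState} (hq : 2 ≤ q) (h5 : s.reg 5 = (q : ℝ)) :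
    Runs testPrime s (2 + (2 + (q + 1) * ((2 + (q + 1) * 27) + 7))) (PropFlag q.Prime) := by
  refine Runs.seq (T := 2) (Runs.of_wp ⟨trivial, ?_⟩ (Nat.le_of_ble_eq_true rfl))
  refine (Runs.forLoop (N := q) (T := 2 + (q + 1) * 27)
    (fun i => PropFlag (∀ i' < i, ∀ j < q, i' * j ≠ q)) (by simpa using h5)
    (by decide) (by decide) (by decide) ?_ ?_).mono le_rfl fun s' _ h =>
      h.2.congr (prime_iff_forall_mul_ne hq).symm rfl
  · exact Or.inl ⟨fun i hi => absurd hi (Nat.not_lt_zero i), by simp⟩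
  intro i hi s1 hs1 h20 hF
  have e5 : s1.reg 5 = (q : ℝ) := by rw [hs1.reg 5 (by decide)]; simpa using h5
  refine (Runs.forLoop (N := q) (T := 20)
    (fun j => PropFlag ((∀ i' < i, ∀ j < q, i' * j ≠ q) ∧ ∀ j' < j, i * j' ≠ q)) e5
    (by decide) (by decide) (by decide) ?_ ?_).mono le_rfl fun s' _ h => ?_
  · exact hF.congr (by simp) (by simp)
  · intro j hj s2 hs2 h21 hF
    have i5 : s2.reg 5 = (q : ℝ) := (hs2.reg 5 (by decide)).trans e5
    have i20 : s2.reg 20 = (i : ℝ) := (hs2.reg 20 (by decide)).trans h20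
    have hsucc : (∀ j' < j + 1, i * j' ≠ q) ↔ (∀ j' < j, i * j' ≠ q) ∧ i * j ≠ q :=
      Nat.forall_lt_succ_right
    have e : (i : ℝ) * j = ((i * j : ℕ) : ℝ) := by push_cast; rfl
    refine Runs.of_wp ?_ (Nat.le_of_ble_eq_true rfl)
    simp only [Stmt.wp, RExpr.ok_mul, RExpr.ok_var, RExpr.eval_mul, RExpr.eval_var, i5, i20, h21,
      true_and, and_true, e, Nat.cast_lt, hsucc, RExpr.ok_zero, RExpr.eval_zero]
    refine ⟨fun h => hF.congr (by simp [h.ne]) (by simp), fun h =>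
      ⟨fun h' => hF.congr (by simp [h'.ne']) (by simp), fun h' => Or.inr ⟨fun hn => ?_, by simp⟩⟩⟩
    exact hn.2.2 (by omega)
  · refine h.2.congr ?_ (by simp)
    rw [Nat.forall_lt_succ_right]

/-- Register `5` becomes the next prime. -/
def nextPrime : Stmt :=
  .set 30 0 ;; .loop (.var 30) 1 (testPrime ;; .ite (.var 30) 1 (.set 5 (.var 5 + 1)) .skip)

theorem nextPrime_runs {N : ℕ} {s : RAMState} (hN : 2 ≤ N) (h5 : s.reg 5 = (N : ℝ)) :
    Runs nextPrime s (2 + (N + 1 + 1) * (1 + 1 + (2 + (2 + (2 * N + 1) *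
        ((2 + (2 * N + 1) * 27) + 7)) + 10) + 1))
      (fun s' => ∃ q : ℕ, q.Prime ∧ N ≤ q ∧ q ≤ 2 * N ∧ s'.reg 5 = (q : ℝ)) := by
  -- Bertrand's postulate ends the search. The invariant N + k ≤ p holds while no prime has been
  -- found, so at most N + 1 quadratic tests are made, and the cubic cost stays within N⁴.
  obtain ⟨p, hp, hNp, hpN⟩ := Nat.exists_prime_lt_and_le_two_mul N (by omega)
  refine Runs.seq (T := 2) (Runs.of_wp ⟨trivial, ?_⟩ (Nat.le_of_ble_eq_true rfl))
  refine (Runs.loop (T := 2 + (2 + (2 * N + 1) * ((2 + (2 * N + 1) * 27) + 7)) + 10) (N + 1)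
    (fun k s' => s'.reg 30 = 0 ∧ s'.reg 5 = ((N + k : ℕ) : ℝ) ∧ N + k ≤ p ∨ s'.reg 30 = 1 ∧
      ∃ q : ℕ, q.Prime ∧ N ≤ q ∧ q ≤ 2 * N ∧ s'.reg 5 = (q : ℝ)) ?_ ?_ ?_).mono le_rfl ?_
  · exact Or.inl ⟨by simp, by simpa using h5, by omega⟩
  · intro k s' _ _; exact ⟨trivial, trivial⟩
  · rintro k s' hs (⟨h30, e5, hk⟩ | ⟨h30, -⟩) hc
    · refine ⟨by omega, Runs.andThen (T := 2 + (2 + (2 * N + 1) * ((2 + (2 * N + 1) * 27) + 7)))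
        ((testPrime_runs (by omega) e5).mono ?_ fun _ _ h => h) ?_⟩
      · gcongr <;> omega
      · intro s1 hs1 hF
        have f5 : s1.reg 5 = ((N + k : ℕ) : ℝ) := (hs1.reg 5 (by decide)).trans e5
        refine Runs.of_wp ?_ (Nat.le_of_ble_eq_true rfl)
        simp only [Stmt.wp, RExpr.ok_add, RExpr.ok_var, RExpr.ok_one, RExpr.eval_add,
          RExpr.eval_var, RExpr.eval_one, RAMState.reg_setReg, Nat.reduceEqDiff, if_false, if_true,
          f5, true_and]
        rcases hF with ⟨hpr, h1⟩ | ⟨hpr, h0⟩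
        · refine ⟨fun h => absurd h (by rw [h1]; exact lt_irrefl _), fun _ => Or.inr
            ⟨h1, N + k, hpr, by omega, by omega, rfl⟩⟩
        · refine ⟨fun _ => Or.inl ⟨h0, by push_cast; ring, ?_⟩, fun h => absurd (by rw [h0]; exact
            one_pos) h⟩
          have : N + k ≠ p := fun e => hpr (e ▸ hp)
          omega
    · simp [h30] at hc
  · rintro s' - ⟨k, -, ⟨h30, -⟩ | ⟨-, h⟩, hc⟩
    · simp [h30] at hc
    · exact h

/-- The number of items in register `8`, powers of register `5`, and the sum of the values. -/
def sizeProg : Stmt :=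
  .set 6 (.var 5 * .var 5) ;; .set 7 (.var 6 * .var 6) ;; .set 8 (.var 1 + .var 2) ;; .set 15 3 ;;
    .set 9 0 ;; .forLoop 20 1 (.set 9 (.var 9 + .get 1 (.var 20)))

theorem sizeProg_runs {q pa pb : ℕ} {s : RAMState} (h5 : s.reg 5 = (q : ℝ))
    (h1 : s.reg 1 = (pa : ℝ)) (h2 : s.reg 2 = (pb : ℝ)) :
    Runs sizeProg s (18 + (pa + 1) * 12) (fun s' => s'.reg 6 = ((q * q : ℕ) : ℝ) ∧
      s'.reg 7 = ((q * q * (q * q) : ℕ) : ℝ) ∧ s'.reg 8 = ((pa + pb : ℕ) : ℝ) ∧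
      s'.reg 15 = ((3 : ℕ) : ℝ) ∧ s'.reg 9 = ∑ k ∈ Finset.range pa, s.arr 1 k) := by
  refine Runs.mono (T := 4 + (4 + (4 + (2 + (2 + (2 + (pa + 1) * (5 + 7))))))) ?_ (by omega)
    fun _ _ h => h
  refine Runs.seq (Runs.of_wp ⟨⟨trivial, trivial⟩, ?_⟩ (Nat.le_of_ble_eq_true rfl))
  refine Runs.seq (Runs.of_wp ⟨⟨trivial, trivial⟩, ?_⟩ (Nat.le_of_ble_eq_true rfl))
  refine Runs.seq (Runs.of_wp ⟨⟨trivial, trivial⟩, ?_⟩ (Nat.le_of_ble_eq_true rfl))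
  refine Runs.seq (Runs.of_wp ⟨trivial, ?_⟩ (Nat.le_of_ble_eq_true rfl))
  refine Runs.seq (Runs.of_wp ⟨trivial, ?_⟩ (Nat.le_of_ble_eq_true rfl))
  set s1 := ((((s.setReg 6 _).setReg 7 _).setReg 8 _).setReg 15 _).setReg 9 _ with hs1
  refine (Runs.forLoop (N := pa) (T := 5) (fun k s' =>
    s'.reg 9 = ∑ k ∈ Finset.range k, s.arr 1 k) (by simpa [hs1] using h1) (by decide) (by decide)
    (by decide) ?_ ?_).mono le_rfl ?_
  · simp [hs1]
  · intro k hk s2 hs2 h20 h9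
    have e1 : s2.arr 1 = s.arr 1 := by rw [hs2.arr 1 (by decide)]; rfl
    refine Runs.of_wp ?_ (Nat.le_of_ble_eq_true rfl)
    simp only [Stmt.wp, RExpr.ok_add, RExpr.ok_var, RExpr.ok_get, RExpr.eval_add, RExpr.eval_var,
      RExpr.eval_get, RAMState.reg_setReg, Nat.reduceEqDiff, if_false, if_true, h20, h9, e1,
      Nat.floor_natCast, true_and, Finset.sum_range_succ]
  · rintro s2 hs2 ⟨-, h9⟩
    refine ⟨?_, ?_, ?_, ?_, h9⟩
    · rw [hs2.reg 6 (by decide)]; simp [hs1, h5]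
    · rw [hs2.reg 7 (by decide)]; simp [hs1, h5]
    · rw [hs2.reg 8 (by decide)]; simp [hs1, h1, h2]
    · rw [hs2.reg 15 (by decide)]; simp [hs1]

/-- The shape of the vertex set: registers `10, 12, 13` become `v, j, t` such that `v * q ^ j *
(q ^ 8) ^ t` is between register `8` and twice this number. -/
def shapeProg : Stmt :=
  .set 12 1 ;; .set 11 (.var 5) ;;
    .loop (.var 11 * .var 5) (.var 8 + 1) (.set 11 (.var 11 * .var 5) ;; .set 12 (.var 12 + 1)) ;;
    .set 10 1 ;; .loop (.var 10 * .var 11) (.var 8) (.set 10 (.var 10 + 1)) ;;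
    .set 13 0 ;; .loop 9 (.var 12) (.set 12 (.var 12 - 8) ;; .set 13 (.var 13 + 1))

/-- The first loop finds the exponent k + 1 with q^(k+1) ≤ m < q^(k+2), and the second the least `v`
with v q^(k+1) ≥ m; minimality gives v q^(k+1) < m + q^(k+1) ≤ 2m. The exponent is at least 2
because q² ≤ m, and subtracting 8 while it exceeds 9 leaves `j` between 2 and 9. -/
theorem shapeProg_runs {q m : ℕ} {s : RAMState} (hq : 2 ≤ q) (hm : q * q ≤ m)
    (h5 : s.reg 5 = (q : ℝ)) (h8 : s.reg 8 = (m : ℝ)) :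
    Runs shapeProg s (8 + (m + 1) * 15 + (q + 1) * 9 + (m + 1) * 11) (fun s' => ∃ v j t : ℕ,
      0 < v ∧ v ≤ q ∧ 2 ≤ j ∧ j ≤ 9 ∧ m ≤ v * q ^ j * (q ^ 8) ^ t ∧
      v * q ^ j * (q ^ 8) ^ t ≤ 2 * m ∧ s'.reg 10 = (v : ℝ) ∧ s'.reg 12 = (j : ℝ) ∧
      s'.reg 13 = (t : ℝ)) := by
  refine Runs.mono (T := 2 + (2 + ((m + 1) * (3 + 3 + 8 + 1) + (2 + ((q + 1) * (3 + 1 + 4 + 1) +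
    (2 + (m + 1) * (1 + 1 + 8 + 1))))))) ?_ (by omega) fun _ _ h => h
  refine Runs.seq (Runs.of_wp ⟨trivial, ?_⟩ (Nat.le_of_ble_eq_true rfl))
  refine Runs.seq (Runs.of_wp ⟨trivial, ?_⟩ (Nat.le_of_ble_eq_true rfl))
  refine Runs.andThen (Runs.loop (T := 8) m (fun k s' => s'.reg 11 = ((q ^ (k + 1) : ℕ) : ℝ) ∧
    s'.reg 12 = ((k + 1 : ℕ) : ℝ) ∧ q ^ (k + 1) ≤ m) ?_ ?_ ?_) ?_
  · refine ⟨by simp [h5], by simp, by rw [zero_add, pow_one]; nlinarith⟩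
  · intro k s' _ _; exact ⟨⟨trivial, trivial⟩, trivial, trivial⟩
  · rintro k s' hs ⟨h11, h12, hk⟩ hc
    have e5 : s'.reg 5 = (q : ℝ) := by
      rw [hs.reg 5 (by decide)]; simpa using h5
    have e8 : s'.reg 8 = (m : ℝ) := by
      rw [hs.reg 8 (by decide)]; simpa using h8
    have e1 : ((q ^ (k + 1) : ℕ) : ℝ) * q = ((q ^ (k + 1 + 1) : ℕ) : ℝ) := by push_cast; ring
    have e2 : (m : ℝ) + 1 = ((m + 1 : ℕ) : ℝ) := by push_cast; rfl
    have e3 : ((k + 1 : ℕ) : ℝ) + 1 = ((k + 1 + 1 : ℕ) : ℝ) := by push_cast; rfl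
    simp only [RExpr.eval_mul, RExpr.eval_var, RExpr.eval_add, RExpr.eval_one, h11, e5, e8, e1, e2,
      Nat.cast_lt] at hc
    have := Nat.lt_pow_self (n := k + 1) (a := q) (by omega)
    refine ⟨by omega, Runs.of_wp ?_ (Nat.le_of_ble_eq_true rfl)⟩
    simp only [Stmt.wp, RExpr.ok_add, RExpr.ok_var, RExpr.ok_one, RExpr.ok_mul, RExpr.eval_add,
      RExpr.eval_var, RExpr.eval_mul, RExpr.eval_one, RAMState.reg_setReg, if_true,
      Nat.reduceEqDiff, if_false, h11, h12, e5, e1, e3, true_and]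
    omega
  rintro s1 hs1 ⟨k, -, ⟨h11, h12, hk⟩, hc⟩
  have e5 : s1.reg 5 = (q : ℝ) := by rw [hs1.reg 5 (by decide)]; simpa using h5
  have e8 : s1.reg 8 = (m : ℝ) := by rw [hs1.reg 8 (by decide)]; simpa using h8
  have hk' : m < q ^ (k + 1) * q := by
    have e1 : ((q ^ (k + 1) : ℕ) : ℝ) * q = ((q ^ (k + 1) * q : ℕ) : ℝ) := by push_cast; ring
    have e2 : (m : ℝ) + 1 = ((m + 1 : ℕ) : ℝ) := by push_cast; rfl
    simp only [RExpr.eval_mul, RExpr.eval_var, RExpr.eval_add, RExpr.eval_one, h11, e5, e8, e1, e2,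
      Nat.cast_lt] at hc
    omega
  refine Runs.seq (Runs.of_wp ⟨trivial, ?_⟩ (Nat.le_of_ble_eq_true rfl))
  refine Runs.andThen (Runs.loop (T := 4) q (fun i s' => s'.reg 10 = ((i + 1 : ℕ) : ℝ) ∧
    i * q ^ (k + 1) < m ∧ i + 1 ≤ q) ?_ ?_ ?_) ?_
  · refine ⟨by simp, by nlinarith, by omega⟩
  · intro k s' _ _; exact ⟨⟨trivial, trivial⟩, trivial⟩
  · rintro i s' hs ⟨h10, hi, hiq⟩ hc
    have f11 : s'.reg 11 = ((q ^ (k + 1) : ℕ) : ℝ) := by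
      rw [hs.reg 11 (by decide)]; simpa using h11
    have f8 : s'.reg 8 = (m : ℝ) := by rw [hs.reg 8 (by decide)]; simpa using e8
    have e1 : ((i + 1 : ℕ) : ℝ) * ((q ^ (k + 1) : ℕ) : ℝ) = (((i + 1) * q ^ (k + 1) : ℕ) : ℝ) := by
      push_cast; ring
    have e3 : ((i + 1 : ℕ) : ℝ) + 1 = ((i + 1 + 1 : ℕ) : ℝ) := by push_cast; rfl
    simp only [RExpr.eval_mul, RExpr.eval_var, h10, f11, f8, e1, Nat.cast_lt] at hc
    have : i + 1 < q := by
      by_contra hn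
      have := Nat.mul_le_mul_right (q ^ (k + 1)) (not_lt.1 hn)
      rw [mul_comm q] at this
      omega
    refine ⟨by omega, Runs.of_wp ?_ (Nat.le_of_ble_eq_true rfl)⟩
    simp only [Stmt.wp, RExpr.ok_add, RExpr.ok_var, RExpr.ok_one, RExpr.eval_add,
      RExpr.eval_var, RExpr.eval_one, RAMState.reg_setReg, if_true, h10, e3, true_and]
    omega
  rintro s2 hs2 ⟨i, -, ⟨h10, hi, hiq⟩, hc⟩
  have f12 : s2.reg 12 = ((k + 1 : ℕ) : ℝ) := by rw [hs2.reg 12 (by decide)]; simpa using h12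
  have hi' : m ≤ (i + 1) * q ^ (k + 1) := by
    have f11 : s2.reg 11 = ((q ^ (k + 1) : ℕ) : ℝ) := by
      rw [hs2.reg 11 (by decide)]; simpa using h11
    have f8 : s2.reg 8 = (m : ℝ) := by rw [hs2.reg 8 (by decide)]; simpa using e8
    have e1 : ((i + 1 : ℕ) : ℝ) * ((q ^ (k + 1) : ℕ) : ℝ) = (((i + 1) * q ^ (k + 1) : ℕ) : ℝ) := by
      push_cast; ring
    simp only [RExpr.eval_mul, RExpr.eval_var, h10, f11, f8, e1, Nat.cast_lt] at hc
    omega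
  have hk1 : 1 ≤ k := by
    by_contra h0
    have : k = 0 := by omega
    subst this
    rw [zero_add, pow_one] at hk'
    omega
  have hkm : k + 1 ≤ m := ((Nat.lt_pow_self (n := k + 1) (a := q) (by omega)).le).trans hk
  refine Runs.seq (Runs.of_wp ⟨trivial, ?_⟩ (Nat.le_of_ble_eq_true rfl))
  refine (Runs.loop (T := 8) m (fun t s' => s'.reg 13 = (t : ℝ) ∧ ∃ j : ℕ, 2 ≤ j ∧
    j + 8 * t = k + 1 ∧ s'.reg 12 = (j : ℝ)) ?_ ?_ ?_).mono le_rfl ?_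
  · exact ⟨by simp, k + 1, by omega, by omega, by simpa using f12⟩
  · intro k s' _ _; exact ⟨trivial, trivial⟩
  · rintro t s' hs ⟨h13, j, hj, hjt, g12⟩ hc
    have e9 : (9 : ℝ) = ((9 : ℕ) : ℝ) := by norm_num
    simp only [RExpr.eval_ofNat, RExpr.eval_var, g12] at hc
    have hj9 : 9 < j := by exact_mod_cast hc
    refine ⟨by omega, Runs.of_wp ?_ (Nat.le_of_ble_eq_true rfl)⟩
    simp only [Stmt.wp, RExpr.ok_add, RExpr.ok_sub, RExpr.ok_var, RExpr.ok_one, RExpr.ok_ofNat,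
      RExpr.eval_add, RExpr.eval_sub, RExpr.eval_ofNat,
      RExpr.eval_var, RExpr.eval_one, RAMState.reg_setReg, if_true, Nat.reduceEqDiff, if_false,
      h13, g12, true_and]
    refine ⟨by push_cast; rfl, j - 8, by omega, by omega, ?_⟩
    rw [Nat.cast_sub (by omega)]
    norm_num
  · rintro s3 hs3 ⟨t, -, ⟨h13, j, hj, hjt, g12⟩, hc⟩
    simp only [RExpr.eval_ofNat, RExpr.eval_var, g12] at hc
    have hj9 : j ≤ 9 := by exact_mod_cast (not_lt.1 hc)
    have e : (i + 1) * q ^ j * (q ^ 8) ^ t = (i + 1) * q ^ (k + 1) := by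
      rw [← pow_mul, mul_assoc, ← pow_add, hjt]
    refine ⟨i + 1, j, t, by omega, hiq, hj, hj9, ?_, ?_, ?_, g12, h13⟩
    · rw [e]; exact hi'
    · rw [e, add_mul]; omega
    · rw [hs3.reg 10 (by decide)]; simpa using h10

/-! ### Construction of the expander -/

/-- The permutation tables on the powers of the field with `q` elements. -/
def tablesProg : Stmt := powProg ;; divModProg ;; shiftProg

theorem tablesProg_runs {q J : ℕ} {s : RAMState} (hq : q.Prime) (hJ : 2 ≤ J) (hJ9 : J ≤ 9)
    (h5 : s.reg 5 = (q : ℝ)) (h12 : s.reg 12 = (J : ℝ)) :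
    Runs tablesProg s (4000 * (q ^ J * (q * q))) (fun s' => s'.reg 11 = ((q ^ J : ℕ) : ℝ) ∧
      ExpTable 10 (q ^ J) (q * q) (J / q) s') := by
  have hq2 := hq.two_le
  have hX : q * q ≤ q ^ J := by
    rw [← sq]; exact Nat.pow_le_pow_right hq.pos hJ
  set X := q ^ J with hXd
  refine Runs.mono (T := (4 + (J + 1) * 11) + ((6 + (X + 1) * 27) +
    (2 + (X + 1) * ((2 + (q + 1) * ((2 + (q + 1) * ((30 + (J + 1) * 32) + 7)) + 7)) + 7))))
    (Runs.andThen (powProg_runs h5 h12) ?_) ?_ fun _ _ h => h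
  · intro s1 hs1 h11
    have e5 : s1.reg 5 = (q : ℝ) := (hs1.reg 5 (by decide)).trans h5
    have e12 : s1.reg 12 = (J : ℝ) := (hs1.reg 12 (by decide)).trans h12
    refine Runs.andThen (divModProg_runs hq.pos e5 h11) ?_
    rintro s2 hs2 ⟨h8, h9⟩
    have f11 : s2.reg 11 = (X : ℝ) := (hs2.reg 11 (by decide)).trans h11
    refine (shiftProg_runs hq2 hX ((hs2.reg 5 (by decide)).trans e5) f11
      ((hs2.reg 12 (by decide)).trans e12) h8 h9).mono le_rfl fun s3 hs3 h => ?_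
    exact ⟨(hs3.reg 11 (by decide)).trans f11, expTable_digitShift hq h⟩
  · have hX1 : 1 ≤ X := Nat.one_le_pow _ _ hq.pos
    calc _ ≤ (4 + (9 + 1) * 11) + ((6 + (X + 1) * 27) +
        (2 + (X + 1) * ((2 + (q + 1) * ((2 + (q + 1) * ((30 + (9 + 1) * 32) + 7)) + 7)) + 7))) := by
          gcongr
      _ ≤ _ := by
          clear_value X
          obtain ⟨x, rfl⟩ := Nat.exists_eq_add_of_le hX1
          obtain ⟨y, rfl⟩ := Nat.exists_eq_add_of_le hq2
          ring_nf
          nlinarith [Nat.zero_le (x * y), Nat.zero_le (x * y ^ 2)]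

theorem zigzag_time {V X Q : ℕ} (hV : 1 ≤ V) (hX : 1 ≤ X) (hQ : 1 ≤ Q) :
    2 + (V + 1) * ((2 + (X + 1) * ((2 + (Q + 1) * ((30 + (2 + (Q + 1) * 27)) + 7)) + 7)) + 7) ≤
      1000 * (V * X * (Q * Q)) := by
  obtain ⟨x, rfl⟩ := Nat.exists_eq_add_of_le hV
  obtain ⟨y, rfl⟩ := Nat.exists_eq_add_of_le hX
  obtain ⟨z, rfl⟩ := Nat.exists_eq_add_of_le hQ
  ring_nf
  omega

theorem square_time {V L : ℕ} (hV : 1 ≤ V) (hL : 1 ≤ L) :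
    2 + (V + 1) * ((2 + (L + 1) * ((2 + (L + 1) * 32) + 7)) + 7) ≤ 500 * (V * (L * L)) := by
  obtain ⟨x, rfl⟩ := Nat.exists_eq_add_of_le hV
  obtain ⟨y, rfl⟩ := Nat.exists_eq_add_of_le hL
  ring_nf
  omega

theorem rotation_time {V X : ℕ} (hV : 1 ≤ V) (hX : 1 ≤ X) :
    2 + (V + 1) * ((2 + (2 + (X + 1) * 27)) + 7) ≤ 200 * (V * X) := by
  obtain ⟨x, rfl⟩ := Nat.exists_eq_add_of_le hV
  obtain ⟨y, rfl⟩ := Nat.exists_eq_add_of_le hX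
  ring_nf
  omega

/-- The first expander. -/
def initExpander : Stmt :=
  tablesProg ;; rotationProg ;; zigzagProg ;; .set 10 (.var 10 * .var 11)

/-- The registers and the table of an expander on `V` points. -/
structure HasExpander (q V : ℕ) (s : RAMState) : Prop where
  five : s.reg 5 = (q : ℝ)
  six : s.reg 6 = ((q * q : ℕ) : ℝ)
  seven : s.reg 7 = ((q * q * (q * q) : ℕ) : ℝ)
  ten : s.reg 10 = (V : ℝ)
  table : ExpTable 12 V (q * q * (q * q)) (19 / q) s

/-- The rotations contract by v / q^j ≤ 1 / q because v ≤ q and j ≥ 2. The zig-zag product with the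
translations adds 2·9/q, which gives 19 / q. -/
theorem initExpander_runs {q v j : ℕ} {s : RAMState} (hq : q.Prime) (hv : 0 < v) (hvq : v ≤ q)
    (hj : 2 ≤ j) (hj9 : j ≤ 9) (h5 : s.reg 5 = (q : ℝ)) (h6 : s.reg 6 = ((q * q : ℕ) : ℝ))
    (h7 : s.reg 7 = ((q * q * (q * q) : ℕ) : ℝ)) (h10 : s.reg 10 = (v : ℝ))
    (h12 : s.reg 12 = (j : ℝ)) :
    Runs initExpander s (6000 * (v * q ^ j * q ^ 4)) (HasExpander q (v * q ^ j)) := by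
  have hq0 : (0 : ℝ) < q := by exact_mod_cast hq.pos
  have hX1 : 1 ≤ q ^ j := Nat.one_le_pow _ _ hq.pos
  have hQ1 : 1 ≤ q * q := Nat.mul_pos hq.pos hq.pos
  refine Runs.mono (T := 4000 * (q ^ j * (q * q)) + (200 * (v * q ^ j) +
    (1000 * (v * q ^ j * (q * q * (q * q))) + 4)))
    (Runs.andThen (tablesProg_runs hq hj hj9 h5 h12) ?_) ?_ fun _ _ h => h
  · rintro s1 hs1 ⟨h11, hH⟩
    have e10 : s1.reg 10 = (v : ℝ) := (hs1.reg 10 (by decide)).trans h10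
    refine Runs.andThen ((rotationProg_runs e10 h11 hv hX1).mono (rotation_time hv hX1)
      fun _ _ h => h) ?_
    intro s2 hs2 hW
    have f10 : s2.reg 10 = (v : ℝ) := (hs2.reg 10 (by decide)).trans e10
    have f11 : s2.reg 11 = ((q ^ j : ℕ) : ℝ) := (hs2.reg 11 (by decide)).trans h11
    have f6 : s2.reg 6 = ((q * q : ℕ) : ℝ) := by
      rw [hs2.reg 6 (by decide), hs1.reg 6 (by decide), h6]
    refine Runs.andThen ((zigzagProg_runs f10 f11 f6 hv hX1 hQ1 (by positivity) (by positivity) hW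
      (hH.congr (hs2.arr 10 (by decide)))).mono (zigzag_time hv hX1 hQ1) fun _ _ h => h) ?_
    intro s3 hs3 hG
    have g10 : s3.reg 10 = (v : ℝ) := (hs3.reg 10 (by decide)).trans f10
    have g11 : s3.reg 11 = ((q ^ j : ℕ) : ℝ) := (hs3.reg 11 (by decide)).trans f11
    have gr {r : ℕ} (hr : r ∈ [5, 6, 7]) : s3.reg r = s.reg r := by
      rw [hs3.reg r (by revert hr; revert r; decide), hs2.reg r (by revert hr; revert r; decide),
        hs1.reg r (by revert hr; revert r; decide)]
    refine Runs.of_wp ⟨⟨trivial, trivial⟩, ?_⟩ (Nat.le_of_ble_eq_true rfl)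
    refine ⟨?_, ?_, ?_, ?_, (hG.mono ?_).congr rfl⟩
    · simpa using (gr (by decide)).trans h5
    · rw [RAMState.reg_setReg, if_neg (by decide), gr (by decide), h6]
    · rw [RAMState.reg_setReg, if_neg (by decide), gr (by decide), h7]
    · rw [RAMState.reg_setReg, if_pos rfl, RExpr.eval_mul, RExpr.eval_var, RExpr.eval_var, g10, g11]
      push_cast; rfl
    · have h1 : (v : ℝ) / (q ^ j : ℕ) ≤ 1 / q := by
        rw [div_le_div_iff₀ (by exact_mod_cast hX1) hq0, one_mul]
        have : v * q ≤ q ^ j := by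
          calc v * q ≤ q * q := Nat.mul_le_mul_right q hvq
            _ = q ^ 2 := (sq q).symm
            _ ≤ q ^ j := Nat.pow_le_pow_right hq.pos hj
        exact_mod_cast this
      have h2 : (j : ℝ) / q ≤ 9 / q := by
        have : (j : ℝ) ≤ 9 := by exact_mod_cast hj9
        gcongr
      calc _ ≤ 1 / (q : ℝ) + 2 * (9 / q) := by linarith
        _ = _ := by ring
  · have h2 : q ^ j * (q * q) ≤ v * q ^ j * q ^ 4 := by
      have h3 : q * q ≤ q ^ 4 := by
        rw [← sq]; exact Nat.pow_le_pow_right hq.pos (by norm_num)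
      calc _ ≤ v * q ^ j * (q * q) := Nat.mul_le_mul_right _ (Nat.le_mul_of_pos_left _ hv)
        _ ≤ _ := Nat.mul_le_mul_left _ h3
    have h4 : v * q ^ j ≤ v * q ^ j * q ^ 4 := Nat.le_mul_of_pos_right _ (Nat.pow_pos hq.pos)
    have h5 : v * q ^ j * (q * q * (q * q)) = v * q ^ j * q ^ 4 := by ring
    have h6 : 1 ≤ v * q ^ j := Nat.mul_pos hv hX1
    rw [h5]
    omega

/-- Replace an expander by one on `q ^ 8` times as many points. -/
def growExpander : Stmt :=
  .set 12 8 ;; tablesProg ;; squareProg ;; zigzagProg ;; .set 10 (.var 10 * .var 11)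

/-- The square of the family has q⁸ members, as many as the translated space has points, so the
zig-zag product is defined and has q⁴ members again. The factor reproduces itself: (19/q)² ≤ 3/q
because 361 ≤ 3·121, and 3/q + 2·8/q = 19/q. -/
theorem growExpander_runs {q V : ℕ} {s : RAMState} (hq : q.Prime) (hq' : 121 ≤ q) (hV : 0 < V)
    (h : HasExpander q V s) :
    Runs growExpander s (6000 * (V * q ^ 8 * q ^ 4)) (HasExpander q (V * q ^ 8)) := by
  have hq0 : (0 : ℝ) < q := by exact_mod_cast hq.pos
  have hX1 : 1 ≤ q ^ 8 := Nat.one_le_pow _ _ hq.pos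
  have hQ1 : 1 ≤ q * q := Nat.mul_pos hq.pos hq.pos
  have hL1 : 1 ≤ q * q * (q * q) := Nat.mul_pos hQ1 hQ1
  have hLL : q * q * (q * q) * (q * q * (q * q)) = q ^ 8 := by ring
  obtain ⟨h5, h6, h7, h10, hG⟩ := h
  refine Runs.mono (T := 2 + (4000 * (q ^ 8 * (q * q)) +
    (500 * (V * (q * q * (q * q) * (q * q * (q * q)))) +
    (1000 * (V * q ^ 8 * (q * q * (q * q))) + 4)))) (Runs.seq (T := 2) (Runs.of_wp
      (Q := fun s' => _) ⟨trivial, ?_⟩ (Nat.le_of_ble_eq_true rfl))) ?_ fun _ _ h => h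
  · set s0 := s.setReg 12 _ with hs0
    have e5 : s0.reg 5 = (q : ℝ) := by simpa [hs0] using h5
    refine Runs.andThen (tablesProg_runs (J := 8) hq (by norm_num) (by norm_num) e5
      (by simp [hs0])) ?_
    rintro s1 hs1 ⟨h11, hH⟩
    have fr {r : ℕ} (hr : r ∈ [5, 6, 7, 10]) : s1.reg r = s.reg r := by
      rw [hs1.reg r (by revert hr; revert r; decide), hs0, RAMState.reg_setReg,
        if_neg (by revert hr; revert r; decide)]
    have e10 : s1.reg 10 = (V : ℝ) := (fr (by decide)).trans h10
    refine Runs.andThen ((squareProg_runs e10 ((fr (by decide)).trans h7) hV hL1 (by positivity)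
      (hG.congr (hs1.arr 12 (by decide)))).mono (square_time hV hL1) fun _ _ h => h) ?_
    intro s2 hs2 hW
    rw [hLL] at hW
    have f10 : s2.reg 10 = (V : ℝ) := (hs2.reg 10 (by decide)).trans e10
    have f11 : s2.reg 11 = ((q ^ 8 : ℕ) : ℝ) := (hs2.reg 11 (by decide)).trans h11
    have f6 : s2.reg 6 = ((q * q : ℕ) : ℝ) := by
      rw [hs2.reg 6 (by decide), fr (by decide), h6]
    refine Runs.andThen ((zigzagProg_runs f10 f11 f6 hV hX1 hQ1 (by positivity) (by positivity) hW
      (hH.congr (hs2.arr 10 (by decide)))).mono (zigzag_time hV hX1 hQ1) fun _ _ h => h) ?_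
    intro s3 hs3 hG
    have g10 : s3.reg 10 = (V : ℝ) := (hs3.reg 10 (by decide)).trans f10
    have g11 : s3.reg 11 = ((q ^ 8 : ℕ) : ℝ) := (hs3.reg 11 (by decide)).trans f11
    have gr {r : ℕ} (hr : r ∈ [5, 6, 7]) : s3.reg r = s.reg r := by
      rw [hs3.reg r (by revert hr; revert r; decide), hs2.reg r (by revert hr; revert r; decide),
        fr (List.mem_append_left [10] hr)]
    refine Runs.of_wp ⟨⟨trivial, trivial⟩, ?_⟩ (Nat.le_of_ble_eq_true rfl)
    refine ⟨?_, ?_, ?_, ?_, (hG.mono ?_).congr rfl⟩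
    · simpa using (gr (by decide)).trans h5
    · rw [RAMState.reg_setReg, if_neg (by decide), gr (by decide), h6]
    · rw [RAMState.reg_setReg, if_neg (by decide), gr (by decide), h7]
    · rw [RAMState.reg_setReg, if_pos rfl, RExpr.eval_mul, RExpr.eval_var, RExpr.eval_var, g10, g11]
      push_cast; rfl
    · have hq'' : (121 : ℝ) ≤ q := by exact_mod_cast hq'
      have h1 : (19 / q : ℝ) ^ 2 ≤ 3 / q := by
        rw [div_pow, div_le_div_iff₀ (by positivity) hq0]
        nlinarith
      calc _ ≤ 3 / (q : ℝ) + 2 * (8 / q) := by push_cast; linarith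
        _ = _ := by ring
  · have h2 : q ^ 8 * (q * q) ≤ V * q ^ 8 * q ^ 4 := by
      have h3 : q * q ≤ q ^ 4 := by
        rw [← sq]; exact Nat.pow_le_pow_right hq.pos (by norm_num)
      calc _ ≤ V * q ^ 8 * (q * q) := Nat.mul_le_mul_right _ (Nat.le_mul_of_pos_left _ hV)
        _ ≤ _ := Nat.mul_le_mul_left _ h3
    have h4 : V * q ^ 8 ≤ V * q ^ 8 * q ^ 4 := Nat.le_mul_of_pos_right _ (Nat.pow_pos hq.pos)
    have h5 : V * q ^ 8 * (q * q * (q * q)) = V * q ^ 8 * q ^ 4 := by ring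
    have h6 : 1 ≤ V * q ^ 8 := Nat.mul_pos hV hX1
    rw [h5, hLL]
    omega

/-- The expander on `v * q ^ j * (q ^ 8) ^ t` points. -/
def expanderProg : Stmt := initExpander ;; .forLoop 24 13 growExpander

theorem sum_pow_succ_le {R : ℕ} (hR : 2 ≤ R) (t : ℕ) :
    ∑ k ∈ Finset.range t, R ^ (k + 1) ≤ 2 * R ^ t := by
  induction t with
  | zero => simp
  | succ t ih =>
    rw [Finset.sum_range_succ]
    have : 2 * R ^ t ≤ R ^ (t + 1) := by
      rw [pow_succ, mul_comm]; exact Nat.mul_le_mul_left _ hR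
    omega

/-- Each enlargement costs time proportional to its new table, and the sizes grow by the factor q⁸.
The total is therefore at most twice the last term, up to constants. -/
theorem expanderProg_runs {q v j t : ℕ} {s : RAMState} (hq : q.Prime) (hq' : 121 ≤ q) (hv : 0 < v)
    (hvq : v ≤ q) (hj : 2 ≤ j) (hj9 : j ≤ 9) (h5 : s.reg 5 = (q : ℝ))
    (h6 : s.reg 6 = ((q * q : ℕ) : ℝ)) (h7 : s.reg 7 = ((q * q * (q * q) : ℕ) : ℝ))
    (h10 : s.reg 10 = (v : ℝ)) (h12 : s.reg 12 = (j : ℝ)) (h13 : s.reg 13 = (t : ℝ)) :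
    Runs expanderProg s (20000 * (v * q ^ j * (q ^ 8) ^ t * q ^ 4))
      (HasExpander q (v * q ^ j * (q ^ 8) ^ t)) := by
  have hR : 2 ≤ q ^ 8 := hq.two_le.trans (Nat.le_self_pow (by norm_num) q)
  refine Runs.mono (T := 6000 * (v * q ^ j * q ^ 4) + (2 + ((t + 1) * 7 +
    ∑ k ∈ Finset.range t, 6000 * (v * q ^ j * (q ^ 8) ^ k * q ^ 8 * q ^ 4)))) (Runs.andThen
      (initExpander_runs hq hv hvq hj hj9 h5 h6 h7 h10 h12) ?_) ?_ fun _ _ h => h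
  · intro s1 hs1 h
    refine (Runs.forLoopSum (fun k => 6000 * (v * q ^ j * (q ^ 8) ^ k * q ^ 8 * q ^ 4))
      (fun k => HasExpander q (v * q ^ j * (q ^ 8) ^ k)) ((hs1.reg 13 (by decide)).trans h13)
      (by decide) (by decide) (by decide) ?_ ?_).mono le_rfl fun _ _ h => h.2
    · rw [pow_zero, mul_one]
      exact ⟨by simpa using h.five, by simpa using h.six, by simpa using h.seven,
        by simpa using h.ten, h.table.congr rfl⟩
    · intro k hk s2 hs2 h24 h
      refine (growExpander_runs hq hq' (by have := hq.pos; positivity) h).mono le_rfl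
        fun s3 _ h => ?_
      rw [mul_assoc _ ((q ^ 8) ^ k), ← pow_succ] at h
      exact ⟨by simpa using h.five, by simpa using h.six, by simpa using h.seven,
        by simpa using h.ten, h.table.congr rfl⟩
  · have h1 : ∑ k ∈ Finset.range t, 6000 * (v * q ^ j * (q ^ 8) ^ k * q ^ 8 * q ^ 4) =
        6000 * (v * q ^ j * q ^ 4) * ∑ k ∈ Finset.range t, (q ^ 8) ^ (k + 1) := by
      rw [Finset.mul_sum]
      exact Finset.sum_congr rfl fun k _ => by ring
    have h2 := Nat.mul_le_mul_left (6000 * (v * q ^ j * q ^ 4)) (sum_pow_succ_le hR t)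
    have h3 : t + 1 ≤ (q ^ 8) ^ t := Nat.lt_pow_self (by omega)
    have hB : 1 ≤ v * q ^ j * q ^ 4 := by
      have := hq.pos
      exact Nat.mul_pos (Nat.mul_pos hv (Nat.pow_pos this)) (Nat.pow_pos this)
    have h4 : v * q ^ j * (q ^ 8) ^ t * q ^ 4 = v * q ^ j * q ^ 4 * (q ^ 8) ^ t := by ring
    rw [h1, h4]
    set R := (q ^ 8) ^ t
    set B := v * q ^ j * q ^ 4
    have h5 : R ≤ B * R := Nat.le_mul_of_pos_left _ hB
    have h6 : B ≤ B * R := Nat.le_mul_of_pos_right _ (by omega)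
    have h7 : 6000 * B * (2 * R) = 12000 * (B * R) := by ring
    omega

/-! ### The program -/

/-- The output for many items. -/
def outputExpander : Stmt :=
  shapeProg ;; expanderProg ;; .set 16 (.var 9 / .var 10) ;; fillProg 3 2 15 16 ;;
    fillProg 1 1 17 18 ;; outputCoupling

theorem output_time {M L : ℕ} (hM : 1 ≤ M) (hL : 1 ≤ L) :
    2 + (M + 1) * ((2 + (L + 1) * 2087) + 7) ≤ 9000 * (M * L) := by
  obtain ⟨x, rfl⟩ := Nat.exists_eq_add_of_le hM
  obtain ⟨y, rfl⟩ := Nat.exists_eq_add_of_le hL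
  ring_nf
  omega

theorem outputExpander_runs {q pa pb : ℕ} {d : ℝ} {s : RAMState} (hq : q.Prime) (hq' : 121 ≤ q)
    (hm : q * q ≤ pa + pb) (h1 : s.reg 1 = (pa : ℝ)) (h2 : s.reg 2 = (pb : ℝ))
    (h5 : s.reg 5 = (q : ℝ)) (h6 : s.reg 6 = ((q * q : ℕ) : ℝ))
    (h7 : s.reg 7 = ((q * q * (q * q) : ℕ) : ℝ)) (h8 : s.reg 8 = ((pa + pb : ℕ) : ℝ))
    (h15 : s.reg 15 = ((3 : ℕ) : ℝ)) (h9 : s.reg 9 = d) (hd : 0 < d)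
    (ha : ∀ k < pa, 0 ≤ s.arr 1 k) (hb : ∀ k < pb, 0 ≤ s.arr 3 k)
    (hda : ∑ k ∈ Finset.range pa, s.arr 1 k = d) (hdb : ∑ k ∈ Finset.range pb, s.arr 3 k = d)
    (hO : Output pa pb 0 0 s) :
    Runs outputExpander s (60000 * ((pa + pb) * q ^ 4)) (fun s' => ∃ (M : ℕ) (w : ℝ)
      (G I I' : ℕ → ℕ → ℕ) (W W' : ℕ → ℕ → ℝ) (g : Fin (q * q * (q * q)) → Fin M → Fin M),
      0 < M ∧ M ≤ 2 * (pa + pb) ∧ 0 < w ∧ IsExp g (19 / q) ∧ (∀ l v, (g l v : ℕ) = G v l) ∧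
      IsFilling pb M w (s.arr 3) I W ∧ (∀ u < M, ∀ c < 3, I u c < pb) ∧
      (∀ u < M, ∀ c < 3, 0 ≤ W u c) ∧ IsFilling pa M w (s.arr 1) I' W' ∧
      (∀ u < M, ∀ c < 3, I' u c < pa) ∧ (∀ u < M, ∀ c < 3, 0 ≤ W' u c) ∧
      Output pa pb (M * (q * q * (q * q) * 9))
        (couplingSum M (q * q * (q * q)) w G I I' W W') s') := by
  set m := pa + pb with hmd
  have hL : q * q * (q * q) = q ^ 4 := by ring
  have hL1 : 1 ≤ q ^ 4 := Nat.one_le_pow _ _ hq.pos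
  have hqq : q * q ≤ q ^ 4 := by
    rw [← sq]; exact Nat.pow_le_pow_right hq.pos (by norm_num)
  have hqq' : q ≤ q * q := Nat.le_mul_of_pos_left _ hq.pos
  have hm1 : 1 ≤ m := hq.pos.trans_le (hqq'.trans hm)
  have hmL : m ≤ m * q ^ 4 := Nat.le_mul_of_pos_right _ hL1
  have hLm : q ^ 4 ≤ m * q ^ 4 := Nat.le_mul_of_pos_left _ hm1
  -- Since M ≤ 2m, the expander takes 40000 and the coupling 18000 times m q⁴ steps; the rest is
  -- linear in m and q.
  refine Runs.mono (T := (8 + (m + 1) * 15 + (q + 1) * 9 + (m + 1) * 11) +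
    (20000 * (2 * m * q ^ 4) + (4 + ((20 + (m + 1) * 27 + (2 * m + 1) * 107) +
    ((20 + (m + 1) * 27 + (2 * m + 1) * 107) + 9000 * (2 * m * q ^ 4))))))
    (Runs.andThen (shapeProg_runs hq.two_le hm h5 h8) ?_) ?_ fun _ _ h => h
  swap
  · have e : 2 * m * q ^ 4 = 2 * (m * q ^ 4) := by ring
    rw [e]
    omega
  rintro s1 hs1 ⟨v, j, t, hv, hvq, hj, hj9, hmM, hMm, h10, h12, h13⟩
  have r1 {r : ℕ} (hr : r ∈ [1, 2, 5, 6, 7, 9, 15]) : s1.reg r = s.reg r :=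
    hs1.reg r (by revert hr; revert r; decide)
  have k1 (k : ℕ) : s1.arr k = s.arr k := hs1.arr k List.not_mem_nil
  set M := v * q ^ j * (q ^ 8) ^ t with hMd
  have hM : 0 < M := by omega
  have hMr : (0 : ℝ) < M := by exact_mod_cast hM
  have hMq : M * q ^ 4 ≤ 2 * m * q ^ 4 := Nat.mul_le_mul_right _ hMm
  refine Runs.andThen ((expanderProg_runs hq hq' hv hvq hj hj9 ((r1 (by decide)).trans h5)
    ((r1 (by decide)).trans h6) ((r1 (by decide)).trans h7) h10 h12 h13).mono
    (Nat.mul_le_mul_left _ hMq) fun _ _ h => h) ?_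
  intro s2 hs2 hE
  have r2 {r : ℕ} (hr : r ∈ [1, 2, 9, 15]) : s2.reg r = s.reg r := by
    rw [hs2.reg r (by revert hr; revert r; decide), r1 (by revert hr; revert r; decide)]
  have k2 {k : ℕ} (hk : k ∈ [0, 1, 2, 3, 4, 5, 6, 7]) : s2.arr k = s.arr k := by
    rw [hs2.arr k (by revert hk; revert k; decide), k1]
  refine Runs.seq (T := 4) (Runs.of_wp ⟨⟨trivial, trivial, ?_⟩, ?_⟩ (Nat.le_of_ble_eq_true rfl))
  · rw [RExpr.eval_var, hE.ten]; exact hMr.ne'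
  have ew : RExpr.eval s2 (.var 9 / .var 10) = d / M := by
    rw [RExpr.eval_div, RExpr.eval_var, RExpr.eval_var, hE.ten, r2 (by decide), h9]
  set s3 := s2.setReg 16 (RExpr.eval s2 (.var 9 / .var 10)) with hs3
  set w := d / M with hwd
  have hw : 0 < w := div_pos hd hMr
  have hMw : (M : ℝ) * w = d := by rw [hwd]; field_simp
  have r3 {r : ℕ} (hr : r ∈ [1, 2, 9, 15]) : s3.reg r = s.reg r := by
    rw [hs3, RAMState.reg_setReg, if_neg (by revert hr; revert r; decide), r2 hr]
  have k3 {k : ℕ} (hk : k ∈ [0, 1, 2, 3, 4, 5, 6, 7]) : s3.arr k = s.arr k := k2 hk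
  have e16 : s3.reg 16 = w := by rw [hs3, RAMState.reg_setReg, if_pos rfl, ew]
  have e10 : s3.reg 10 = (M : ℝ) := by
    rw [hs3, RAMState.reg_setReg, if_neg (by decide)]; exact hE.ten
  have e7 : s3.reg 7 = ((q * q * (q * q) : ℕ) : ℝ) := by
    rw [hs3, RAMState.reg_setReg, if_neg (by decide)]; exact hE.seven
  have b3 : s3.arr 3 = s.arr 3 := k3 (by decide)
  refine Runs.andThen ((fillProg_runs (kV := 3) (rp := 2) (kI := 15) (kW := 16) (p := pb) (M := M)
    (w := w) (by decide) ((r3 (by decide)).trans h2) (by decide) (by rwa [b3]) hw hM (by omega)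
    (by rw [b3, hdb, hMw]) e10 e16).mono ?_ fun _ _ h => h) ?_
  · gcongr; omega
  rintro s4 hs4 ⟨I, W, hF, hT⟩
  rw [b3] at hF
  have r4 {r : ℕ} (hr : r ∈ [1, 7, 10, 15, 16]) : s4.reg r = s3.reg r :=
    hs4.reg r (by revert hr; revert r; decide)
  have k4 {k : ℕ} (hk : k ∈ [0, 1, 2, 4, 5, 6, 7, 12]) : s4.arr k = s3.arr k :=
    hs4.arr k (by revert hk; revert k; decide)
  have a4 : s4.arr 1 = s.arr 1 := by rw [k4 (by decide), k3 (by decide)]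
  have f1 : s4.reg 1 = (pa : ℝ) := by rw [r4 (by decide), r3 (by decide), h1]
  refine Runs.andThen ((fillProg_runs (kV := 1) (rp := 1) (kI := 17) (kW := 18) (p := pa) (M := M)
    (w := w) (by decide) f1 (by decide) (by rwa [a4]) hw hM (by omega)
    (by rw [a4, hda, hMw]) ((r4 (by decide)).trans e10) ((r4 (by decide)).trans e16)).mono ?_
    fun _ _ h => h) ?_
  · gcongr; omega
  rintro s5 hs5 ⟨I', W', hF', hT'⟩
  rw [a4] at hF'
  have r5 {r : ℕ} (hr : r ∈ [1, 7, 10, 15, 16]) : s5.reg r = s3.reg r := by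
    rw [← r4 hr]; exact hs5.reg r (by revert hr; revert r; decide)
  have k5 {k : ℕ} (hk : k ∈ [0, 2, 4, 5, 6, 7, 12]) : s5.arr k = s3.arr k := by
    rw [hs5.arr k (by revert hk; revert k; decide), k4 (by revert hk; revert k; decide)]
  have hO5 : Output pa pb 0 0 s5 := by
    refine hO.congr ?_ fun k hk => ?_
    · rw [hs5.reg 4 (by decide), hs4.reg 4 (by decide), hs3, RAMState.reg_setReg,
        if_neg (by decide), hs2.reg 4 (by decide), hs1.reg 4 (by decide)]
    · rw [k5 (by revert hk; revert k; decide), k3 (by revert hk; revert k; decide)]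
  obtain ⟨G, g, hg, hgG, hP⟩ := hE.table
  have hGM : ∀ u < M, ∀ l < q * q * (q * q), G u l < M := by
    intro u hu l hl
    rw [← hgG ⟨l, hl⟩ ⟨u, hu⟩]
    exact (g _ _).2
  have h := outputCoupling_runs hO5 ((hs5.reg 1 (by decide)).trans f1)
    (hT.congr (hs5.arr 15 (by decide)) (hs5.arr 16 (by decide))) hT'
    (hP.congr ((k5 (by decide)).trans rfl)) hGM hw (by rw [hL]; exact hL1)
    ((r5 (by decide)).trans e10) ((r5 (by decide)).trans e7)
    (by rw [r5 (by decide), r3 (by decide), h15]) ((r5 (by decide)).trans e16)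
  refine h.mono ?_ fun s6 _ h6 => ⟨M, w, G, I, I', W, W', g, hM, hMm, hw, hg, hgG, hF, hT.lt,
    hT.nonneg, hF', hT'.lt, hT'.nonneg, ?_⟩
  · refine (output_time hM (by rw [hL]; exact hL1)).trans ?_
    rw [hL]
    exact Nat.mul_le_mul_left _ hMq
  · rwa [zero_add, zero_add] at h6

/-- The program SparseProduct. -/
def sparseProduct : Stmt :=
  thresholdProg ;; nextPrime ;; sizeProg ;; .ite (.var 8) (.var 6) outputProduct outputExpander

theorem sparseProduct_low : sparseProduct.low = true := by decide

theorem nextPrime_time {N : ℕ} (hN : 1 ≤ N) : 2 + (N + 1 + 1) * (1 + 1 + (2 + (2 + (2 * N + 1) *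
    ((2 + (2 * N + 1) * 27) + 7)) + 10) + 1) ≤ 3000 * N ^ 3 := by
  obtain ⟨x, rfl⟩ := Nat.exists_eq_add_of_le hN
  ring_nf
  omega

theorem product_time {pa pb Q : ℕ} (hpa : 1 ≤ pa) (hpb : 1 ≤ pb) (hQ : pa + pb < Q) :
    2 + (pb + 1) * ((2 + (pa + 1) * 87) + 7) ≤ 500 * ((pa + pb) * Q) := by
  have h1 : 2 + (pb + 1) * ((2 + (pa + 1) * 87) + 7) ≤ 500 * ((pa + pb) * (pa + pb)) := by
    obtain ⟨x, rfl⟩ := Nat.exists_eq_add_of_le hpa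
    obtain ⟨y, rfl⟩ := Nat.exists_eq_add_of_le hpb
    ring_nf
    omega
  exact h1.trans (Nat.mul_le_mul_left _ (Nat.mul_le_mul_left _ hQ.le))

/-! ### Correctness and running time of the whole program. -/

section correct

variable {n : ℕ} {a b : Fin n → ℝ} {ε : ℝ}

theorem nnz_pos {e : Fin (nnz a) ≃ {i : Fin n // a i ≠ 0}} (ha0 : a ≠ 0) : 1 ≤ nnz a := by
  obtain ⟨i, hi⟩ := Function.ne_iff.1 ha0
  exact (Nat.zero_le _).trans_lt (e.symm ⟨i, hi⟩).2

theorem isCoupling_prodAdj (ha : ∀ i, 0 ≤ a i) (hb : ∀ i, 0 ≤ b i) (ha0 : a ≠ 0)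
    (hab : l1Norm a = l1Norm b) : IsCoupling a b (prodAdj a b) :=
  ⟨outDeg_prodAdj ha ha0, inDeg_prodAdj hb ha0 hab⟩

/-- `C` is a coupling of small correlation with few entries. -/
structure IsSparseCoupling (a b : Fin n → ℝ) (ε : ℝ) (N : ℕ) (C : Matrix (Fin n) (Fin n) ℝ) :
    Prop where
  nonneg : ∀ i j, 0 ≤ C i j
  isCoupling : IsCoupling a b C
  correlation : ∀ x y, |x ⬝ᵥ (C - prodAdj a b) *ᵥ y| ≤
    ε / 128 / 4 * (∑ i, b i * x i ^ 2 + ∑ i, a i * y i ^ 2)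
  sparse : matNnz C ≤ N

theorem isSparseCoupling_prodAdj {ea : Fin (nnz a) ≃ {i : Fin n // a i ≠ 0}}
    {eb : Fin (nnz b) ≃ {i : Fin n // b i ≠ 0}} {N N' : ℕ} {s : RAMState} (ha : ∀ i, 0 ≤ a i)
    (hb : ∀ i, 0 ≤ b i) (ha0 : a ≠ 0) (hab : l1Norm a = l1Norm b) (hε : 0 < ε)
    (h0 : s.arr 0 = (inputState a b ε ea eb).arr 0) (h2 : s.arr 2 = (inputState a b ε ea eb).arr 2)
    (hO : Output (nnz a) (nnz b) N (∑ i ∈ Finset.range (nnz b), ∑ j ∈ Finset.range (nnz a),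
      entry i j ((inputState a b ε ea eb).arr 3 i * (inputState a b ε ea eb).arr 1 j / l1Norm a)) s)
    (hN : N ≤ N') :
    IsSparseCoupling a b ε N' (prodAdj a b) ∧ HoldsOutput s (prodAdj a b) := by
  have hd := l1Norm_pos ha0
  have hent : ∀ i j, prodAdj a b i j = b i * a j / l1Norm a := fun i j => by
    simp only [prodAdj, Matrix.smul_apply, vecMulVec_apply, smul_eq_mul]
    rw [div_eq_inv_mul]
  obtain ⟨h, hs⟩ := hO.holdsOutput h0 h2 (C := prodAdj a b) (fun i j => by
    rw [sum_entry _ i.2 j.2, hent]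
    simp [inputState]) (fun i j hne => by
    rw [hent] at hne
    constructor <;> intro h <;> simp [h] at hne)
  refine ⟨⟨fun i j => ?_, isCoupling_prodAdj ha hb ha0 hab, fun x y => ?_, hs.trans hN⟩, h⟩
  · rw [hent]; exact div_nonneg (mul_nonneg (hb i) (ha j)) hd.le
  · rw [sub_self, zero_mulVec, dotProduct_zero, abs_zero]
    refine mul_nonneg (by positivity) (add_nonneg ?_ ?_)
    · exact Finset.sum_nonneg fun i _ => mul_nonneg (hb i) (sq_nonneg _)
    · exact Finset.sum_nonneg fun i _ => mul_nonneg (ha i) (sq_nonneg _)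

theorem exists_isSparseCoupling {ea : Fin (nnz a) ≃ {i : Fin n // a i ≠ 0}}
    {eb : Fin (nnz b) ≃ {i : Fin n // b i ≠ 0}} {q M L N N' : ℕ} {w : ℝ} {G I I' : ℕ → ℕ → ℕ}
    {W W' : ℕ → ℕ → ℝ} {g : Fin L → Fin M → Fin M} {s : RAMState} (ha : ∀ i, 0 ≤ a i)
    (hq : 0 < q) (hqε : 8192 ≤ (q : ℝ) * ε)
    (h0 : s.arr 0 = (inputState a b ε ea eb).arr 0) (h2 : s.arr 2 = (inputState a b ε ea eb).arr 2)
    (hM : 0 < M) (hL : 0 < L) (hw : 0 < w) (hg : IsExp g (19 / q))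
    (hgG : ∀ l v, (g l v : ℕ) = G v l)
    (hF : IsFilling (nnz b) M w ((inputState a b ε ea eb).arr 3) I W)
    (hI : ∀ u < M, ∀ c < 3, I u c < nnz b) (hW : ∀ u < M, ∀ c < 3, 0 ≤ W u c)
    (hF' : IsFilling (nnz a) M w ((inputState a b ε ea eb).arr 1) I' W')
    (hI' : ∀ u < M, ∀ c < 3, I' u c < nnz a) (hW' : ∀ u < M, ∀ c < 3, 0 ≤ W' u c)
    (hO : Output (nnz a) (nnz b) N (couplingSum M L w G I I' W W') s) (hN : N ≤ N') :
    ∃ C, IsSparseCoupling a b ε N' C ∧ HoldsOutput s C := by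
  have : NeZero M := ⟨hM.ne'⟩
  have hq0 : (0 : ℝ) < q := by exact_mod_cast hq
  have hB := hF.isCells eb hI hW fun k hk => by simp [inputState, hk]
  have hA := hF'.isCells ea hI' hW' fun k hk => by simp [inputState, hk]
  obtain ⟨h, hs⟩ := hO.holdsOutput h0 h2 (fun i j => cellAdj_eq_couplingSum ea eb hI hI' hgG i j)
    (fun i j hne => by
      simp only [cellAdj] at hne
      obtain ⟨u, -, hne⟩ := Finset.exists_ne_zero_of_sum_ne_zero hne
      obtain ⟨l, -, hne⟩ := Finset.exists_ne_zero_of_sum_ne_zero hne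
      obtain ⟨c, -, hne⟩ := Finset.exists_ne_zero_of_sum_ne_zero hne
      obtain ⟨c', -, hne⟩ := Finset.exists_ne_zero_of_sum_ne_zero hne
      split_ifs at hne with hij
      · rw [← hij.1, ← hij.2]
        constructor
        · exact (eb _).2
        · exact (ea _).2
      · exact absurd rfl hne)
  refine ⟨_, ⟨cellAdj_nonneg hB hA hw.le, isCoupling_cellAdj hL hg hw hB hA, fun x y => ?_,
    hs.trans hN⟩, h⟩
  refine (cellAdj_correlation hL hg hw (by positivity) ha hB hA x y).trans ?_
  refine mul_le_mul_of_nonneg_right ?_ (add_nonneg ?_ ?_)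
  · rw [div_div, div_div, div_le_div_iff₀ (by positivity) (by norm_num)]
    nlinarith
  · refine Finset.sum_nonneg fun i _ => mul_nonneg ?_ (sq_nonneg _)
    -- The test function supported at i writes b i as a sum of weights of pieces, which are
    -- non-negative.
    have := hB.total fun k => if k = i then 1 else 0
    simp only [mul_ite, mul_one, mul_zero, Finset.sum_ite_eq', Finset.mem_univ, if_true] at this
    rw [← this]
    refine Finset.sum_nonneg fun u _ => Finset.sum_nonneg fun c _ => ?_
    split_ifs
    exacts [hB.nonneg u c, le_rfl]
  · exact Finset.sum_nonneg fun i _ => mul_nonneg (ha i) (sq_nonneg _)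

/-- Fewer than q² items are joined completely, with at most (nnz a + nnz b) q² entries. Otherwise
the expander is used, with at most 9 M q⁴ entries. Since M ≤ 2(nnz a + nnz b) and q ≤ 2N, the
constant is 9·2·16 = 288. -/
theorem sparseProduct_runs {ea : Fin (nnz a) ≃ {i : Fin n // a i ≠ 0}}
    {eb : Fin (nnz b) ≃ {i : Fin n // b i ≠ 0}} (ha : ∀ i, 0 ≤ a i) (hb : ∀ i, 0 ≤ b i)
    (ha0 : a ≠ 0) (hab : l1Norm a = l1Norm b) (hε : 0 < ε) (hε' : ε ≤ 1 / 2) :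
    Runs sparseProduct (inputState a b ε ea eb)
      (1000000 * ((nnz a + nnz b) * ⌈8192 / ε⌉₊ ^ 4)) (fun s => ∃ C,
        IsSparseCoupling a b ε (288 * ((nnz a + nnz b) * ⌈8192 / ε⌉₊ ^ 4)) C ∧
        HoldsOutput s C) := by
  set N := ⌈8192 / ε⌉₊ with hN
  set s := inputState a b ε ea eb with hs
  have hNε : 8192 ≤ (N : ℝ) * ε := by
    have := Nat.le_ceil (8192 / ε)
    rwa [div_le_iff₀ hε] at this
  have hN2 : 16384 ≤ N := by
    have : (16384 : ℝ) ≤ N := by nlinarith [Nat.cast_nonneg (α := ℝ) N]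
    exact_mod_cast this
  have hd := l1Norm_pos ha0
  have hb0 : b ≠ 0 := by
    rintro rfl
    rw [hab] at hd
    simp [l1Norm] at hd
  have hpa1 : 1 ≤ nnz a := nnz_pos (e := ea) ha0
  have hpb1 : 1 ≤ nnz b := nnz_pos (e := eb) hb0
  have ea1 : ∀ k (h : k < nnz a), s.arr 1 k = a (ea ⟨k, h⟩) := fun k hk => by
    simp only [hs, inputState]; exact dif_pos hk
  have eb3 : ∀ k (h : k < nnz b), s.arr 3 k = b (eb ⟨k, h⟩) := fun k hk => by
    simp only [hs, inputState]; exact dif_pos hk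
  have ha1 : ∀ k < nnz a, 0 ≤ s.arr 1 k := fun k hk => by rw [ea1 k hk]; exact ha _
  have hb3 : ∀ k < nnz b, 0 ≤ s.arr 3 k := fun k hk => by rw [eb3 k hk]; exact hb _
  have hda : ∑ k ∈ Finset.range (nnz a), s.arr 1 k = l1Norm a := by
    rw [sum_range_list ea ea1 fun i h => h, l1Norm_eq_sum ha]
  have hdb : ∑ k ∈ Finset.range (nnz b), s.arr 3 k = l1Norm a := by
    rw [sum_range_list eb eb3 fun i h => h, hab, l1Norm_eq_sum hb]
  have hm1 : 1 ≤ nnz a + nnz b := by omega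
  have hN3 : N ^ 3 ≤ N ^ 4 := Nat.pow_le_pow_right (by omega) (by norm_num)
  have hN2' : N ^ 2 ≤ N ^ 4 := Nat.pow_le_pow_right (by omega) (by norm_num)
  have hN1 : N ≤ N ^ 4 := Nat.le_self_pow (by norm_num) N
  have hB1 : N ^ 4 ≤ (nnz a + nnz b) * N ^ 4 := Nat.le_mul_of_pos_left _ hm1
  have hB2 : nnz a + nnz b ≤ (nnz a + nnz b) * N ^ 4 := Nat.le_mul_of_pos_right _ (by omega)
  refine Runs.mono (T := (2 + (N + 1) * 9) + (3000 * N ^ 3 + ((18 + (nnz a + 1) * 12) +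
    (1 + 1 + (970000 * ((nnz a + nnz b) * N ^ 4) + 1))))) (Runs.andThen
    (thresholdProg_runs hε (by rw [hs]; rfl)) ?_) (by omega) fun _ _ h => h
  intro s1 hs1 h5
  refine Runs.andThen ((nextPrime_runs (by omega) h5).mono (nextPrime_time (by omega))
    fun _ _ h => h) ?_
  rintro s2 hs2 ⟨q, hq, hNq, hqN, h5⟩
  have r2 {r : ℕ} (hr : r ∈ [1, 2, 4]) : s2.reg r = s.reg r := by
    rw [hs2.reg r (by revert hr; revert r; decide), hs1.reg r (by revert hr; revert r; decide)]
  have k2 : ∀ k, s2.arr k = s.arr k := fun k => by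
    rw [hs2.arr k (List.not_mem_nil), hs1.arr k List.not_mem_nil]
  have e1 : s2.reg 1 = (nnz a : ℝ) := r2 (by decide)
  have e2 : s2.reg 2 = (nnz b : ℝ) := r2 (by decide)
  refine Runs.andThen (sizeProg_runs h5 e1 e2) ?_
  rintro s3 hs3 ⟨h6, h7, h8, h15, h9⟩
  have k3 : ∀ k, s3.arr k = s.arr k := fun k => by rw [hs3.arr k List.not_mem_nil, k2]
  have h1 : s3.reg 1 = (nnz a : ℝ) := (hs3.reg 1 (by decide)).trans e1
  have h2 : s3.reg 2 = (nnz b : ℝ) := (hs3.reg 2 (by decide)).trans e2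
  have h5 : s3.reg 5 = (q : ℝ) := (hs3.reg 5 (by decide)).trans h5
  rw [k2, hda] at h9
  have hO : Output (nnz a) (nnz b) 0 0 s3 := inputState_output.congr
    (by rw [hs3.reg 4 (by decide), r2 (by decide)]) fun k _ => k3 k
  have hq4 : q ^ 4 ≤ 16 * N ^ 4 := by
    calc q ^ 4 ≤ (2 * N) ^ 4 := Nat.pow_le_pow_left hqN 4
      _ = _ := by ring
  have hmq : (nnz a + nnz b) * q ^ 4 ≤ 16 * ((nnz a + nnz b) * N ^ 4) := by
    calc (nnz a + nnz b) * q ^ 4 ≤ (nnz a + nnz b) * (16 * N ^ 4) := Nat.mul_le_mul_left (nnz a + nnz b) hq4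
      _ = _ := by ring
  refine Runs.ite trivial trivial ?_ ?_
  · intro hc
    rw [RExpr.eval_var, RExpr.eval_var, h8, h6, Nat.cast_lt] at hc
    have hqq : (nnz a + nnz b) * (q * q) ≤ 4 * ((nnz a + nnz b) * N ^ 4) := by
      have : q * q ≤ 4 * N ^ 4 := by nlinarith
      calc (nnz a + nnz b) * (q * q) ≤ (nnz a + nnz b) * (4 * N ^ 4) := Nat.mul_le_mul_left (nnz a + nnz b) this
        _ = _ := by ring
    refine (outputProduct_runs hO h1 h2 h9 hd (by rw [k3]; exact ha1)
      (by rw [k3]; exact hb3)).mono ?_ fun s4 hs4 h4 => ?_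
    · refine (product_time hpa1 hpb1 hc).trans ?_
      omega
    · refine ⟨_, isSparseCoupling_prodAdj (ea := ea) (eb := eb) (s := s4) ha hb ha0 hab hε
        ((hs4.arr 0 (by decide)).trans (k3 0)) ((hs4.arr 2 (by decide)).trans (k3 2))
        (by rw [k3, k3, zero_add, zero_add] at h4; exact h4) ?_⟩
      have h3 : nnz b * (nnz a * 1) ≤ (nnz a + nnz b) * (q * q) := Nat.mul_le_mul (by omega) (by omega)
      omega
  · intro hc
    rw [RExpr.eval_var, RExpr.eval_var, h8, h6, Nat.cast_lt] at hc
    refine (outputExpander_runs hq (by omega) (not_lt.1 hc) h1 h2 h5 h6 h7 h8 h15 h9 hd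
      (by rw [k3]; exact ha1) (by rw [k3]; exact hb3) (by rw [k3]; exact hda)
      (by rw [k3]; exact hdb) hO).mono (by omega) ?_
    rintro s4 hs4 ⟨M, w, G, I, I', W, W', g, hM, hMm, hw, hg, hgG, hF, hI, hW, hF', hI', hW', h4⟩
    rw [k3] at hF hF'
    refine exists_isSparseCoupling ha hq.pos (hNε.trans (mul_le_mul_of_nonneg_right
      (by exact_mod_cast hNq) hε.le)) ((hs4.arr 0 (by decide)).trans (k3 0))
      ((hs4.arr 2 (by decide)).trans (k3 2)) hM ?_ hw hg hgG hF hI hW hF' hI' hW' h4 ?_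
    · exact Nat.mul_pos (Nat.mul_pos hq.pos hq.pos) (Nat.mul_pos hq.pos hq.pos)
    · have e : M * (q * q * (q * q) * 9) = 9 * (M * q ^ 4) := by ring
      have h3 : M * q ^ 4 ≤ 2 * ((nnz a + nnz b) * q ^ 4) := by
        rw [← mul_assoc]; exact Nat.mul_le_mul_right _ hMm
      omega

end correct

/-! ### Constants and conclusion. -/

theorem HoldsOutput.congr {n : ℕ} {C : Matrix (Fin n) (Fin n) ℝ} {s s' : RAMState}
    (h : HoldsOutput s C) (h' : Agree s' s) : HoldsOutput s' C := by
  obtain ⟨h1, h2⟩ := h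
  refine ⟨(h'.1 4 (by norm_num)).trans h1, ?_⟩
  rwa [h'.2]

theorem IsBipartiteSparsifier.mono {n : ℕ} {a b : Fin n → ℝ} {δ K K' : ℝ}
    {L : Matrix (Fin n ⊕ Fin n) (Fin n ⊕ Fin n) ℝ} (h : IsBipartiteSparsifier K δ a b L)
    (hK : K ≤ K') : IsBipartiteSparsifier K' δ a b L := by
  obtain ⟨h1, h2, h3, h4, h5⟩ := h
  exact ⟨h1, h2, h3, h4, h5.trans (by gcongr)⟩

/-- Rounding up adds at most 1 ≤ 1/ε. -/
theorem ceil_pow_le {ε : ℝ} (hε : 0 < ε) (hε' : ε ≤ 1 / 2) :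
    (⌈8192 / ε⌉₊ : ℝ) ^ 4 ≤ 8193 ^ 4 / ε ^ 4 := by
  rw [← div_pow]
  refine pow_le_pow_left₀ (Nat.cast_nonneg _) ?_ 4
  have h1 := (Nat.ceil_lt_add_one (by positivity : (0 : ℝ) ≤ 8192 / ε)).le
  have h2 : 1 ≤ 1 / ε := by rw [le_div_iff₀ hε]; linarith
  calc (⌈8192 / ε⌉₊ : ℝ) ≤ 8192 / ε + 1 / ε := by linarith
    _ = 8193 / ε := by ring

/-- The bipartite Laplacian has at most nnz a + nnz b diagonal entries and two copies of C, so the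
constant is 1 + 2·288 = 577. -/
theorem IsSparseCoupling.isBipartiteSparsifier {n : ℕ} {a b : Fin n → ℝ} {ε : ℝ}
    {C : Matrix (Fin n) (Fin n) ℝ} (ha : ∀ i, 0 ≤ a i) (hb : ∀ i, 0 ≤ b i) (ha0 : a ≠ 0)
    (hab : l1Norm a = l1Norm b) (hε : 0 < ε) (hε' : ε ≤ 1 / 2)
    (h : IsSparseCoupling a b ε (288 * ((nnz a + nnz b) * ⌈8192 / ε⌉₊ ^ 4)) C) :
    IsBipartiteSparsifier (577 * 8193 ^ 4) (ε / 128) a b (bipLap a b C) := by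
  refine isBipartiteSparsifier_of_correlation ha hb ha0 hab (by positivity) (by linarith) h.nonneg
    h.isCoupling h.correlation ?_
  have h1 : (matNnz C : ℝ) ≤ 288 * (((nnz a : ℝ) + nnz b) * (⌈8192 / ε⌉₊ : ℝ) ^ 4) := by
    exact_mod_cast h.sparse
  have h2 := ceil_pow_le hε hε'
  have h3 : 1 ≤ 8193 ^ 4 / ε ^ 4 := by
    rw [← div_pow]
    exact one_le_pow₀ (by rw [le_div_iff₀ hε]; linarith)
  have h4 : (0 : ℝ) ≤ (nnz a : ℝ) + nnz b := by positivity
  have h5 := mul_le_mul_of_nonneg_left h2 h4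
  have h6 := mul_le_mul_of_nonneg_left h3 h4
  have h7 : ε ^ 4 ≥ (ε / 128) ^ 4 := pow_le_pow_left₀ (by positivity) (by linarith) 4
  calc (nnz a : ℝ) + nnz b + 2 * matNnz C
      ≤ 577 * (((nnz a : ℝ) + nnz b) * (8193 ^ 4 / ε ^ 4)) := by linarith
    _ = 577 * 8193 ^ 4 * ((nnz a : ℝ) + nnz b) / ε ^ 4 := by ring
    _ ≤ _ := div_le_div_of_nonneg_left (by positivity) (by positivity) h7

/-- The first part: for every `ε/128`-bipartite-sparsifier of the bipartite product graph, the
off-diagonal block has the claimed properties. The second part: one fixed program computes such a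
block, within the claimed time. -/
theorem mainTheorem9 :
    (∀ (n : ℕ) (a b : Fin n → ℝ) (ε K : ℝ) (L : Matrix (Fin n ⊕ Fin n) (Fin n ⊕ Fin n) ℝ),
      (∀ i, 0 ≤ a i) → (∀ i, 0 ≤ b i) → a ≠ 0 → l1Norm a = l1Norm b → 0 < ε → ε ≤ 1 / 2 →
      IsBipartiteSparsifier K (ε / 128) a b L →
        (∀ i j, 0 ≤ blockAdj L i j) ∧
        IsGraphApprox ε (blockAdj L) (prodAdj a b) ∧
        (∀ i, outDeg (blockAdj L) i = outDeg (prodAdj a b) i) ∧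
        (∀ i, inDeg (blockAdj L) i = inDeg (prodAdj a b) i) ∧
        (matNnz (blockAdj L) : ℝ) ≤ 128 ^ 4 * K * ((nnz a : ℝ) + (nnz b : ℝ)) / ε ^ 4 ∧
        (matNnz (dirLap (blockAdj L)) : ℝ) ≤
          128 ^ 4 * K * ((nnz a : ℝ) + (nnz b : ℝ)) / ε ^ 4) ∧
    (∃ (P : RAMProg) (K : ℝ), 0 < K ∧
      ∀ (n : ℕ) (a b : Fin n → ℝ) (ε : ℝ)
        (ea : Fin (nnz a) ≃ {i : Fin n // a i ≠ 0}) (eb : Fin (nnz b) ≃ {i : Fin n // b i ≠ 0}),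
        (∀ i, 0 ≤ a i) → (∀ i, 0 ≤ b i) → a ≠ 0 → l1Norm a = l1Norm b → 0 < ε → ε ≤ 1 / 2 →
        ∃ (L : Matrix (Fin n ⊕ Fin n) (Fin n ⊕ Fin n) ℝ) (t : ℕ) (s : RAMState),
          RAMExec P (inputState a b ε ea eb) t s ∧
          (t : ℝ) ≤ K * ((nnz a : ℝ) + (nnz b : ℝ)) / ε ^ 4 ∧
          HoldsOutput s (blockAdj L) ∧
          IsBipartiteSparsifier K (ε / 128) a b L ∧
          IsGraphApprox ε (blockAdj L) (prodAdj a b) ∧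
          (∀ i, outDeg (blockAdj L) i = outDeg (prodAdj a b) i) ∧
          (∀ i, inDeg (blockAdj L) i = inDeg (prodAdj a b) i) ∧
          (matNnz (blockAdj L) : ℝ) ≤ K * ((nnz a : ℝ) + (nnz b : ℝ)) / ε ^ 4 ∧
          (matNnz (dirLap (blockAdj L)) : ℝ) ≤ K * ((nnz a : ℝ) + (nnz b : ℝ)) / ε ^ 4) := by
  -- One constant has to serve the time, the sparsifier and the entry counts. The first two need at
  -- most 1000000·8193⁴, and the first part multiplies the sparsity constant by 128⁴.
  refine ⟨fun n a b ε K L ha hb ha0 hab hε hε' h => h.graphApprox ha hb ha0 hab hε hε',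
    sparseProduct.code, 128 ^ 4 * (1000000 * 8193 ^ 4), by positivity, ?_⟩
  intro n a b ε ea eb ha hb ha0 hab hε hε'
  obtain ⟨t, s, σ, hex, ht, hag, C, hC, hout⟩ := (sparseProduct_runs (ea := ea) (eb := eb) ha hb ha0
    hab hε hε').exists_exec sparseProduct_low
  have hL := (hC.isBipartiteSparsifier ha hb ha0 hab hε hε').mono
    (by norm_num : (577 * 8193 ^ 4 : ℝ) ≤ 1000000 * 8193 ^ 4)
  obtain ⟨-, h2, h3, h4, h5, h6⟩ := hL.graphApprox ha hb ha0 hab hε hε'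
  refine ⟨bipLap a b C, t, s, hex, ?_, ?_, hL.mono (by norm_num), h2, h3, h4, h5, h6⟩
  · have h1 : (t : ℝ) ≤ 1000000 * (((nnz a : ℝ) + nnz b) * (⌈8192 / ε⌉₊ : ℝ) ^ 4) := by
      exact_mod_cast ht
    have h4 : (0 : ℝ) ≤ (nnz a : ℝ) + nnz b := by positivity
    have h5 := mul_le_mul_of_nonneg_left (ceil_pow_le hε hε') h4
    have h6 : 0 ≤ ((nnz a : ℝ) + nnz b) * (8193 ^ 4 / ε ^ 4) := by positivity
    calc (t : ℝ) ≤ 128 ^ 4 * (1000000 * (((nnz a : ℝ) + nnz b) * (8193 ^ 4 / ε ^ 4))) := by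
          linarith
      _ = _ := by ring
  · rw [blockAdj_bipLap]
    exact hout.congr hag
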